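/- Let $D_-^0\subset\mathbb R^3$ be a bounded domain with boundary of class $C^{1,1}$, let $D_+^0=\mathbb R^3\setminus\overline{D_-^0}$ and $\Gamma^0=\overline{D_-^0}\cap\overline{D_+^0}$, and let $n^0$ be the unit normal field on $\Gamma^0$ pointing into $D_+^0$. Let $\kappa\in C^1(\Gamma^0)$, let $\tilde\kappa\in C^1(\mathbb R^3)$ be a compactly supported extension of $\kappa$, let $\tilde n^0$ be a locally Lipschitz extension of $n^0$ to $\mathbb R^3$, and for $\varepsilon\ge 0$ put $$T^\varepsilon(x)=x+\varepsilon\,\tilde\kappa(x)\,\tilde n^0(x)\quad(x\in\mathbb R^3),\qquad \Gamma^\varepsilon=\{x+\varepsilon\kappa(x)n^0(x):x\in\Gamma^0\},\qquad D_-^\varepsilon=T^\varepsilon(D_-^0),\qquad D_+^\varepsilon=\mathbb R^3\setminus\overline{D_-^\varepsilon}.$$ For an open set $U$ let $\|v\|_{H^1_w(U)}^2=\int_U\big(|\nabla v|^2+\frac{|v|^2}{1+|x|^2}\big)\,dx$, where $\nabla v$ is the weak gradient, and let $W_\varepsilon$ be the space of all $v=(v_-,v_+)\in H^1(D_-^\varepsilon)\times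 H^1_w(D_+^\varepsilon)$ with $[v]:=v_--v_+=0$ on $\Gamma^\varepsilon$ in the sense of traces, with the norm $\|v\|_{W_\varepsilon}=\big(\|v_-\|_{H^1(D_-^\varepsilon)}^2+\|v_+\|_{H^1_w(D_+^\varepsilon)}^2\big)^{1/2}$. Let $W_0^*$ be the dual space of $W_0$ with respect to the $L^2$ inner product; thus $f\in L^2(\mathbb R^3)$ belongs to $W_0^*$ if $|\int_{\mathbb R^3}fv\,dx|\le C\|v\|_{W_0}$ for some constant $C$ and all $v\in W_0\cap L^2(\mathbb R^3)$. Let $\alpha_-,\alpha_+>0$ be constants and $f\in L^2(\mathbb R^3)\cap W_0^*$. For all sufficiently small $\varepsilon\ge 0$ let $u^\varepsilon\in W_\varepsilon$ be the weak solution of the transmission problem $$-\nabla\cdot(\alpha^\varepsilon\nabla u^\varepsilon)=f\ \text{ in }D_-^\varepsilon\cup D_+^\varepsilon,\qquad [u^\varepsilon]=0,\quad \Big[\alpha^\varepsilon\frac{\partial u^\varepsilon}{\partial n}\Big]=0\ \text{ on }\Gamma^\varepsilon,$$ where $\alpha^\varepsilon=\alpha_\pm$ in $D^\varepsilon_\pm$;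 that is, $$\alpha_-\int_{D_-^\varepsilon}\nabla u^\varepsilon\cdot\nabla\varphi\,dx+\alpha_+\int_{D_+^\varepsilon}\nabla u^\varepsilon\cdot\nabla\varphi\,dx=\int_{\mathbb R^3}f\varphi\,dx\qquad\text{for all }\varphi\in C_c^\infty(\mathbb R^3).$$ Then $u^\varepsilon\circ T^\varepsilon\in W_0$ for all sufficiently small $\varepsilon>0$, and $$\lim_{\varepsilon\to 0^+}\|u^\varepsilon\circ T^\varepsilon-u^0\|_{W_0}=0.$$ -/

import Mathlib

open MeasureTheory Set Filter Topology
open scoped ENNReal NNReal ContDiff InnerProductSpace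

noncomputable section

namespace Transmission

/-- Euclidean three-space. -/
abbrev E3 : Type := EuclideanSpace ℝ (Fin 3)

/-! ### Domains, interfaces and normals -/

/-- The exterior `D₊ = ℝ³ \ closure D₋` of `D₋`. -/
def exterior (D : Set E3) : Set E3 := (closure D)ᶜ

/-- The interface `Γ = closure D₋ ∩ closure D₊`. -/
def interface (D : Set E3) : Set E3 := closure D ∩ closure (exterior D)

/-- The boundary of `D` is of class `C^{1,1}`: near each boundary point `x` and for a suitable unit
vector `ν`, the set `D` is the strict subgraph, in the direction `ν`, of a `C¹` function with
Lipschitz derivative on the plane through `x` orthogonal to `ν`. -/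
def HasC11Boundary (D : Set E3) : Prop :=
  ∀ x ∈ frontier D, ∃ ν : E3, ‖ν‖ = 1 ∧
    ∃ ψ : (Submodule.span ℝ {ν})ᗮ → ℝ,
      ContDiff ℝ 1 ψ ∧ (∃ K : ℝ≥0, LipschitzWith K (fderiv ℝ ψ)) ∧
        ∀ᶠ y in 𝓝 x, y ∈ D ↔
          ⟪y - x, ν⟫_ℝ < ψ ((Submodule.span ℝ {ν})ᗮ.orthogonalProjectionOnto (y - x))

/-- A bounded domain (nonempty connected open set) in `ℝ³` with boundary of class `C^{1,1}`. -/
structure IsBoundedC11Domain (D : Set E3) : Prop where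
  isOpen : IsOpen D
  isConnected : IsConnected D
  isBounded : Bornology.IsBounded D
  boundary : HasC11Boundary D

/-- `ν` is the unit vector normal to the interface at `x` that points into the exterior `D₊`. -/
def IsOutwardUnitNormal (D : Set E3) (x ν : E3) : Prop :=
  ‖ν‖ = 1 ∧ (∀ τ ∈ tangentConeAt ℝ (interface D) x, ⟪τ, ν⟫_ℝ = 0) ∧
    ∀ᶠ t : ℝ in 𝓝[>] 0, x + t • ν ∈ exterior D

/-- `κ ∈ C¹(Γ)`: near each point of `Γ`, `κ` is the restriction of a `C¹` function on `ℝ³`. -/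
def IsC1On (Γ : Set E3) (κ : E3 → ℝ) : Prop :=
  ∀ x ∈ Γ, ∃ g : E3 → ℝ, ContDiff ℝ 1 g ∧ ∀ᶠ y in 𝓝[Γ] x, κ y = g y

/-- The perturbed interface `Γ^ε = {x + ε κ(x) n(x) : x ∈ Γ}`. -/
def perturbedInterface (Γ : Set E3) (κ : E3 → ℝ) (n : E3 → E3) (ε : ℝ) : Set E3 :=
  (fun x => x + (ε * κ x) • n x) '' Γ

/-- The perturbation map `T^ε(x) = x + ε κ̃(x) ñ(x)` of `ℝ³`, for extensions `κ̃`, `ñ` of the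
amplitude and of the normal field. -/
def perturbMap (κt : E3 → ℝ) (nt : E3 → E3) (ε : ℝ) (x : E3) : E3 :=
  x + (ε * κt x) • nt x

/-! ### Weak gradients and Sobolev spaces -/

/-- The test functions `C_c^∞(ℝ³)`. -/
def IsTest (φ : E3 → ℝ) : Prop := ContDiff ℝ ∞ φ ∧ HasCompactSupport φ

/-- `g` is the weak gradient of `v` on the open set `U`. -/
def HasWeakGrad (U : Set E3) (v : E3 → ℝ) (g : E3 → E3) : Prop :=
  LocallyIntegrableOn v U ∧ LocallyIntegrableOn g U ∧
    ∀ φ : E3 → ℝ, IsTest φ → tsupport φ ⊆ U →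
      ∫ x in U, v x • gradient φ x = -∫ x in U, φ x • g x

open Classical in
/-- The weak gradient of `v` on `U`, unique up to a null set (a dummy value if there is none). -/
def weakGrad (U : Set E3) (v : E3 → ℝ) : E3 → E3 :=
  if h : ∃ g, HasWeakGrad U v g then h.choose else 0

/-- The square of the `H¹(U)` norm of a weakly differentiable `v`. -/
def h1NormSq (U : Set E3) (v : E3 → ℝ) : ℝ≥0∞ :=
  ∫⁻ x in U, (‖weakGrad U v x‖ₑ ^ 2 + ‖v x‖ₑ ^ 2)

/-- The square of the weighted `H¹_w(U)` norm, `∫_U (|∇v|² + |v|² / (1 + |x|²))`, of a weakly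
differentiable `v`. -/
def h1wNormSq (U : Set E3) (v : E3 → ℝ) : ℝ≥0∞ :=
  ∫⁻ x in U, (‖weakGrad U v x‖ₑ ^ 2 + ‖v x‖ₑ ^ 2 / ENNReal.ofReal (1 + ‖x‖ ^ 2))

/-- `v ∈ H¹(U)`. -/
def MemH1 (U : Set E3) (v : E3 → ℝ) : Prop :=
  (∃ g, HasWeakGrad U v g) ∧ h1NormSq U v < ⊤

/-- `v ∈ H¹_w(U)`. -/
def MemH1w (U : Set E3) (v : E3 → ℝ) : Prop :=
  (∃ g, HasWeakGrad U v g) ∧ h1wNormSq U v < ⊤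

/-- `g` is the trace of `v` on `Γ`, for a Sobolev space with squared norm `N`: some test functions
converge to `v` in that norm while their restrictions to `Γ` converge to `g` in `L²(Γ)`, where
`Γ` carries the surface measure, that is, the two-dimensional Hausdorff measure. -/
def HasTrace (N : (E3 → ℝ) → ℝ≥0∞) (Γ : Set E3) (v g : E3 → ℝ) : Prop :=
  ∃ φ : ℕ → E3 → ℝ, (∀ k, IsTest (φ k)) ∧
    Tendsto (fun k => N (fun x => φ k x - v x)) atTop (𝓝 0) ∧
    Tendsto (fun k => eLpNorm (fun x => φ k x - g x) 2 ((μH[2] : Measure E3).restrict Γ))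
      atTop (𝓝 0)

/-- `[v] = 0` on `Γ`: the traces of `v₋ = v|_{D₋}` and `v₊ = v|_{D₊}` exist and are equal in
`L²(Γ)`. -/
def JumpZero (D Γ : Set E3) (v : E3 → ℝ) : Prop :=
  ∃ g : E3 → ℝ, MemLp g 2 ((μH[2] : Measure E3).restrict Γ) ∧
    HasTrace (h1NormSq D) Γ v g ∧ HasTrace (h1wNormSq (exterior D)) Γ v g

/-- The space `W` of the partition with interior `D₋ = D` and interface `Γ`: pairs
`(v₋, v₊) ∈ H¹(D₋) × H¹_w(D₊)` with `[v] = 0` on `Γ`. A pair is given by a single function `v` with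
`v₋ = v|_{D₋}` and `v₊ = v|_{D₊}`; the values of `v` on the null set `Γ` play no role. -/
def MemW (D Γ : Set E3) (v : E3 → ℝ) : Prop :=
  MemH1 D v ∧ MemH1w (exterior D) v ∧ JumpZero D Γ v

/-- The norm `(‖v₋‖²_{H¹(D₋)} + ‖v₊‖²_{H¹_w(D₊)})^{1/2}` of the space `W`. -/
def wNorm (D : Set E3) (v : E3 → ℝ) : ℝ≥0∞ :=
  (h1NormSq D v + h1wNormSq (exterior D) v) ^ (1 / 2 : ℝ)

/-- `f ∈ L²` belongs to the dual space `W^*` of `W` with respect to the `L²` inner product: the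
functional `v ↦ ∫ f v`, defined on the dense subspace `W ∩ L²`, is bounded in the norm of `W`. -/
def MemWDual (D Γ : Set E3) (f : E3 → ℝ) : Prop :=
  ∃ C : ℝ≥0, ∀ v : E3 → ℝ, MemW D Γ v → MemLp v 2 volume →
    ‖∫ x, f x * v x‖ₑ ≤ C * wNorm D v

/-! ### The transmission problem -/

/-- `u` is a weak solution of the transmission problem `-∇·(α∇u) = f` in `D₋ ∪ D₊` with
`[u] = 0` and `[α ∂u/∂n] = 0` on `Γ`, where `α = αm` in `D₋ = D` and `α = αp` in `D₊`. Membership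
in `W` carries the first jump condition and the decay at infinity; the variational equation
carries the differential equation and the second jump condition. -/
def IsWeakSolution (αm αp : ℝ) (f : E3 → ℝ) (D Γ : Set E3) (u : E3 → ℝ) : Prop :=
  MemW D Γ u ∧ ∀ φ : E3 → ℝ, IsTest φ →
    αm * (∫ x in D, ⟪weakGrad D u x, gradient φ x⟫_ℝ) +
      αp * (∫ x in exterior D, ⟪weakGrad (exterior D) u x, gradient φ x⟫_ℝ) =
        ∫ x, f x * φ x

end Transmission

end

open Transmission

/-!
The perturbed problem is pulled back to the reference configuration by `T = T^ε`, where it becomes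
a transmission problem with slightly changed coefficients and a slightly changed right-hand side;
coercivity then bounds the difference of the solutions.

*The maps.* The displacement `κ̃ ñ` is bounded and Lipschitz, because `κ̃` has compact support. So,
for small `ε`, `T` is a bijection of `ℝ³`, and `T` and its inverse `S` differ from the identity by
maps that are bounded by `δ` and Lipschitz with constant `δ`, where `δ = O(ε)`
(`exists_nearId_perturbMap`). Hausdorff measures change under such maps by a factor close to one.
Hence the space `W` of the perturbed partition is pulled back to that of the reference partition
(`NearId.hasGradW_comp`), where the gradient `G` becomes `(DT)ᵀ G ∘ T`. Traces are carried along by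
approximating Lipschitz functions `φ ∘ T`, with `φ` a test function, again by test functions. The
bilinear form changes by at most `O(δ)` times the product of the `L²` norms of the gradients
(`NearId.abs_integral_inner_pullGrad_sub_le`), and the right-hand side by `∫ f (ψ ∘ S - ψ)`, which is
`O(δ) ‖f‖ ‖∇ψ‖` since `ψ ∘ S - ψ` is an integral of `∇ψ` over segments of length at most `δ`
(`NearId.lintegral_test_comp_sub_le`).

*The estimate.* Let `w = u^ε ∘ T`, and let `Z` be the gradient of `w - u⁰`. The two weak equations
together give `|a(Z, ∇ψ)| ≤ O(δ) (‖∇w‖ + ‖f‖) ‖∇ψ‖` for all test functions `ψ`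
(`abs_integral_sub_le`). Test functions are dense in the weighted energy norm on `ℝ³`
(`exists_test_tendsto`), so `ψ` may be replaced by `w - u⁰`; since `‖∇w‖ ≤ ‖Z‖ + ‖∇u⁰‖`, coercivity
leads to `‖Z‖ = O(δ)` (`l2Norm_sub_le`). Hardy's inequality (`energy_le_of_hasWeakGrad`) bounds the
norm of `W` by `‖Z‖`.

*Gluing.* The density of test functions and Hardy's inequality are used on all of `ℝ³`. For this, the
weak gradients of a function of `W` on the two sides have to form a weak gradient on `ℝ³`, which is
where `[v] = 0` enters (`HasGradW.hasWeakGrad`). Approximating from the two sides by test functions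
`φₖ` and `ψₖ` with the same trace, one has to show that `∫_D ∇((φₖ - ψₖ) η)` tends to zero. It
suffices that `∫_D ∇χ` is bounded by the `L¹` norm of `χ` on the interface (`exists_trace_bound`),
which follows by localization near the boundary and integration along the vertical direction in
graph coordinates.
-/

namespace Transmission

/-! ### Weak gradients -/

lemma IsTest.continuous {φ : E3 → ℝ} (h : IsTest φ) : Continuous φ := h.1.continuous

lemma IsTest.contDiff_one {φ : E3 → ℝ} (h : IsTest φ) : ContDiff ℝ 1 φ :=
  h.1.of_le (by exact_mod_cast le_top)

lemma norm_gradient (φ : E3 → ℝ) (x : E3) : ‖gradient φ x‖ = ‖fderiv ℝ φ x‖ := by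
  simp [gradient]

lemma continuous_gradient {φ : E3 → ℝ} (h : ContDiff ℝ 1 φ) : Continuous (gradient φ) :=
  (InnerProductSpace.toDual ℝ E3).symm.continuous.comp (h.continuous_fderiv one_ne_zero)

lemma tsupport_gradient_subset (φ : E3 → ℝ) : tsupport (gradient φ) ⊆ tsupport φ := by
  refine closure_minimal (fun x hx => ?_) isClosed_closure
  refine support_fderiv_subset ℝ (f := φ) fun h => hx ?_
  simp [gradient, h]

lemma hasCompactSupport_gradient {φ : E3 → ℝ} (h : HasCompactSupport φ) :
    HasCompactSupport (gradient φ) :=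
  h.of_isClosed_subset isClosed_closure (tsupport_gradient_subset φ)

lemma measurable_gradient (φ : E3 → ℝ) : Measurable (gradient φ) :=
  (InnerProductSpace.toDual ℝ E3).symm.continuous.measurable.comp (measurable_fderiv ℝ φ)

lemma norm_gradient_le_of_lipschitz {φ : E3 → ℝ} {C : ℝ≥0} (h : LipschitzWith C φ) (x : E3) :
    ‖gradient φ x‖ ≤ C := by
  rw [norm_gradient]
  exact norm_fderiv_le_of_lipschitz ℝ h

lemma IsTest.exists_lipschitz {φ : E3 → ℝ} (h : IsTest φ) : ∃ C, LipschitzWith C φ :=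
  ContDiff.lipschitzWith_of_hasCompactSupport h.2 h.contDiff_one one_ne_zero

lemma gradient_mul {φ ψ : E3 → ℝ} {x : E3} (hφ : DifferentiableAt ℝ φ x)
    (hψ : DifferentiableAt ℝ ψ x) :
    gradient (fun y => φ y * ψ y) x = φ x • gradient ψ x + ψ x • gradient φ x := by
  simp [gradient, fderiv_fun_mul hφ hψ]

/-- A locally integrable function on an open set times a continuous function with compact support
in that set is integrable. -/
lemma integrable_smul_of_tsupport_subset {F : Type*} [NormedAddCommGroup F] [NormedSpace ℝ F]
    {U : Set E3} {f : E3 → F} {a : E3 → ℝ}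
    (hf : LocallyIntegrableOn f U) (ha : Continuous a) (hc : HasCompactSupport a)
    (hs : tsupport a ⊆ U) : Integrable (fun x => a x • f x) (volume.restrict U) := by
  have h1 : IntegrableOn (fun x => a x • f x) (tsupport a) :=
    (hf.integrableOn_compact_subset hs hc).continuousOn_smul ha.continuousOn hc
  refine Integrable.mono_measure ?_ Measure.restrict_le_self
  exact (integrableOn_iff_integrable_of_support_subset
    ((Function.support_smul_subset_left a f).trans (subset_tsupport a))).1 h1

/-- As `integrable_smul_of_tsupport_subset`, for a scalar function and a vector field. -/
lemma integrable_smul_of_tsupport_subset' {F : Type*} [NormedAddCommGroup F] [NormedSpace ℝ F]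
    {U : Set E3} {f : E3 → ℝ} {a : E3 → F}
    (hf : LocallyIntegrableOn f U) (ha : Continuous a) (hc : HasCompactSupport a)
    (hs : tsupport a ⊆ U) : Integrable (fun x => f x • a x) (volume.restrict U) := by
  have h1 : IntegrableOn (fun x => f x • a x) (tsupport a) :=
    (hf.integrableOn_compact_subset hs hc).smul_continuousOn ha.continuousOn hc
  refine Integrable.mono_measure ?_ Measure.restrict_le_self
  exact (integrableOn_iff_integrable_of_support_subset
    ((Function.support_smul_subset_right f a).trans (subset_tsupport a))).1 h1

/-- The defining identity of the weak gradient, tested with a direction `e`. -/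
lemma HasWeakGrad.integral_mul_fderiv {U : Set E3} {v : E3 → ℝ} {g : E3 → E3}
    (h : HasWeakGrad U v g) {φ : E3 → ℝ} (hφ : IsTest φ) (hs : tsupport φ ⊆ U) (e : E3) :
    ∫ x in U, v x * fderiv ℝ φ x e = -∫ x in U, φ x * ⟪g x, e⟫_ℝ := by
  have h1 := integrable_smul_of_tsupport_subset' h.1 (continuous_gradient hφ.contDiff_one)
    (hasCompactSupport_gradient hφ.2) ((tsupport_gradient_subset φ).trans hs)
  have h2 := integrable_smul_of_tsupport_subset h.2.1 hφ.continuous hφ.2 hs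
  have h3 := congrArg (fun z => ⟪e, z⟫_ℝ) (h.2.2 φ hφ hs)
  simp only [inner_neg_right] at h3
  rw [← integral_inner h1, ← integral_inner h2] at h3
  simpa [inner_smul_right, real_inner_comm, inner_gradient_left, real_inner_comm e] using h3

lemma hasWeakGrad_of_integral_mul_fderiv {U : Set E3} {v : E3 → ℝ} {g : E3 → E3}
    (hv : LocallyIntegrableOn v U) (hg : LocallyIntegrableOn g U)
    (h : ∀ φ : E3 → ℝ, IsTest φ → tsupport φ ⊆ U → ∀ e : E3,
      ∫ x in U, v x * fderiv ℝ φ x e = -∫ x in U, φ x * ⟪g x, e⟫_ℝ) : HasWeakGrad U v g := by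
  refine ⟨hv, hg, fun φ hφ hs => ?_⟩
  have h1 := integrable_smul_of_tsupport_subset' hv (continuous_gradient hφ.contDiff_one)
    (hasCompactSupport_gradient hφ.2) ((tsupport_gradient_subset φ).trans hs)
  have h2 := integrable_smul_of_tsupport_subset hg hφ.continuous hφ.2 hs
  refine ext_inner_left ℝ fun e => ?_
  rw [inner_neg_right, ← integral_inner h1, ← integral_inner h2]
  simpa [inner_smul_right, real_inner_comm, inner_gradient_left, real_inner_comm e] using h φ hφ hs e

lemma HasWeakGrad.ae_eq {U : Set E3} (hU : IsOpen U) {v : E3 → ℝ} {g₁ g₂ : E3 → E3}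
    (h₁ : HasWeakGrad U v g₁) (h₂ : HasWeakGrad U v g₂) : g₁ =ᵐ[volume.restrict U] g₂ := by
  have := hU.ae_eq_zero_of_integral_contDiff_smul_eq_zero (h₁.2.1.sub h₂.2.1) (fun φ h1 h2 h3 => by
    have e1 := h₁.2.2 φ ⟨h1, h2⟩ h3
    rw [h₂.2.2 φ ⟨h1, h2⟩ h3, neg_inj] at e1
    rw [← setIntegral_eq_integral_of_forall_compl_eq_zero (s := U) (fun x hx => by
      rw [image_eq_zero_of_notMem_tsupport fun h => hx (h3 h), zero_smul])]
    simp only [Pi.sub_apply, smul_sub]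
    rw [integral_sub (integrable_smul_of_tsupport_subset h₁.2.1 h1.continuous h2 h3)
      (integrable_smul_of_tsupport_subset h₂.2.1 h1.continuous h2 h3), e1, sub_self])
  filter_upwards [(ae_restrict_iff' hU.measurableSet).2 this] with x hx
  simpa [sub_eq_zero] using hx

lemma hasWeakGrad_weakGrad {U : Set E3} {v : E3 → ℝ} (h : ∃ g, HasWeakGrad U v g) :
    HasWeakGrad U v (weakGrad U v) := by
  rw [weakGrad, dif_pos h]
  exact h.choose_spec

lemma HasWeakGrad.congr {U : Set E3} {v v' : E3 → ℝ} {g g' : E3 → E3} (h : HasWeakGrad U v g)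
    (hv : v =ᵐ[volume.restrict U] v') (hg : g =ᵐ[volume.restrict U] g') :
    HasWeakGrad U v' g' := by
  refine ⟨h.1.congr hv, h.2.1.congr hg, fun φ hφ hs => ?_⟩
  have e1 : ∫ x in U, v' x • gradient φ x = ∫ x in U, v x • gradient φ x :=
    integral_congr_ae (hv.mono fun x hx => by simp only [hx])
  have e2 : ∫ x in U, φ x • g' x = ∫ x in U, φ x • g x :=
    integral_congr_ae (hg.mono fun x hx => by simp only [hx])
  rw [e1, e2, h.2.2 φ hφ hs]

lemma HasWeakGrad.mono {U V : Set E3} {v : E3 → ℝ} {g : E3 → E3} (h : HasWeakGrad U v g)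
    (hVU : V ⊆ U) : HasWeakGrad V v g := by
  refine ⟨h.1.mono_set hVU, h.2.1.mono_set hVU, fun φ hφ hs => ?_⟩
  have h0 : ∀ x ∉ V, φ x = 0 := fun x hx =>
    image_eq_zero_of_notMem_tsupport fun h => hx (hs h)
  have h0' : ∀ x ∉ V, gradient φ x = 0 := fun x hx =>
    image_eq_zero_of_notMem_tsupport fun h => hx (hs (tsupport_gradient_subset φ h))
  have e1 : ∀ W : Set E3, V ⊆ W →
      ∫ x in W, v x • gradient φ x = ∫ x, v x • gradient φ x := fun W hW =>
    setIntegral_eq_integral_of_forall_compl_eq_zero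
      fun x hx => by rw [h0' x fun h => hx (hW h), smul_zero]
  have e2 : ∀ W : Set E3, V ⊆ W → ∫ x in W, φ x • g x = ∫ x, φ x • g x := fun W hW =>
    setIntegral_eq_integral_of_forall_compl_eq_zero
      fun x hx => by rw [h0 x fun h => hx (hW h), zero_smul]
  have := h.2.2 φ hφ (hs.trans hVU)
  rwa [e1 U hVU, e2 U hVU, ← e1 V le_rfl, ← e2 V le_rfl] at this

lemma HasWeakGrad.sub {U : Set E3} {v v' : E3 → ℝ} {g g' : E3 → E3}
    (h : HasWeakGrad U v g) (h' : HasWeakGrad U v' g') :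
    HasWeakGrad U (fun x => v x - v' x) (fun x => g x - g' x) := by
  refine ⟨h.1.sub h'.1, h.2.1.sub h'.2.1, fun φ hφ hs => ?_⟩
  have hg := continuous_gradient hφ.contDiff_one
  have hc := hasCompactSupport_gradient hφ.2
  have hs' := (tsupport_gradient_subset φ).trans hs
  simp only [sub_smul, smul_sub]
  rw [integral_sub (integrable_smul_of_tsupport_subset' h.1 hg hc hs')
      (integrable_smul_of_tsupport_subset' h'.1 hg hc hs'),
    integral_sub (integrable_smul_of_tsupport_subset h.2.1 hφ.continuous hφ.2 hs)
      (integrable_smul_of_tsupport_subset h'.2.1 hφ.continuous hφ.2 hs),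
    h.2.2 φ hφ hs, h'.2.2 φ hφ hs]
  abel

/-- A Lipschitz function is weakly differentiable, and its weak gradient is the gradient given
almost everywhere by Rademacher's theorem. -/
lemma hasWeakGrad_of_lipschitz {φ : E3 → ℝ} {C : ℝ≥0} (h : LipschitzWith C φ) (U : Set E3) :
    HasWeakGrad U φ (gradient φ) := by
  refine HasWeakGrad.mono (U := univ) ?_ (subset_univ U)
  have hb : ∀ x, ‖gradient φ x‖ ≤ ‖(C : ℝ)‖ := fun x => by
    simpa using norm_gradient_le_of_lipschitz h x
  refine hasWeakGrad_of_integral_mul_fderiv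
    (locallyIntegrableOn_univ.2 h.continuous.locallyIntegrable)
    (locallyIntegrableOn_univ.2 ((locallyIntegrable_const (C : ℝ)).mono
      (measurable_gradient φ).aestronglyMeasurable (Eventually.of_forall hb)))
    fun ψ hψ _ e => ?_
  obtain ⟨C', hC'⟩ := hψ.exists_lipschitz
  have := h.integral_lineDeriv_mul_eq (μ := volume) hC' hψ.2 e
  have e1 : ∀ x, lineDeriv ℝ ψ x (-e) = -fderiv ℝ ψ x e := fun x => by
    rw [(hψ.contDiff_one.differentiable one_ne_zero x).lineDeriv_eq_fderiv, map_neg]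
  have e2 : ∫ x, lineDeriv ℝ φ x e * ψ x = ∫ x, ψ x * ⟪gradient φ x, e⟫_ℝ := by
    refine integral_congr_ae ?_
    filter_upwards [h.ae_differentiableAt (μ := volume)] with x hx
    rw [hx.lineDeriv_eq_fderiv, inner_gradient_left, mul_comm]
  rw [e2] at this
  simp only [Measure.restrict_univ]
  rw [this, ← integral_neg]
  simp [e1, mul_comm]

lemma IsTest.hasWeakGrad {φ : E3 → ℝ} (h : IsTest φ) (U : Set E3) :
    HasWeakGrad U φ (gradient φ) :=
  let ⟨_, hC⟩ := h.exists_lipschitz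
  hasWeakGrad_of_lipschitz hC U

/-! ### Energies -/

/-- The energy `∫_U (|g|² + |v|² / c)` of a function `v` and a vector field `g`, usually its weak
gradient, for a positive weight `c`. The weights in use are `1` and `1 + |x|²`. -/
noncomputable def energy (c : E3 → ℝ) (U : Set E3) (v : E3 → ℝ) (g : E3 → E3) : ℝ≥0∞ :=
  ∫⁻ x in U, (‖g x‖ₑ ^ 2 + ‖v x‖ₑ ^ 2 / ENNReal.ofReal (c x))

/-- The constant weight of `H¹`. -/
def unitWeight : E3 → ℝ := fun _ => 1

/-- The weight `1 + |x|²` of `H¹_w`. -/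
noncomputable def decayWeight : E3 → ℝ := fun x => 1 + ‖x‖ ^ 2

lemma h1NormSq_eq_energy (U : Set E3) (v : E3 → ℝ) :
    h1NormSq U v = energy unitWeight U v (weakGrad U v) := by
  simp [h1NormSq, energy, unitWeight]

lemma h1wNormSq_eq_energy (U : Set E3) (v : E3 → ℝ) :
    h1wNormSq U v = energy decayWeight U v (weakGrad U v) := rfl

lemma energy_congr {c : E3 → ℝ} {U : Set E3} {v v' : E3 → ℝ} {g g' : E3 → E3}
    (hv : v =ᵐ[volume.restrict U] v') (hg : g =ᵐ[volume.restrict U] g') :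
    energy c U v g = energy c U v' g' :=
  lintegral_congr_ae (by filter_upwards [hv, hg] with x h1 h2; rw [h1, h2])

lemma energy_weakGrad {c : E3 → ℝ} {U : Set E3} (hU : IsOpen U) {v : E3 → ℝ} {g : E3 → E3}
    (h : HasWeakGrad U v g) : energy c U v (weakGrad U v) = energy c U v g :=
  energy_congr (ae_eq_refl _) ((hasWeakGrad_weakGrad ⟨g, h⟩).ae_eq hU h)

lemma enorm_add_sq_le {F : Type*} [NormedAddCommGroup F] (a b : F) :
    ‖a + b‖ₑ ^ 2 ≤ 2 * ‖a‖ₑ ^ 2 + 2 * ‖b‖ₑ ^ 2 := by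
  have h : (‖a + b‖₊ ^ 2 : ℝ≥0) ≤ 2 * ‖a‖₊ ^ 2 + 2 * ‖b‖₊ ^ 2 := by
    rw [← NNReal.coe_le_coe]
    push_cast
    nlinarith [norm_add_le a b, norm_nonneg (a + b), sq_nonneg (‖a‖ - ‖b‖)]
  simp only [enorm_eq_nnnorm]
  exact_mod_cast h

/-- The weights for which the energy is used: continuous, at least one, and of comparable size at
points of distance at most one. -/
structure IsWeight (c : E3 → ℝ) : Prop where
  continuous : Continuous c
  one_le : ∀ x, 1 ≤ c x
  le_mul : ∀ x y, ‖x - y‖ ≤ 1 → c x ≤ 4 * c y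

lemma isWeight_unitWeight : IsWeight unitWeight :=
  ⟨continuous_const, fun _ => le_rfl, fun _ _ _ => by norm_num [unitWeight]⟩

lemma isWeight_decayWeight : IsWeight decayWeight := by
  refine ⟨by unfold decayWeight; fun_prop, fun x => by simp [decayWeight], fun x y h => ?_⟩
  have h1 : ‖x‖ ≤ ‖y‖ + 1 := by linarith [norm_sub_norm_le x y]
  have h2 : ‖x‖ ^ 2 ≤ (‖y‖ + 1) ^ 2 := by gcongr
  simp only [decayWeight]
  nlinarith [sq_nonneg (‖y‖ - 1)]

lemma IsWeight.measurable {c : E3 → ℝ} (hc : IsWeight c) :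
    Measurable fun x => ENNReal.ofReal (c x) :=
  hc.continuous.measurable.ennreal_ofReal

lemma IsWeight.ofReal_ne_zero {c : E3 → ℝ} (hc : IsWeight c) (x : E3) :
    ENNReal.ofReal (c x) ≠ 0 := by
  simpa using zero_lt_one.trans_le (hc.one_le x)

lemma energy_add_le {c : E3 → ℝ} (hc : IsWeight c) {U : Set E3} {v v' : E3 → ℝ} {g g' : E3 → E3}
    (hv : AEStronglyMeasurable v (volume.restrict U))
    (hg : AEStronglyMeasurable g (volume.restrict U)) :
    energy c U (fun x => v x + v' x) (fun x => g x + g' x) ≤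
      2 * energy c U v g + 2 * energy c U v' g' := by
  have hm : AEMeasurable (fun x => ‖g x‖ₑ ^ 2 + ‖v x‖ₑ ^ 2 / ENNReal.ofReal (c x))
      (volume.restrict U) :=
    (hg.enorm.pow_const 2).add ((hv.enorm.pow_const 2).div hc.measurable.aemeasurable)
  unfold energy
  rw [← lintegral_const_mul'' _ hm, ← lintegral_const_mul' _ _ (by norm_num),
    ← lintegral_add_left' (hm.const_mul 2)]
  refine lintegral_mono fun x => ?_
  calc _ ≤ (2 * ‖g x‖ₑ ^ 2 + 2 * ‖g' x‖ₑ ^ 2) +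
        (2 * ‖v x‖ₑ ^ 2 + 2 * ‖v' x‖ₑ ^ 2) / ENNReal.ofReal (c x) := by
        gcongr
        · exact enorm_add_sq_le _ _
        · exact enorm_add_sq_le _ _
    _ = _ := by
        rw [ENNReal.add_div, mul_div_assoc, mul_div_assoc]; ring

lemma energy_mono_set {c : E3 → ℝ} {U V : Set E3} (h : V ⊆ U) (v : E3 → ℝ) (g : E3 → E3) :
    energy c V v g ≤ energy c U v g :=
  lintegral_mono_set h

lemma lintegral_enorm_sq_le_energy {c : E3 → ℝ} {U : Set E3} (v : E3 → ℝ) (g : E3 → E3) :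
    ∫⁻ x in U, ‖g x‖ₑ ^ 2 ≤ energy c U v g :=
  lintegral_mono fun _ => le_self_add

lemma lintegral_enorm_sq_div_le_energy {c : E3 → ℝ} {U : Set E3} (v : E3 → ℝ) (g : E3 → E3) :
    ∫⁻ x in U, ‖v x‖ₑ ^ 2 / ENNReal.ofReal (c x) ≤ energy c U v g :=
  lintegral_mono fun _ => le_add_self

/-- The Cauchy–Schwarz inequality for nonnegative functions. -/
lemma lintegral_mul_sq_le {α : Type*} [MeasurableSpace α] {μ : Measure α} {f g : α → ℝ≥0∞}
    (hf : AEMeasurable f μ) (hg : AEMeasurable g μ) :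
    (∫⁻ x, f x * g x ∂μ) ^ 2 ≤ (∫⁻ x, f x ^ 2 ∂μ) * ∫⁻ x, g x ^ 2 ∂μ := by
  have h := ENNReal.lintegral_mul_le_Lp_mul_Lq μ Real.HolderConjugate.two_two hf hg
  simp only [Pi.mul_apply, ENNReal.rpow_two] at h
  calc _ ≤ ((∫⁻ x, f x ^ 2 ∂μ) ^ (1 / 2 : ℝ) * (∫⁻ x, g x ^ 2 ∂μ) ^ (1 / 2 : ℝ)) ^ 2 := by gcongr
    _ = _ := by
      rw [mul_pow, ← ENNReal.rpow_natCast, ← ENNReal.rpow_natCast, ← ENNReal.rpow_mul,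
        ← ENNReal.rpow_mul]
      norm_num

/-- If `|F k|² / c` tends to zero in `L¹(U)`, then `|F k| |a|` does, for `a` continuous with compact
support. -/
lemma tendsto_lintegral_mul_of_weighted_sq {F F' : Type*} [NormedAddCommGroup F]
    [NormedAddCommGroup F'] {c : E3 → ℝ} (hc : IsWeight c) {U : Set E3}
    {f : ℕ → E3 → F} (hf : ∀ k, AEStronglyMeasurable (f k) (volume.restrict U))
    (h : Tendsto (fun k => ∫⁻ x in U, ‖f k x‖ₑ ^ 2 / ENNReal.ofReal (c x)) atTop (𝓝 0))
    {a : E3 → F'} (ha : Continuous a) (hs : HasCompactSupport a) :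
    Tendsto (fun k => ∫⁻ x in U, ‖f k x‖ₑ * ‖a x‖ₑ) atTop (𝓝 0) := by
  set M : ℝ≥0∞ := ∫⁻ x in U, (ENNReal.ofReal √(c x) * ‖a x‖ₑ) ^ 2 with hM
  have hsq : Continuous fun x => √(c x) * ‖a x‖ := hc.continuous.sqrt.mul ha.norm
  have hMfin : M ≠ ⊤ := by
    have h1 : HasCompactSupport fun x => (√(c x) * ‖a x‖) ^ 2 :=
      hs.mono fun x hx h0 => hx (by simp [h0])
    have h2 := ((hsq.pow 2).integrable_of_hasCompactSupport (μ := volume) h1).2.ne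
    refine ne_top_of_le_ne_top h2 ((lintegral_mono' Measure.restrict_le_self le_rfl).trans
      (le_of_eq (lintegral_congr fun x => ?_)))
    rw [Pi.pow_apply, enorm_pow, enorm_mul, enorm_norm, Real.enorm_of_nonneg (Real.sqrt_nonneg _)]
  have hkey : ∀ k, (∫⁻ x in U, ‖f k x‖ₑ * ‖a x‖ₑ) ^ 2 ≤
      (∫⁻ x in U, ‖f k x‖ₑ ^ 2 / ENNReal.ofReal (c x)) * M := fun k => by
    have hcs : Measurable fun x => ENNReal.ofReal √(c x) :=
      hc.continuous.sqrt.measurable.ennreal_ofReal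
    have e : ∀ x, ENNReal.ofReal √(c x) ^ 2 = ENNReal.ofReal (c x) := fun x => by
      rw [← ENNReal.ofReal_pow (Real.sqrt_nonneg _), Real.sq_sqrt (zero_le_one.trans (hc.one_le x))]
    have hne : ∀ x, ENNReal.ofReal √(c x) ≠ 0 := fun x => by
      simpa using zero_lt_one.trans_le (hc.one_le x)
    have := lintegral_mul_sq_le (μ := volume.restrict U)
      (f := fun x => ‖f k x‖ₑ / ENNReal.ofReal √(c x)) (g := fun x => ENNReal.ofReal √(c x) * ‖a x‖ₑ)
      ((hf k).enorm.div hcs.aemeasurable)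
      (hcs.aemeasurable.mul ha.enorm.measurable.aemeasurable)
    convert! this using 3
    · funext x
      rw [← mul_assoc, ENNReal.div_mul_cancel (hne x) ENNReal.ofReal_ne_top]
    · funext x
      rw [div_eq_mul_inv, div_eq_mul_inv, mul_pow, ← e x, ENNReal.inv_pow]
  have h2 : Tendsto (fun k => (∫⁻ x in U, ‖f k x‖ₑ * ‖a x‖ₑ) ^ 2) atTop (𝓝 0) := by
    have := ENNReal.Tendsto.mul_const h (Or.inr hMfin)
    rw [zero_mul] at this
    exact tendsto_of_tendsto_of_tendsto_of_le_of_le tendsto_const_nhds this (fun _ => zero_le)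
      hkey
  have h3 := (ENNReal.continuous_rpow_const (y := 1 / 2)).tendsto 0 |>.comp h2
  refine Tendsto.congr (fun k => ?_) (by simpa using h3)
  simp only [Function.comp]
  rw [← ENNReal.rpow_natCast, ← ENNReal.rpow_mul]
  norm_num

lemma tendsto_integral_smul_of_weighted_sq {F : Type*} [NormedAddCommGroup F] [NormedSpace ℝ F]
    {c : E3 → ℝ} (hc : IsWeight c) {U : Set E3} {v : ℕ → E3 → ℝ} {v₀ : E3 → ℝ}
    (hm : ∀ k, AEStronglyMeasurable (fun x => v k x - v₀ x) (volume.restrict U))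
    {a : E3 → F} (ha : Continuous a) (hs : HasCompactSupport a)
    (hi : ∀ k, Integrable (fun x => v k x • a x) (volume.restrict U))
    (hi₀ : Integrable (fun x => v₀ x • a x) (volume.restrict U))
    (h : Tendsto (fun k => ∫⁻ x in U, ‖v k x - v₀ x‖ₑ ^ 2 / ENNReal.ofReal (c x)) atTop (𝓝 0)) :
    Tendsto (fun k => ∫ x in U, v k x • a x) atTop (𝓝 (∫ x in U, v₀ x • a x)) := by
  refine tendsto_integral_of_L1 _ hi₀.aestronglyMeasurable (Eventually.of_forall hi) ?_
  refine (tendsto_lintegral_mul_of_weighted_sq hc hm h ha hs).congr fun k => ?_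
  refine lintegral_congr fun x => ?_
  rw [← sub_smul, enorm_smul]

lemma tendsto_integral_smul_of_sq {F : Type*} [NormedAddCommGroup F] [NormedSpace ℝ F]
    {U : Set E3} {g : ℕ → E3 → F} {g₀ : E3 → F}
    (hm : ∀ k, AEStronglyMeasurable (fun x => g k x - g₀ x) (volume.restrict U))
    {a : E3 → ℝ} (ha : Continuous a) (hs : HasCompactSupport a)
    (hi : ∀ k, Integrable (fun x => a x • g k x) (volume.restrict U))
    (hi₀ : Integrable (fun x => a x • g₀ x) (volume.restrict U))
    (h : Tendsto (fun k => ∫⁻ x in U, ‖g k x - g₀ x‖ₑ ^ 2) atTop (𝓝 0)) :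
    Tendsto (fun k => ∫ x in U, a x • g k x) atTop (𝓝 (∫ x in U, a x • g₀ x)) := by
  refine tendsto_integral_of_L1 _ hi₀.aestronglyMeasurable (Eventually.of_forall hi) ?_
  refine (tendsto_lintegral_mul_of_weighted_sq isWeight_unitWeight hm
    (by simpa [unitWeight] using h) ha hs).congr fun k => ?_
  refine lintegral_congr fun x => ?_
  rw [← smul_sub, enorm_smul, mul_comm]

lemma tendsto_weighted_sq_of_tendsto_energy {c : E3 → ℝ} {U : Set E3} {v : ℕ → E3 → ℝ}
    {g : ℕ → E3 → E3} (h : Tendsto (fun k => energy c U (v k) (g k)) atTop (𝓝 0)) :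
    Tendsto (fun k => ∫⁻ x in U, ‖v k x‖ₑ ^ 2 / ENNReal.ofReal (c x)) atTop (𝓝 0) :=
  tendsto_of_tendsto_of_tendsto_of_le_of_le tendsto_const_nhds h (fun _ => zero_le)
    fun _ => lintegral_enorm_sq_div_le_energy _ _

lemma tendsto_sq_of_tendsto_energy {c : E3 → ℝ} {U : Set E3} {v : ℕ → E3 → ℝ}
    {g : ℕ → E3 → E3} (h : Tendsto (fun k => energy c U (v k) (g k)) atTop (𝓝 0)) :
    Tendsto (fun k => ∫⁻ x in U, ‖g k x‖ₑ ^ 2) atTop (𝓝 0) :=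
  tendsto_of_tendsto_of_tendsto_of_le_of_le tendsto_const_nhds h (fun _ => zero_le)
    fun _ => lintegral_enorm_sq_le_energy _ _

/-- Weak gradients are closed under convergence in energy. -/
lemma hasWeakGrad_of_tendsto_energy {c : E3 → ℝ} (hc : IsWeight c) {U : Set E3}
    {v : ℕ → E3 → ℝ} {g : ℕ → E3 → E3} {v₀ : E3 → ℝ} {g₀ : E3 → E3}
    (h : ∀ k, HasWeakGrad U (v k) (g k))
    (hv : LocallyIntegrableOn v₀ U) (hg : LocallyIntegrableOn g₀ U)
    (hlim : Tendsto (fun k => energy c U (fun x => v k x - v₀ x) (fun x => g k x - g₀ x))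
      atTop (𝓝 0)) : HasWeakGrad U v₀ g₀ := by
  refine ⟨hv, hg, fun φ hφ hs => ?_⟩
  have hgc := continuous_gradient hφ.contDiff_one
  have hgs := hasCompactSupport_gradient hφ.2
  have hs' := (tsupport_gradient_subset φ).trans hs
  have l1 := tendsto_integral_smul_of_weighted_sq hc
    (fun k => ((h k).1.sub hv).aestronglyMeasurable) hgc hgs
    (fun k => integrable_smul_of_tsupport_subset' (h k).1 hgc hgs hs')
    (integrable_smul_of_tsupport_subset' hv hgc hgs hs') (tendsto_weighted_sq_of_tendsto_energy hlim)
  have l2 := tendsto_integral_smul_of_sq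
    (fun k => ((h k).2.1.sub hg).aestronglyMeasurable) hφ.continuous hφ.2
    (fun k => integrable_smul_of_tsupport_subset (h k).2.1 hφ.continuous hφ.2 hs)
    (integrable_smul_of_tsupport_subset hg hφ.continuous hφ.2 hs) (tendsto_sq_of_tendsto_energy hlim)
  refine tendsto_nhds_unique l1 (l2.neg.congr fun k => ?_)
  rw [(h k).2.2 φ hφ hs]

/-- A function of finite energy is locally square integrable, hence locally integrable. -/
lemma locallyIntegrableOn_of_energy {c : E3 → ℝ} (hc : IsWeight c) {U : Set E3} (hU : IsOpen U)
    {v : E3 → ℝ} {g : E3 → E3} (hv : AEStronglyMeasurable v (volume.restrict U))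
    (h : energy c U v g < ⊤) : LocallyIntegrableOn v U := by
  refine (locallyIntegrableOn_iff hU.isLocallyClosed).2 fun K hKU hK => ?_
  obtain ⟨M, hM⟩ := hK.exists_bound_of_continuousOn hc.continuous.continuousOn
  have hfin : IsFiniteMeasure (volume.restrict K) := ⟨by simpa using hK.measure_lt_top⟩
  have h2 : MemLp v 2 (volume.restrict K) := by
    refine ⟨hv.mono_measure (Measure.restrict_mono hKU le_rfl), ?_⟩
    rw [eLpNorm_lt_top_iff_lintegral_rpow_enorm_lt_top two_ne_zero ENNReal.ofNat_ne_top]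
    simp only [ENNReal.toReal_ofNat, ENNReal.rpow_two]
    calc ∫⁻ x in K, ‖v x‖ₑ ^ 2
        ≤ ∫⁻ x in K, ENNReal.ofReal M * (‖v x‖ₑ ^ 2 / ENNReal.ofReal (c x)) := by
          refine setLIntegral_mono_ae' hK.measurableSet (Eventually.of_forall fun x hx => ?_)
          rw [← mul_div_assoc, mul_comm, mul_div_assoc]
          refine le_mul_of_one_le_right zero_le ?_
          rw [ENNReal.le_div_iff_mul_le (Or.inl (hc.ofReal_ne_zero x))
            (Or.inl ENNReal.ofReal_ne_top), one_mul]
          exact ENNReal.ofReal_le_ofReal ((le_abs_self _).trans (hM x hx))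
      _ = ENNReal.ofReal M * ∫⁻ x in K, ‖v x‖ₑ ^ 2 / ENNReal.ofReal (c x) :=
          lintegral_const_mul' _ _ ENNReal.ofReal_ne_top
      _ < ⊤ := ENNReal.mul_lt_top ENNReal.ofReal_lt_top
          ((lintegral_mono_set hKU).trans (lintegral_enorm_sq_div_le_energy v g) |>.trans_lt h)
  exact h2.integrable one_le_two

lemma memLp_of_energy {c : E3 → ℝ} {U : Set E3} {v : E3 → ℝ} {g : E3 → E3}
    (hg : AEStronglyMeasurable g (volume.restrict U)) (h : energy c U v g < ⊤) :
    MemLp g 2 (volume.restrict U) := by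
  refine ⟨hg, ?_⟩
  rw [eLpNorm_lt_top_iff_lintegral_rpow_enorm_lt_top two_ne_zero ENNReal.ofNat_ne_top]
  simp only [ENNReal.toReal_ofNat, ENNReal.rpow_two]
  exact (lintegral_enorm_sq_le_energy v g).trans_lt h

/-! ### Graph coordinates -/

/-- The plane through the origin orthogonal to `ν`. -/
noncomputable abbrev normalPlane (ν : E3) : Submodule ℝ E3 := (Submodule.span ℝ {ν})ᗮ

lemma isAddHaarMeasure_normalPlane {ν : E3} (hν : ‖ν‖ = 1) :
    (μH[2] : Measure (normalPlane ν)).IsAddHaarMeasure := by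
  have : Fact (Module.finrank ℝ E3 = 2 + 1) := ⟨by simp⟩
  have h0 : ν ≠ 0 := fun h => by simp [h] at hν
  have h := Submodule.finrank_orthogonal_span_singleton (𝕜 := ℝ) (n := 2) h0
  have := MeasureTheory.isAddHaarMeasure_hausdorffMeasure (E := normalPlane ν)
  rw [h] at this
  exact_mod_cast this

lemma inner_normalPlane {ν : E3} (q : normalPlane ν) : ⟪(q : E3), ν⟫_ℝ = 0 := by
  rw [real_inner_comm]
  exact Submodule.mem_orthogonal_singleton_iff_inner_right.1 q.2

/-- The coordinates `(q, t) ↦ q + t ν` adapted to the unit vector `ν`. -/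
noncomputable def planeEquiv {ν : E3} (hν : ‖ν‖ = 1) : (normalPlane ν × ℝ) ≃L[ℝ] E3 :=
  ContinuousLinearEquiv.equivOfInverse
    ((normalPlane ν).subtypeL.coprod ((ContinuousLinearMap.id ℝ ℝ).smulRight ν))
    ((normalPlane ν).orthogonalProjectionOnto.prod (innerSL ℝ ν))
    (fun p => by
      ext1
      · simp [Submodule.orthogonalProjectionOnto_orthogonalComplement_singleton_eq_zero]
      · have := inner_normalPlane p.1
        rw [real_inner_comm] at this
        simp [inner_add_right, inner_smul_right, this, hν])
    (fun y => by
      have h := Submodule.starProjection_add_starProjection_orthogonal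
        (K := Submodule.span ℝ {ν}) y
      rw [Submodule.starProjection_singleton] at h
      rw [hν] at h
      simp only [ContinuousLinearMap.prod_apply, ContinuousLinearMap.coprod_apply,
        ContinuousLinearMap.smulRight_apply, ContinuousLinearMap.id_apply, innerSL_apply_apply]
      rw [add_comm]
      simpa using h)

lemma planeEquiv_apply {ν : E3} (hν : ‖ν‖ = 1) (p : normalPlane ν × ℝ) :
    planeEquiv hν p = (p.1 : E3) + p.2 • ν := rfl

lemma planeEquiv_symm_apply {ν : E3} (hν : ‖ν‖ = 1) (y : E3) :
    (planeEquiv hν).symm y = ((normalPlane ν).orthogonalProjectionOnto y, ⟪ν, y⟫_ℝ) := rfl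

/-- Coordinates that flatten the graph of `ψ` over the plane through `x₀` orthogonal to `ν`: the
graph corresponds to `t = 0`, and `t` is the height over the graph. -/
noncomputable def graphChart {ν : E3} (hν : ‖ν‖ = 1) (x₀ : E3) (ψ : normalPlane ν → ℝ)
    (p : normalPlane ν × ℝ) : E3 :=
  x₀ + planeEquiv hν (p.1, p.2 + ψ p.1)

/-- The height of a point over the graph of `ψ`, measured along `ν`. -/
noncomputable def graphHeight {ν : E3} (x₀ : E3) (ψ : normalPlane ν → ℝ) (y : E3) : ℝ :=
  ⟪y - x₀, ν⟫_ℝ - ψ ((normalPlane ν).orthogonalProjectionOnto (y - x₀))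

section Chart

variable {ν : E3} (hν : ‖ν‖ = 1) (x₀ : E3) {ψ : normalPlane ν → ℝ}

lemma orthogonalProjectionOnto_graphChart (p : normalPlane ν × ℝ) :
    (normalPlane ν).orthogonalProjectionOnto (graphChart hν x₀ ψ p - x₀) = p.1 := by
  have := (planeEquiv hν).symm_apply_apply (p.1, p.2 + ψ p.1)
  rw [planeEquiv_symm_apply] at this
  simpa [graphChart] using congrArg Prod.fst this

lemma graphHeight_graphChart (p : normalPlane ν × ℝ) :
    graphHeight x₀ ψ (graphChart hν x₀ ψ p) = p.2 := by
  rw [graphHeight, orthogonalProjectionOnto_graphChart]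
  have := (planeEquiv hν).symm_apply_apply (p.1, p.2 + ψ p.1)
  rw [planeEquiv_symm_apply] at this
  have h2 := congrArg Prod.snd this
  simp only at h2
  rw [real_inner_comm, graphChart, add_sub_cancel_left, h2]
  ring

lemma graphChart_graphHeight (y : E3) :
    graphChart hν x₀ ψ ((normalPlane ν).orthogonalProjectionOnto (y - x₀), graphHeight x₀ ψ y) =
      y := by
  have := (planeEquiv hν).apply_symm_apply (y - x₀)
  rw [planeEquiv_symm_apply] at this
  rw [graphChart, graphHeight]
  simp only [sub_add_cancel]
  rw [real_inner_comm, this]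
  abel

lemma continuous_graphHeight (hψ : Continuous ψ) : Continuous (graphHeight x₀ ψ) := by
  unfold graphHeight
  fun_prop

lemma contDiff_graphChart (hψ : ContDiff ℝ 1 ψ) : ContDiff ℝ 1 (graphChart hν x₀ ψ) := by
  unfold graphChart
  exact contDiff_const.add ((planeEquiv hν).contDiff.comp
    (contDiff_fst.prodMk (contDiff_snd.add (hψ.comp contDiff_fst))))

/-- The graph coordinates as a homeomorphism. -/
noncomputable def graphHomeomorph (hψ : Continuous ψ) : (normalPlane ν × ℝ) ≃ₜ E3 where
  toFun := graphChart hν x₀ ψ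
  invFun y := ((normalPlane ν).orthogonalProjectionOnto (y - x₀), graphHeight x₀ ψ y)
  left_inv p := Prod.ext (orthogonalProjectionOnto_graphChart hν x₀ p)
    (graphHeight_graphChart hν x₀ p)
  right_inv y := graphChart_graphHeight hν x₀ y
  continuous_toFun := by unfold graphChart; fun_prop
  continuous_invFun := by
    have := continuous_graphHeight x₀ hψ
    fun_prop

/-- Change of variables to graph coordinates; the constant relates Lebesgue measure to the product
of two-dimensional Hausdorff measure on the plane with Lebesgue measure on the line. -/
lemma exists_integral_eq_graphChart : ∃ c : ℝ≥0, ∀ (x₀ : E3) (ψ : normalPlane ν → ℝ) (F : E3 → ℝ),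
    Integrable F → ∫ y, F y = c * ∫ q, ∫ t : ℝ, F (graphChart hν x₀ ψ (q, t)) ∂volume ∂μH[2] := by
  have := isAddHaarMeasure_normalPlane hν
  let m : Measure E3 := ((μH[2] : Measure (normalPlane ν)).prod volume).map (planeEquiv hν)
  have hm : m.IsAddHaarMeasure := ContinuousLinearEquiv.isAddHaarMeasure_map _ _
  have hme : MeasurableEmbedding (planeEquiv hν) :=
    (planeEquiv hν).toHomeomorph.measurableEmbedding
  refine ⟨Measure.addHaarScalarFactor (volume : Measure E3) m, fun x₀ ψ F hF => ?_⟩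
  have e0 : (volume : Measure E3) = Measure.addHaarScalarFactor (volume : Measure E3) m • m :=
    Measure.isAddLeftInvariant_eq_smul _ _
  have e1 : (m : Measure E3) = Measure.addHaarScalarFactor m (volume : Measure E3) • volume :=
    Measure.isAddLeftInvariant_eq_smul _ _
  have hF' : Integrable (fun y => F (x₀ + y)) := hF.comp_add_left x₀
  have hFm : Integrable (fun p => F (x₀ + planeEquiv hν p))
      ((μH[2] : Measure (normalPlane ν)).prod volume) := by
    have : Integrable (fun y => F (x₀ + y)) m := by
      rw [e1]; exact hF'.smul_measure_nnreal
    exact (hme.integrable_map_iff).1 this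
  calc ∫ y, F y = ∫ y, F (x₀ + y) := (integral_add_left_eq_self F x₀).symm
    _ = Measure.addHaarScalarFactor (volume : Measure E3) m * ∫ y, F (x₀ + y) ∂m := by
      conv_lhs => rw [e0]
      rw [integral_smul_nnreal_measure, NNReal.smul_def, smul_eq_mul]
    _ = _ := by
      rw [hme.integral_map, integral_prod _ hFm]
      congr 1
      refine integral_congr_ae (Eventually.of_forall fun q => ?_)
      exact (integral_add_right_eq_self (fun t => F (x₀ + planeEquiv hν (q, t))) (ψ q)).symm

/-- The derivative of a `C¹` function with compact support has integral zero. -/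
lemma integral_fderiv_eq_zero {E : Type*} [NormedAddCommGroup E] [NormedSpace ℝ E]
    [FiniteDimensional ℝ E] [MeasurableSpace E] [BorelSpace E] (μ : Measure E) [μ.IsAddHaarMeasure]
    {χ : E → ℝ} (h : ContDiff ℝ 1 χ) (hs : HasCompactSupport χ) (e : E) :
    ∫ y, fderiv ℝ χ y e ∂μ = 0 := by
  have h1 : Continuous fun y => fderiv ℝ χ y e :=
    (h.continuous_fderiv one_ne_zero).clm_apply continuous_const
  have := integral_mul_fderiv_eq_neg_fderiv_mul_of_integrable (μ := μ) (f := fun _ : E => (1 : ℝ))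
    (g := χ) (v := e) (by simp)
    (by simpa using h1.integrable_of_hasCompactSupport (hs.fderiv_apply ℝ e))
    (by simpa using h.continuous.integrable_of_hasCompactSupport hs)
    (fun x _ => differentiableAt_const _) (fun x _ => h.differentiable one_ne_zero x)
  simpa using this

/-- Integration of a derivative over a subgraph leaves an integral over the graph. -/
lemma exists_integral_subgraph : ∃ c : ℝ≥0, ∀ (x₀ : E3) (ψ : normalPlane ν → ℝ),
    ContDiff ℝ 1 ψ → ∀ χ : E3 → ℝ, ContDiff ℝ 1 χ → HasCompactSupport χ →
    ∀ (w : normalPlane ν) (a : ℝ),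
      ∫ y, {y | graphHeight x₀ ψ y < 0}.indicator (fun y => fderiv ℝ χ y (w + a • ν)) y =
        c * ∫ q, (a - fderiv ℝ ψ q w) * χ (graphChart hν x₀ ψ (q, 0)) ∂μH[2] := by
  have := isAddHaarMeasure_normalPlane hν
  obtain ⟨c, hc⟩ := exists_integral_eq_graphChart hν
  refine ⟨c, fun x₀ ψ hψ χ hχ hs w a => ?_⟩
  have hd : Continuous fun y => fderiv ℝ χ y (w + a • ν) :=
    (hχ.continuous_fderiv one_ne_zero).clm_apply continuous_const
  have hmeas : MeasurableSet {y | graphHeight x₀ ψ y < 0} :=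
    (continuous_graphHeight x₀ hψ.continuous).measurable measurableSet_Iio
  rw [hc x₀ ψ _ ((hd.integrable_of_hasCompactSupport (hs.fderiv_apply ℝ _)).indicator hmeas)]
  congr 1
  -- The pullback of `χ` to graph coordinates.
  set X : normalPlane ν × ℝ → ℝ := fun p => χ (graphChart hν x₀ ψ p) with hX
  have hXd : ContDiff ℝ 1 X := hχ.comp (contDiff_graphChart hν x₀ hψ)
  have hXs : HasCompactSupport X :=
    hs.comp_homeomorph (graphHomeomorph hν x₀ hψ.continuous)
  have hXdiff := hXd.differentiable one_ne_zero
  have hchart : ∀ q : normalPlane ν, ∀ t : ℝ, ∀ v : normalPlane ν, ∀ s : ℝ,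
      fderiv ℝ X (q, t) (v, s) =
        fderiv ℝ χ (graphChart hν x₀ ψ (q, t)) (v + (s + fderiv ℝ ψ q v) • ν) := fun q t v s => by
    have h1 : HasFDerivAt (graphChart hν x₀ ψ)
        ((planeEquiv hν : (normalPlane ν × ℝ) →L[ℝ] E3).comp
          ((ContinuousLinearMap.fst ℝ _ ℝ).prod (ContinuousLinearMap.snd ℝ _ ℝ +
            (fderiv ℝ ψ q).comp (ContinuousLinearMap.fst ℝ _ ℝ)))) (q, t) := by
      have hψ' : HasFDerivAt ψ (fderiv ℝ ψ q) (q, t).1 :=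
        (hψ.differentiable one_ne_zero q).hasFDerivAt
      exact (((planeEquiv hν).hasFDerivAt).comp (q, t)
        (hasFDerivAt_fst.prodMk (hasFDerivAt_snd.add (hψ'.comp (q, t) hasFDerivAt_fst)))).const_add x₀
    have h2 := ((hχ.differentiable one_ne_zero (graphChart hν x₀ ψ (q, t))).hasFDerivAt.comp
      (q, t) h1).fderiv
    rw [hX]
    change fderiv ℝ (χ ∘ graphChart hν x₀ ψ) (q, t) (v, s) = _
    rw [h2]
    simp [planeEquiv_apply]
  have hsplit : ∀ q t, fderiv ℝ χ (graphChart hν x₀ ψ (q, t)) (w + a • ν) =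
      fderiv ℝ X (q, t) (w, 0) + (a - fderiv ℝ ψ q w) * fderiv ℝ X (q, t) (0, 1) := fun q t => by
    have : ((w : normalPlane ν), a - fderiv ℝ ψ q w) =
        (w, (0 : ℝ)) + (a - fderiv ℝ ψ q w) • ((0 : normalPlane ν), (1 : ℝ)) := by simp
    rw [← smul_eq_mul, ← map_smul, ← map_add, ← this, hchart]
    simp
  have hcont : ∀ v, Continuous fun p => fderiv ℝ X p v := fun v =>
    (hXd.continuous_fderiv one_ne_zero).clm_apply continuous_const
  have hint : ∀ v, Integrable (fun p => fderiv ℝ X p v)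
      ((μH[2] : Measure (normalPlane ν)).prod volume) := fun v =>
    (hcont v).integrable_of_hasCompactSupport (hXs.fderiv_apply ℝ _)
  have hembR : ∀ q : normalPlane ν, IsClosedEmbedding fun t : ℝ => (q, t) := fun q =>
    (Isometry.of_dist_eq fun s t => by simp [Prod.dist_eq]).isClosedEmbedding
  have hembL : ∀ t : ℝ, IsClosedEmbedding fun q : normalPlane ν => (q, t) := fun t =>
    (Isometry.of_dist_eq fun p q => by simp [Prod.dist_eq]).isClosedEmbedding
  have hline : ∀ q : normalPlane ν, HasCompactSupport fun t : ℝ => X (q, t) := fun q =>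
    hXs.comp_isClosedEmbedding (hembR q)
  have hslice : ∀ t : ℝ, HasCompactSupport fun q : normalPlane ν => X (q, t) := fun t =>
    hXs.comp_isClosedEmbedding (hembL t)
  have hq : ∀ q, ∫ t : ℝ, {y | graphHeight x₀ ψ y < 0}.indicator
        (fun y => fderiv ℝ χ y (w + a • ν)) (graphChart hν x₀ ψ (q, t)) =
      (∫ t in Iio (0 : ℝ), fderiv ℝ X (q, t) (w, 0)) + (a - fderiv ℝ ψ q w) * X (q, 0) := fun q => by
    have e1 : ∀ t : ℝ, {y | graphHeight x₀ ψ y < 0}.indicator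
        (fun y => fderiv ℝ χ y (w + a • ν)) (graphChart hν x₀ ψ (q, t)) =
        (Iio (0 : ℝ)).indicator (fun t => fderiv ℝ X (q, t) (w, 0) +
          (a - fderiv ℝ ψ q w) * fderiv ℝ X (q, t) (0, 1)) t := fun t => by
      simp only [indicator, mem_ofPred_eq, graphHeight_graphChart, mem_Iio, hsplit]
    have hs1 : ∀ v, Integrable fun t : ℝ => fderiv ℝ X (q, t) v := fun v =>
      ((hcont v).comp (Continuous.prodMk_right q)).integrable_of_hasCompactSupport
        ((hXs.fderiv_apply ℝ v).comp_isClosedEmbedding (hembR q))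
    simp_rw [e1]
    rw [integral_indicator measurableSet_Iio, integral_add (hs1 _).integrableOn
      ((hs1 _).const_mul _).integrableOn, integral_const_mul, ← integral_Iic_eq_integral_Iio,
      ← integral_Iic_eq_integral_Iio]
    congr 2
    have e2 : ∀ t : ℝ, fderiv ℝ X (q, t) (0, 1) = deriv (fun t => X (q, t)) t := fun t => by
      have h1 : HasDerivAt (fun t : ℝ => (q, t)) ((0 : normalPlane ν), (1 : ℝ)) t :=
        (hasDerivAt_const t q).prodMk (hasDerivAt_id t)
      exact (((hXdiff (q, t)).hasFDerivAt.comp_hasDerivAt t h1).deriv).symm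
    simp_rw [e2]
    exact HasCompactSupport.integral_Iic_deriv_eq
      (hXd.comp (contDiff_prodMk_right q)) (hline q) 0
  simp_rw [hq]
  have hI : Integrable (fun p : normalPlane ν × ℝ => fderiv ℝ X p (w, 0))
      ((μH[2] : Measure (normalPlane ν)).prod (volume.restrict (Iio (0 : ℝ)))) := by
    refine (hint (w, 0)).mono_measure ?_
    exact Measure.prod_mono le_rfl Measure.restrict_le_self
  rw [integral_add hI.integral_prod_left, integral_integral_swap hI]
  · have : ∀ t : ℝ, ∫ q, fderiv ℝ X (q, t) (w, 0) ∂(μH[2] : Measure (normalPlane ν)) = 0 := fun t => by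
      have e2 : ∀ q, fderiv ℝ X (q, t) (w, 0) = fderiv ℝ (fun q => X (q, t)) q w := fun q => by
        have h1 : HasFDerivAt (fun q : normalPlane ν => (q, t))
            (ContinuousLinearMap.inl ℝ (normalPlane ν) ℝ) q := by
          exact hasFDerivAt_prodMk_left q t
        have h2 := ((hXdiff (q, t)).hasFDerivAt.comp q h1).fderiv
        change _ = fderiv ℝ (X ∘ fun q => (q, t)) q w
        rw [h2]
        simp
      simp_rw [e2]
      exact integral_fderiv_eq_zero _ (hXd.comp (contDiff_prodMk_left t)) (hslice t) w
    simp only [this, integral_zero, zero_add]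
    rfl
  · refine Continuous.integrable_of_hasCompactSupport ?_ (hslice 0).mul_left
    exact (continuous_const.sub ((hψ.continuous_fderiv one_ne_zero).clm_apply
      continuous_const)).mul (hXd.continuous.comp (Continuous.prodMk_left 0))

end Chart

/-! ### The interface: area and trace inequality -/

lemma graphHeight_add_smul {ν : E3} (hν : ‖ν‖ = 1) (x₀ : E3) {ψ : normalPlane ν → ℝ} (y : E3) (s : ℝ) :
    graphHeight x₀ ψ (y + s • ν) = graphHeight x₀ ψ y + s := by
  have h : y + s • ν = graphChart hν x₀ ψ
      ((normalPlane ν).orthogonalProjectionOnto (y - x₀), graphHeight x₀ ψ y + s) := by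
    have := graphChart_graphHeight hν x₀ (ψ := ψ) y
    conv_lhs => rw [← this]
    simp only [graphChart, planeEquiv_apply]
    module
  rw [h, graphHeight_graphChart]

/-- Projection along `ν` does not increase area: the push-forward of the area of the plane to the
graph is at most the area of the graph. -/
lemma map_graph_le {ν : E3} (hν : ‖ν‖ = 1) (x₀ : E3) {ψ : normalPlane ν → ℝ} (hψ : Continuous ψ) :
    (μH[2] : Measure (normalPlane ν)).map (fun q => graphChart hν x₀ ψ (q, 0)) ≤
      (μH[2] : Measure E3).restrict (range fun q => graphChart hν x₀ ψ (q, 0)) := by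
  have hγ : Continuous fun q => graphChart hν x₀ ψ (q, 0) :=
    (graphHomeomorph hν x₀ hψ).continuous.comp (Continuous.prodMk_left 0)
  refine Measure.le_iff.2 fun s hs => ?_
  rw [Measure.map_apply hγ.measurable hs, Measure.restrict_apply hs]
  set γ := fun q => graphChart hν x₀ ψ (q, 0)
  have h1 : γ ⁻¹' s = (fun y => (normalPlane ν).orthogonalProjectionOnto (y - x₀)) ''
      (γ '' (γ ⁻¹' s)) := by
    rw [image_image]
    simp only [γ, orthogonalProjectionOnto_graphChart]
    simp
  have h2 : LipschitzWith 1 fun y => (normalPlane ν).orthogonalProjectionOnto (y - x₀) :=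
    LipschitzWith.of_dist_le_mul fun y z => by
      simpa using (normalPlane ν).lipschitzWith_orthogonalProjectionOnto.dist_le_mul
        (y - x₀) (z - x₀)
  calc _ ≤ μH[2] (γ '' (γ ⁻¹' s)) := by
        conv_lhs => rw [h1]
        simpa using h2.hausdorffMeasure_image_le zero_le_two (γ '' (γ ⁻¹' s))
    _ ≤ _ := measure_mono (by rw [image_preimage_eq_inter_range])

/-- `D` is, in the ball of radius `r` about `x₀`, the strict subgraph of `ψ` along `ν`. -/
def IsSubgraphIn (D : Set E3) (x₀ : E3) (r : ℝ) {ν : E3} (ψ : normalPlane ν → ℝ) : Prop :=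
  ∀ y ∈ Metric.ball x₀ r, y ∈ D ↔ graphHeight x₀ ψ y < 0

lemma HasC11Boundary.exists_isSubgraphIn {D : Set E3} (h : HasC11Boundary D) {x : E3}
    (hx : x ∈ frontier D) : ∃ ν : E3, ‖ν‖ = 1 ∧ ∃ ψ : normalPlane ν → ℝ, ContDiff ℝ 1 ψ ∧
      ∃ r > 0, IsSubgraphIn D x r ψ := by
  obtain ⟨ν, hν, ψ, hψ, -, hy⟩ := h x hx
  obtain ⟨r, hr, hb⟩ := Metric.eventually_nhds_iff_ball.1 hy
  exact ⟨ν, hν, ψ, hψ, r, hr, fun y hy => (hb y hy).trans (sub_neg (a := ⟪y - x, ν⟫_ℝ)).symm⟩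

section Local

variable {D : Set E3} {x₀ : E3} {r : ℝ} {ν : E3} {ψ : normalPlane ν → ℝ}

lemma IsSubgraphIn.notMem_closure (h : IsSubgraphIn D x₀ r ψ) (hψ : Continuous ψ) {y : E3}
    (hy : y ∈ Metric.ball x₀ r) (hpos : 0 < graphHeight x₀ ψ y) : y ∉ closure D := by
  rw [mem_closure_iff_frequently, not_frequently]
  filter_upwards [Metric.isOpen_ball.mem_nhds hy,
    (continuous_graphHeight x₀ hψ).continuousAt.eventually (lt_mem_nhds hpos)] with z h1 h2 h3
  exact lt_asymm h2 ((h z h1).1 h3)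

lemma IsSubgraphIn.height_eq_zero (h : IsSubgraphIn D x₀ r ψ) (hψ : Continuous ψ) (hD : IsOpen D)
    {y : E3} (hy : y ∈ Metric.ball x₀ r) (hyD : y ∈ frontier D) : graphHeight x₀ ψ y = 0 := by
  rw [hD.frontier_eq] at hyD
  refine le_antisymm (not_lt.1 fun hp => h.notMem_closure hψ hy hp hyD.1) (not_lt.1 fun hn => ?_)
  exact hyD.2 ((h y hy).2 hn)

lemma IsSubgraphIn.mem_interface (h : IsSubgraphIn D x₀ r ψ) (hν : ‖ν‖ = 1) (hψ : Continuous ψ)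
    {y : E3} (hy : y ∈ Metric.ball x₀ r) (h0 : graphHeight x₀ ψ y = 0) : y ∈ interface D := by
  have hball : ∀ σ : ℝ, ∀ᶠ s in 𝓝[>] (0 : ℝ), y + (σ * s) • ν ∈ Metric.ball x₀ r := fun σ => by
    have hc : Tendsto (fun s : ℝ => y + (σ * s) • ν) (𝓝[>] 0) (𝓝 y) := by
      have : Continuous fun s : ℝ => y + (σ * s) • ν := by fun_prop
      simpa using (this.tendsto 0).mono_left nhdsWithin_le_nhds
    exact hc.eventually (Metric.isOpen_ball.mem_nhds hy)
  have hlim : ∀ σ : ℝ, Tendsto (fun s : ℝ => y + (σ * s) • ν) (𝓝[>] 0) (𝓝 y) := fun σ => by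
    have : Continuous fun s : ℝ => y + (σ * s) • ν := by fun_prop
    simpa using (this.tendsto 0).mono_left nhdsWithin_le_nhds
  constructor
  · refine mem_closure_of_tendsto (hlim (-1)) ?_
    filter_upwards [hball (-1), self_mem_nhdsWithin] with s hs (hpos : 0 < s)
    rw [h _ hs, graphHeight_add_smul hν, h0]
    linarith
  · refine mem_closure_of_tendsto (hlim 1) ?_
    filter_upwards [hball 1, self_mem_nhdsWithin] with s hs (hpos : 0 < s)
    refine h.notMem_closure hψ hs ?_
    rw [graphHeight_add_smul hν, h0]
    linarith

end Local

lemma interface_subset_frontier {D : Set E3} (hD : IsOpen D) : interface D ⊆ frontier D := by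
  rw [hD.frontier_eq]
  refine fun x hx => ⟨hx.1, fun hxD => ?_⟩
  have := hx.2
  rw [exterior, closure_compl] at this
  exact this (interior_maximal subset_closure hD hxD)

lemma isCompact_interface {D : Set E3} (hb : Bornology.IsBounded D) : IsCompact (interface D) :=
  hb.isCompact_closure.of_isClosed_subset (isClosed_closure.inter isClosed_closure) inter_subset_left

lemma isCompact_frontier {D : Set E3} (hb : Bornology.IsBounded D) : IsCompact (frontier D) :=
  hb.isCompact_closure.of_isClosed_subset isClosed_frontier frontier_subset_closure

/-- The interface has finite area: it is locally a Lipschitz image of a disc. -/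
lemma hausdorffMeasure_frontier_lt_top {D : Set E3} (hD : IsBoundedC11Domain D) :
    μH[2] (frontier D) < ⊤ := by
  refine (isCompact_frontier hD.isBounded).induction_on (p := fun s => μH[2] s < ⊤) (by simp)
    (fun s t hst ht => (measure_mono hst).trans_lt ht)
    (fun s t hs ht => (measure_union_le s t).trans_lt (ENNReal.add_lt_top.2 ⟨hs, ht⟩))
    fun x hx => ?_
  obtain ⟨ν, hν, ψ, hψ, r, hr, h⟩ := hD.boundary.exists_isSubgraphIn hx
  have := isAddHaarMeasure_normalPlane hν
  refine ⟨frontier D ∩ Metric.ball x r,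
    inter_mem_nhdsWithin _ (Metric.ball_mem_nhds x hr), ?_⟩
  have hγ : ContDiff ℝ 1 fun q => graphChart hν x ψ (q, 0) :=
    (contDiff_graphChart hν x hψ).comp (contDiff_prodMk_left 0)
  obtain ⟨K, hK⟩ := hγ.locallyLipschitz.locallyLipschitzOn.exists_lipschitzOnWith_of_compact
    (isCompact_closedBall (0 : normalPlane ν) r)
  have hsub : frontier D ∩ Metric.ball x r ⊆
      (fun q => graphChart hν x ψ (q, 0)) '' Metric.closedBall (0 : normalPlane ν) r := by
    rintro y ⟨hyD, hy⟩
    refine ⟨(normalPlane ν).orthogonalProjectionOnto (y - x), ?_, ?_⟩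
    · rw [mem_closedBall_zero_iff]
      exact ((normalPlane ν).norm_orthogonalProjectionOnto_apply_le _).trans
        (mem_ball_iff_norm.1 hy).le
    · have := graphChart_graphHeight hν x (ψ := ψ) y
      rwa [h.height_eq_zero hψ.continuous hD.isOpen hy hyD] at this
  refine (measure_mono hsub).trans_lt ((hK.hausdorffMeasure_image_le zero_le_two).trans_lt ?_)
  exact ENNReal.mul_lt_top (ENNReal.rpow_lt_top_of_nonneg zero_le_two ENNReal.coe_ne_top)
    (isCompact_closedBall _ _).measure_lt_top

lemma volume_eq_zero_of_hausdorffMeasure_eq_zero {s : Set E3} (h : μH[3] s = 0) :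
    volume s = 0 := by
  have h0 := Measure.isAddLeftInvariant_eq_smul (volume : Measure E3) (μH[(3 : ℕ)] : Measure E3)
  rw [h0]
  simp [h]

lemma volume_frontier {D : Set E3} (hD : IsBoundedC11Domain D) : volume (frontier D) = 0 := by
  refine volume_eq_zero_of_hausdorffMeasure_eq_zero ?_
  refine (Measure.hausdorffMeasure_zero_or_top (by norm_num : (2 : ℝ) < 3) _).resolve_right ?_
  exact (hausdorffMeasure_frontier_lt_top hD).ne

/-- The trace inequality for functions supported near a point of the boundary. -/
lemma exists_local_trace_bound {D : Set E3} (hD : IsBoundedC11Domain D) {x : E3}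
    (hx : x ∈ frontier D) : ∃ r > 0, ∃ C : ℝ≥0, ∀ χ : E3 → ℝ, ContDiff ℝ 1 χ →
      HasCompactSupport χ → tsupport χ ⊆ Metric.ball x r → ∀ e : E3,
      ‖∫ y in D, fderiv ℝ χ y e‖ₑ ≤ C * ‖e‖ₑ * ∫⁻ y in interface D, ‖χ y‖ₑ ∂μH[2] := by
  obtain ⟨ν, hν, ψ, hψ, r, hr, h⟩ := hD.boundary.exists_isSubgraphIn hx
  have := isAddHaarMeasure_normalPlane hν
  obtain ⟨c, hc⟩ := exists_integral_subgraph hν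
  obtain ⟨M, hM⟩ := (isCompact_closedBall (0 : normalPlane ν) r).exists_bound_of_continuousOn
    (hψ.continuous_fderiv one_ne_zero).continuousOn
  have hM0 : 0 ≤ M := (norm_nonneg _).trans (hM 0 (Metric.mem_closedBall_self hr.le))
  have hγ : Continuous fun q => graphChart hν x ψ (q, 0) :=
    (graphHomeomorph hν x hψ.continuous).continuous.comp (Continuous.prodMk_left 0)
  refine ⟨r, hr, c * (1 + M.toNNReal), fun χ hχ hs hsupp e => ?_⟩
  set w := (normalPlane ν).orthogonalProjectionOnto e
  set a := ⟪ν, e⟫_ℝ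
  have he : (w : E3) + a • ν = e := (planeEquiv hν).apply_symm_apply e
  have hw : ‖w‖ ≤ ‖e‖ := (normalPlane ν).norm_orthogonalProjectionOnto_apply_le e
  have ha : |a| ≤ ‖e‖ := by simpa [hν] using abs_real_inner_le_norm ν e
  have e1 : ∫ y in D, fderiv ℝ χ y e =
      c * ∫ q, (a - fderiv ℝ ψ q w) * χ (graphChart hν x ψ (q, 0)) ∂μH[2] := by
    rw [← hc x ψ hψ χ hχ hs w a, he, ← integral_indicator hD.isOpen.measurableSet]
    congr 1
    funext y
    by_cases hy : y ∈ Metric.ball x r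
    · simp only [indicator, h y hy, mem_ofPred_eq]
    · have : fderiv ℝ χ y = 0 :=
        image_eq_zero_of_notMem_tsupport fun hh => hy (hsupp (tsupport_fderiv_subset ℝ hh))
      simp [indicator, this]
  have e2 : ∀ q, ‖(a - fderiv ℝ ψ q w) * χ (graphChart hν x ψ (q, 0))‖ₑ ≤
      (1 + M.toNNReal : ℝ≥0) * ‖e‖ₑ * ‖χ (graphChart hν x ψ (q, 0))‖ₑ := fun q => by
    by_cases hq : graphChart hν x ψ (q, 0) ∈ Metric.ball x r
    · rw [enorm_mul]
      gcongr
      have hq' : q ∈ Metric.closedBall (0 : normalPlane ν) r := by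
        have hp := orthogonalProjectionOnto_graphChart hν x (ψ := ψ) (q, 0)
        simp only at hp
        rw [mem_closedBall_zero_iff, ← hp]
        exact ((normalPlane ν).norm_orthogonalProjectionOnto_apply_le _).trans
          (mem_ball_iff_norm.1 hq).le
      have h1 : ‖fderiv ℝ ψ q w‖ ≤ M * ‖e‖ :=
        ((fderiv ℝ ψ q).le_opNorm w).trans (mul_le_mul (hM q hq') hw (norm_nonneg _) hM0)
      have h2 : ‖a - fderiv ℝ ψ q w‖ ≤ (1 + M) * ‖e‖ := by
        refine (norm_sub_le _ _).trans ?_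
        rw [Real.norm_eq_abs a]
        linarith
      have h3 : ‖a - fderiv ℝ ψ q w‖₊ ≤ (1 + M.toNNReal) * ‖e‖₊ := by
        rw [← NNReal.coe_le_coe]
        push_cast
        rwa [Real.coe_toNNReal _ hM0]
      simp only [enorm_eq_nnnorm]
      exact_mod_cast h3
    · have : χ (graphChart hν x ψ (q, 0)) = 0 :=
        image_eq_zero_of_notMem_tsupport fun hh => hq (hsupp hh)
      simp [this]
  have e3 : ∫⁻ q, ‖χ (graphChart hν x ψ (q, 0))‖ₑ ∂(μH[2] : Measure (normalPlane ν)) ≤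
      ∫⁻ y in interface D, ‖χ y‖ₑ ∂μH[2] := by
    have hχm : Measurable fun y => ‖χ y‖ₑ := hχ.continuous.enorm.measurable
    rw [← lintegral_map (f := fun y => ‖χ y‖ₑ) hχm hγ.measurable]
    refine (lintegral_mono' (map_graph_le hν x hψ.continuous) le_rfl).trans ?_
    have hcl : MeasurableSet (range fun q => graphChart hν x ψ (q, 0)) := by
      have : (range fun q => graphChart hν x ψ (q, 0)) = {y | graphHeight x ψ y = 0} := by
        ext y
        constructor
        · rintro ⟨q, rfl⟩
          exact graphHeight_graphChart hν x (q, 0)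
        · intro (hy : graphHeight x ψ y = 0)
          refine ⟨(normalPlane ν).orthogonalProjectionOnto (y - x), ?_⟩
          have := graphChart_graphHeight hν x (ψ := ψ) y
          rwa [hy] at this
      rw [this]
      exact (continuous_graphHeight x hψ.continuous).measurable (measurableSet_singleton 0)
    rw [← lintegral_indicator hcl, ← lintegral_indicator
      (isCompact_interface hD.isBounded).measurableSet]
    refine lintegral_mono fun y => ?_
    by_cases hy : y ∈ Metric.ball x r
    · by_cases hyr : y ∈ range fun q => graphChart hν x ψ (q, 0)
      · obtain ⟨q, rfl⟩ := hyr
        have := h.mem_interface hν hψ.continuous hy (graphHeight_graphChart hν x (q, 0))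
        simp [indicator, this]
      · simp [indicator, hyr]
    · have : χ y = 0 := image_eq_zero_of_notMem_tsupport fun hh => hy (hsupp hh)
      simp [indicator, this]
  calc ‖∫ y in D, fderiv ℝ χ y e‖ₑ
      ≤ c * ∫⁻ q, (1 + M.toNNReal : ℝ≥0) * ‖e‖ₑ * ‖χ (graphChart hν x ψ (q, 0))‖ₑ ∂μH[2] := by
        rw [e1, enorm_mul]
        have : ‖(c : ℝ)‖ₑ = c := by simp [enorm_eq_nnnorm]
        rw [this]
        gcongr
        exact (enorm_integral_le_lintegral_enorm _).trans (lintegral_mono e2)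
    _ = c * ((1 + M.toNNReal : ℝ≥0) * ‖e‖ₑ * ∫⁻ q, ‖χ (graphChart hν x ψ (q, 0))‖ₑ ∂μH[2]) := by
        rw [lintegral_const_mul' _ _ (by finiteness)]
    _ ≤ _ := by
        rw [ENNReal.coe_mul, mul_assoc, mul_assoc, mul_assoc]
        gcongr

/-- The trace inequality: up to a constant, `∫_D ∂_e χ` is bounded by the `L¹` norm of `χ` on the
interface. This is what the divergence theorem is needed for. -/
lemma exists_trace_bound {D : Set E3} (hD : IsBoundedC11Domain D) :
    ∃ C : ℝ≥0, ∀ χ : E3 → ℝ, ContDiff ℝ 1 χ → HasCompactSupport χ → ∀ e : E3,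
      ‖∫ y in D, fderiv ℝ χ y e‖ₑ ≤ C * ‖e‖ₑ * ∫⁻ y in interface D, ‖χ y‖ₑ ∂μH[2] := by
  -- Induction over compact parts of the boundary; cut-offs `θ₁`, `θ₂` of two parts combine to the
  -- cut-off `1 - (1 - θ₁) (1 - θ₂)` of their union.
  have key : ∃ θ : E3 → ℝ, ContDiff ℝ 1 θ ∧ (∀ y, θ y ∈ Icc (0 : ℝ) 1) ∧
      (∀ y ∈ frontier D, ∀ᶠ z in 𝓝 y, θ z = 1) ∧ ∃ C : ℝ≥0, ∀ χ : E3 → ℝ, ContDiff ℝ 1 χ →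
        HasCompactSupport χ → ∀ e : E3, ‖∫ y in D, fderiv ℝ (fun y => θ y * χ y) y e‖ₑ ≤
          C * ‖e‖ₑ * ∫⁻ y in interface D, ‖χ y‖ₑ ∂μH[2] := by
    refine (isCompact_frontier hD.isBounded).induction_on
      (p := fun s => ∃ θ : E3 → ℝ, ContDiff ℝ 1 θ ∧ (∀ y, θ y ∈ Icc (0 : ℝ) 1) ∧
      (∀ y ∈ s, ∀ᶠ z in 𝓝 y, θ z = 1) ∧ ∃ C : ℝ≥0, ∀ χ : E3 → ℝ, ContDiff ℝ 1 χ →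
        HasCompactSupport χ → ∀ e : E3, ‖∫ y in D, fderiv ℝ (fun y => θ y * χ y) y e‖ₑ ≤
          C * ‖e‖ₑ * ∫⁻ y in interface D, ‖χ y‖ₑ ∂μH[2]) ?_ ?_ ?_ ?_
    · exact ⟨fun _ => 0, contDiff_const, by simp, by simp, 0, by simp⟩
    · rintro s t hst ⟨θ, h1, h2, h3, h4⟩
      exact ⟨θ, h1, h2, fun y hy => h3 y (hst hy), h4⟩
    · rintro s t ⟨θ₁, h1, h2, h3, C₁, h4⟩ ⟨θ₂, k1, k2, k3, C₂, k4⟩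
      refine ⟨fun y => θ₁ y + θ₂ y * (1 - θ₁ y), h1.add (k1.mul (contDiff_const.sub h1)),
        fun y => ?_, ?_, C₁ + C₂, fun χ hχ hs e => ?_⟩
      · obtain ⟨a1, a2⟩ := h2 y
        obtain ⟨b1, b2⟩ := k2 y
        constructor <;> nlinarith
      · rintro y (hy | hy)
        · filter_upwards [h3 y hy] with z hz
          rw [hz]; ring
        · filter_upwards [k3 y hy] with z hz
          rw [hz]; ring
      · have c1 : ContDiff ℝ 1 fun y => θ₁ y * χ y := h1.mul hχ
        have c2 : ContDiff ℝ 1 fun y => (1 - θ₁ y) * χ y := (contDiff_const.sub h1).mul hχ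
        have c3 : ContDiff ℝ 1 fun y => θ₂ y * ((1 - θ₁ y) * χ y) := k1.mul c2
        have i : ∀ {f : E3 → ℝ}, ContDiff ℝ 1 f → HasCompactSupport f →
            Integrable (fun y => fderiv ℝ f y e) (volume.restrict D) := fun hf hfs =>
          (((hf.continuous_fderiv one_ne_zero).clm_apply
            continuous_const).integrable_of_hasCompactSupport (hfs.fderiv_apply ℝ e)).restrict
        have e1 : ∀ y, fderiv ℝ (fun y => (θ₁ y + θ₂ y * (1 - θ₁ y)) * χ y) y e =
            fderiv ℝ (fun y => θ₁ y * χ y) y e +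
              fderiv ℝ (fun y => θ₂ y * ((1 - θ₁ y) * χ y)) y e := fun y => by
          rw [← add_apply, ← fderiv_fun_add (c1.differentiable one_ne_zero y)
            (c3.differentiable one_ne_zero y)]
          congr 2
          funext y
          ring
        simp_rw [e1]
        rw [integral_add (i c1 hs.mul_left) (i c3 hs.mul_left.mul_left)]
        refine (enorm_add_le _ _).trans ((add_le_add (h4 χ hχ hs e)
          (k4 _ c2 hs.mul_left e)).trans ?_)
        rw [ENNReal.coe_add, add_mul, add_mul]
        gcongr with y
        refine enorm_le_iff_norm_le.2 ?_
        rw [norm_mul]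
        obtain ⟨a1, a2⟩ := h2 y
        refine mul_le_of_le_one_left (norm_nonneg _) ?_
        rw [Real.norm_eq_abs, abs_le]
        constructor <;> linarith
    · intro x hx
      obtain ⟨r, hr, C, hC⟩ := exists_local_trace_bound hD hx
      let b : ContDiffBump x := ⟨r / 4, r / 2, by positivity, by linarith⟩
      refine ⟨Metric.ball x (r / 4), mem_nhdsWithin_of_mem_nhds (Metric.ball_mem_nhds x (by positivity)),
        b, b.contDiff, fun y => ⟨b.nonneg, b.le_one⟩, fun y hy => ?_, C, fun χ hχ hs e => ?_⟩
      · filter_upwards [Metric.isOpen_ball.mem_nhds hy] with z hz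
        exact b.one_of_mem_closedBall (Metric.ball_subset_closedBall hz)
      · refine (hC (fun y => b y * χ y) (b.contDiff.mul hχ) hs.mul_left ?_ e).trans ?_
        · refine (tsupport_mul_subset_left (f := b) (g := χ)).trans ?_
          rw [b.tsupport_eq]
          exact Metric.closedBall_subset_ball (by change r / 2 < r; linarith)
        · gcongr with y
          rw [enorm_le_iff_norm_le, norm_mul]
          refine mul_le_of_le_one_left (norm_nonneg _) ?_
          rw [Real.norm_of_nonneg b.nonneg]
          exact b.le_one
  obtain ⟨θ, h1, h2, h3, C, h4⟩ := key
  refine ⟨C, fun χ hχ hs e => ?_⟩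
  have c1 : ContDiff ℝ 1 fun y => θ y * χ y := h1.mul hχ
  have c2 : ContDiff ℝ 1 fun y => (1 - θ y) * χ y := (contDiff_const.sub h1).mul hχ
  have i : ∀ {f : E3 → ℝ}, ContDiff ℝ 1 f → HasCompactSupport f →
      Integrable (fun y => fderiv ℝ f y e) (volume.restrict D) := fun hf hfs =>
    (((hf.continuous_fderiv one_ne_zero).clm_apply
      continuous_const).integrable_of_hasCompactSupport (hfs.fderiv_apply ℝ e)).restrict
  -- Away from the boundary, extension by zero keeps the function `C¹`.
  have hz : ∫ y in D, fderiv ℝ (fun y => (1 - θ y) * χ y) y e = 0 := by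
    set f : E3 → ℝ := D.indicator fun y => (1 - θ y) * χ y with hf
    have hloc : ∀ y, (f =ᶠ[𝓝 y] fun y => (1 - θ y) * χ y) ∧ y ∈ D ∨ (f =ᶠ[𝓝 y] fun _ => 0) ∧
        (y ∈ D → fderiv ℝ (fun y => (1 - θ y) * χ y) y = 0) := fun y => by
      by_cases hyD : y ∈ D
      · refine Or.inl ⟨?_, hyD⟩
        filter_upwards [hD.isOpen.mem_nhds hyD] with z hz
        simp [f, hz]
      · refine Or.inr ⟨?_, fun h => absurd h hyD⟩
        by_cases hyc : y ∈ closure D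
        · filter_upwards [h3 y (by rw [hD.isOpen.frontier_eq]; exact ⟨hyc, hyD⟩)] with z hz
          simp [f, indicator, hz]
        · filter_upwards [isClosed_closure.isOpen_compl.mem_nhds hyc] with z hz
          have : z ∉ D := fun h => hz (subset_closure h)
          simp [f, this]
    have hfd : ContDiff ℝ 1 f := contDiff_iff_contDiffAt.2 fun y => by
      rcases hloc y with h | h
      · exact c2.contDiffAt.congr_of_eventuallyEq h.1
      · exact contDiffAt_const.congr_of_eventuallyEq h.1
    have hfs : HasCompactSupport f := hs.mono fun y hy h0 => hy (by simp [f, indicator, h0])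
    rw [← integral_indicator hD.isOpen.measurableSet, ← integral_fderiv_eq_zero volume hfd hfs e]
    congr 1
    funext y
    rcases hloc y with h | h
    · rw [h.1.fderiv_eq, indicator_of_mem h.2]
    · rw [h.1.fderiv_eq]
      by_cases hy : y ∈ D
      · simp [indicator, h.2 hy]
      · simp [indicator, hy]
  have e1 : ∀ y, fderiv ℝ χ y e = fderiv ℝ (fun y => θ y * χ y) y e +
      fderiv ℝ (fun y => (1 - θ y) * χ y) y e := fun y => by
    rw [← add_apply, ← fderiv_fun_add (c1.differentiable one_ne_zero y)
      (c2.differentiable one_ne_zero y)]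
    congr 2
    funext y
    ring
  simp_rw [e1]
  rw [integral_add (i c1 hs.mul_left) (i c2 hs.mul_left), hz, add_zero]
  exact h4 χ hχ hs e

/-! ### Gluing across the interface -/

lemma isOpen_exterior (D : Set E3) : IsOpen (exterior D) := isClosed_closure.isOpen_compl

lemma disjoint_exterior (D : Set E3) : Disjoint D (exterior D) :=
  disjoint_left.2 fun _ h h' => h' (subset_closure h)

/-- `HasTrace` for a function with weak gradient `G`, in terms of energies. -/
def HasTraceWith (c : E3 → ℝ) (U Γ : Set E3) (v : E3 → ℝ) (G : E3 → E3) (g : E3 → ℝ) : Prop :=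
  ∃ φ : ℕ → E3 → ℝ, (∀ k, IsTest (φ k)) ∧
    Tendsto (fun k => energy c U (fun x => φ k x - v x) (fun x => gradient (φ k) x - G x))
      atTop (𝓝 0) ∧
    Tendsto (fun k => eLpNorm (fun x => φ k x - g x) 2 ((μH[2] : Measure E3).restrict Γ))
      atTop (𝓝 0)

lemma hasTrace_iff_hasTraceWith {c : E3 → ℝ} {U Γ : Set E3} (hU : IsOpen U) {v : E3 → ℝ}
    {G : E3 → E3} {g : E3 → ℝ} (h : HasWeakGrad U v G) :
    HasTrace (fun v => energy c U v (weakGrad U v)) Γ v g ↔ HasTraceWith c U Γ v G g := by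
  unfold HasTrace HasTraceWith
  refine exists_congr fun φ => and_congr_right fun hφ => and_congr_left fun _ => ?_
  refine iff_of_eq (congrArg (fun F => Tendsto F atTop (𝓝 0)) (funext fun k => ?_))
  exact energy_weakGrad hU (((hφ k).hasWeakGrad U).sub h)

/-- `v` belongs to the space `W`, and `G` is its weak gradient on both sides of the interface. -/
structure HasGradW (D Γ : Set E3) (v : E3 → ℝ) (G : E3 → E3) : Prop where
  inner : HasWeakGrad D v G
  outer : HasWeakGrad (exterior D) v G
  energy_inner : energy unitWeight D v G < ⊤
  energy_outer : energy decayWeight (exterior D) v G < ⊤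
  trace : ∃ g, MemLp g 2 ((μH[2] : Measure E3).restrict Γ) ∧
    HasTraceWith unitWeight D Γ v G g ∧ HasTraceWith decayWeight (exterior D) Γ v G g

open Classical in
/-- The weak gradients of `v` in `D` and in the exterior, as one vector field. -/
noncomputable def glueGrad (D : Set E3) (v : E3 → ℝ) : E3 → E3 :=
  D.piecewise (weakGrad D v) (weakGrad (exterior D) v)

open Classical in
lemma glueGrad_ae_inner {D : Set E3} (hD : IsOpen D) (v : E3 → ℝ) :
    weakGrad D v =ᵐ[volume.restrict D] glueGrad D v := by
  filter_upwards [ae_restrict_mem hD.measurableSet] with x hx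
  exact (piecewise_eq_of_mem _ _ _ hx).symm

open Classical in
lemma glueGrad_ae_outer (D : Set E3) (v : E3 → ℝ) :
    weakGrad (exterior D) v =ᵐ[volume.restrict (exterior D)] glueGrad D v := by
  filter_upwards [ae_restrict_mem (isOpen_exterior D).measurableSet] with x hx
  exact (piecewise_eq_of_notMem _ _ _ fun h => hx (subset_closure h)).symm

lemma h1NormSq_eq : h1NormSq = fun U v => energy unitWeight U v (weakGrad U v) :=
  funext fun U => funext fun v => h1NormSq_eq_energy U v

lemma MemW.hasGradW {D Γ : Set E3} (hD : IsOpen D) {v : E3 → ℝ} (h : MemW D Γ v) :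
    HasGradW D Γ v (glueGrad D v) := by
  obtain ⟨⟨h1, h2⟩, ⟨h3, h4⟩, g, hg, t1, t2⟩ := h
  have w1 := (hasWeakGrad_weakGrad h1).congr (ae_eq_refl _) (glueGrad_ae_inner hD v)
  have w2 := (hasWeakGrad_weakGrad h3).congr (ae_eq_refl _) (glueGrad_ae_outer D v)
  refine ⟨w1, w2, ?_, ?_, g, hg, ?_, ?_⟩
  · rwa [h1NormSq_eq_energy, energy_weakGrad hD w1] at h2
  · rwa [h1wNormSq_eq_energy, energy_weakGrad (isOpen_exterior D) w2] at h4
  · rw [h1NormSq_eq] at t1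
    exact (hasTrace_iff_hasTraceWith hD w1).1 t1
  · exact (hasTrace_iff_hasTraceWith (isOpen_exterior D) w2).1 t2

lemma HasGradW.memW {D Γ : Set E3} (hD : IsOpen D) {v : E3 → ℝ} {G : E3 → E3}
    (h : HasGradW D Γ v G) : MemW D Γ v := by
  obtain ⟨w1, w2, e1, e2, g, hg, t1, t2⟩ := h
  refine ⟨⟨⟨G, w1⟩, ?_⟩, ⟨⟨G, w2⟩, ?_⟩, g, hg, ?_, ?_⟩
  · rwa [h1NormSq_eq_energy, energy_weakGrad hD w1]
  · rwa [h1wNormSq_eq_energy, energy_weakGrad (isOpen_exterior D) w2]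
  · rw [h1NormSq_eq]
    exact (hasTrace_iff_hasTraceWith hD w1).2 t1
  · exact (hasTrace_iff_hasTraceWith (isOpen_exterior D) w2).2 t2

lemma restrict_union_exterior {D : Set E3} (hD : IsBoundedC11Domain D) :
    (volume : Measure E3).restrict (D ∪ exterior D) = volume := by
  refine Measure.restrict_eq_self_of_ae_mem ?_
  refine measure_mono_null (fun x hx => ?_) (volume_frontier hD)
  rw [hD.isOpen.frontier_eq]
  simp only [mem_compl_iff, mem_ofPred_eq, mem_union, not_or, exterior, not_not] at hx
  exact ⟨hx.2, hx.1⟩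

lemma lintegral_eq_add_exterior {D : Set E3} (hD : IsBoundedC11Domain D) (F : E3 → ℝ≥0∞) :
    ∫⁻ x, F x = (∫⁻ x in D, F x) + ∫⁻ x in exterior D, F x := by
  conv_lhs => rw [← restrict_union_exterior hD]
  exact lintegral_union (isOpen_exterior D).measurableSet (disjoint_exterior D)

lemma integral_eq_add_exterior {D : Set E3} (hD : IsBoundedC11Domain D) {F : Type*}
    [NormedAddCommGroup F] [NormedSpace ℝ F] {f : E3 → F} (hf : Integrable f) :
    ∫ x, f x = (∫ x in D, f x) + ∫ x in exterior D, f x := by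
  conv_lhs => rw [← restrict_union_exterior hD]
  exact setIntegral_union (disjoint_exterior D) (isOpen_exterior D).measurableSet
    hf.integrableOn hf.integrableOn

lemma aestronglyMeasurable_of_inner_outer {D : Set E3} (hD : IsBoundedC11Domain D) {F : Type*}
    [NormedAddCommGroup F] {f : E3 → F} (h1 : AEStronglyMeasurable f (volume.restrict D))
    (h2 : AEStronglyMeasurable f (volume.restrict (exterior D))) :
    AEStronglyMeasurable f volume := by
  rw [← restrict_union_exterior hD]
  exact aestronglyMeasurable_union_iff.2 ⟨h1, h2⟩

section Glue

variable {D : Set E3} {v : E3 → ℝ} {G : E3 → E3}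

lemma decayEnergy_le_unitEnergy (U : Set E3) (v : E3 → ℝ) (G : E3 → E3) :
    energy decayWeight U v G ≤ energy unitWeight U v G := by
  refine lintegral_mono fun x => ?_
  gcongr
  simp [unitWeight, decayWeight]

lemma HasGradW.energy_lt_top (hD : IsBoundedC11Domain D) {Γ : Set E3} (h : HasGradW D Γ v G) :
    energy decayWeight univ v G < ⊤ := by
  rw [energy, Measure.restrict_univ, lintegral_eq_add_exterior hD]
  exact ENNReal.add_lt_top.2 ⟨(decayEnergy_le_unitEnergy D v G).trans_lt h.energy_inner,
    h.energy_outer⟩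

lemma HasGradW.aestronglyMeasurable (hD : IsBoundedC11Domain D) {Γ : Set E3}
    (h : HasGradW D Γ v G) : AEStronglyMeasurable v volume :=
  aestronglyMeasurable_of_inner_outer hD h.inner.1.aestronglyMeasurable
    h.outer.1.aestronglyMeasurable

lemma HasGradW.memLp (hD : IsBoundedC11Domain D) {Γ : Set E3} (h : HasGradW D Γ v G) :
    MemLp G 2 volume := by
  have := memLp_of_energy (U := univ) (v := v) (g := G) (c := decayWeight) (by
    rw [Measure.restrict_univ]
    exact aestronglyMeasurable_of_inner_outer hD h.inner.2.1.aestronglyMeasurable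
      h.outer.2.1.aestronglyMeasurable) (h.energy_lt_top hD)
  rwa [Measure.restrict_univ] at this

/-- Across an interface on which the traces from both sides agree, the weak gradients on the two
sides form a weak gradient on the whole space. -/
lemma HasGradW.hasWeakGrad (hD : IsBoundedC11Domain D) (h : HasGradW D (interface D) v G) :
    HasWeakGrad univ v G := by
  have hvl : LocallyIntegrableOn v univ := locallyIntegrableOn_of_energy isWeight_decayWeight
    isOpen_univ (by rw [Measure.restrict_univ]; exact h.aestronglyMeasurable hD)
    (h.energy_lt_top hD)
  have hGl : LocallyIntegrableOn G univ :=
    locallyIntegrableOn_univ.2 ((h.memLp hD).locallyIntegrable one_le_two)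
  obtain ⟨γ, hγ, ⟨φ, hφ, hφe, hφt⟩, ψ, hψ, hψe, hψt⟩ := h.trace
  refine ⟨hvl, hGl, fun η hη _ => ext_inner_left ℝ fun e => ?_⟩
  have hgc := continuous_gradient hη.contDiff_one
  have hgs := hasCompactSupport_gradient hη.2
  have iv : Integrable fun x => v x • gradient η x := by
    simpa using integrable_smul_of_tsupport_subset' hvl hgc hgs (subset_univ _)
  have iG : Integrable fun x => η x • G x := by
    simpa using integrable_smul_of_tsupport_subset hGl hη.continuous hη.2 (subset_univ _)
  have iv' : ∀ {χ : E3 → ℝ}, IsTest χ → Integrable fun x => χ x • gradient η x := fun hχ =>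
    (hχ.continuous.smul hgc).integrable_of_hasCompactSupport (hgs.smul_left)
  have iG' : ∀ {χ : E3 → ℝ}, IsTest χ → Integrable fun x => η x • gradient χ x := fun hχ =>
    (hη.continuous.smul (continuous_gradient hχ.contDiff_one)).integrable_of_hasCompactSupport
      (hη.2.smul_right)
  have lim : ∀ {c : E3 → ℝ} {U : Set E3}, IsWeight c → ∀ {χ : ℕ → E3 → ℝ}, (∀ k, IsTest (χ k)) →
      AEStronglyMeasurable v (volume.restrict U) → AEStronglyMeasurable G (volume.restrict U) →
      Tendsto (fun k => energy c U (fun x => χ k x - v x) (fun x => gradient (χ k) x - G x))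
        atTop (𝓝 0) →
      Tendsto (fun k => ∫ x in U, (χ k x • gradient η x + η x • gradient (χ k) x)) atTop
        (𝓝 ((∫ x in U, v x • gradient η x) + ∫ x in U, η x • G x)) :=
    fun {c U} hc χ hχ hmv hmG hlim => by
    have l1 := tendsto_integral_smul_of_weighted_sq hc
      (fun k => (hχ k).continuous.aestronglyMeasurable.sub hmv) hgc hgs
      (fun k => (iv' (hχ k)).restrict) iv.restrict
      (tendsto_weighted_sq_of_tendsto_energy hlim)
    have l2 := tendsto_integral_smul_of_sq
      (fun k => (continuous_gradient (hχ k).contDiff_one).aestronglyMeasurable.sub hmG)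
      hη.continuous hη.2 (fun k => (iG' (hχ k)).restrict) iG.restrict
      (tendsto_sq_of_tendsto_energy hlim)
    refine (l1.add l2).congr fun k => ?_
    rw [integral_add (iv' (hχ k)).restrict (iG' (hχ k)).restrict]
  have L := (lim isWeight_unitWeight hφ h.inner.1.aestronglyMeasurable
    h.inner.2.1.aestronglyMeasurable hφe).add (lim isWeight_decayWeight hψ
    h.outer.1.aestronglyMeasurable h.outer.2.1.aestronglyMeasurable hψe)
  -- The sum of the two integrals is `∫_D ∇((φₖ - ψₖ) η)`, which only sees the traces.
  have hprod : ∀ {χ : E3 → ℝ}, IsTest χ → ∀ x,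
      χ x • gradient η x + η x • gradient χ x = gradient (fun y => χ y * η y) x := fun hχ x =>
    (gradient_mul (hχ.contDiff_one.differentiable one_ne_zero x)
      (hη.contDiff_one.differentiable one_ne_zero x)).symm
  have hcd : ∀ {χ : E3 → ℝ}, IsTest χ → ContDiff ℝ 1 fun y => χ y * η y := fun hχ =>
    hχ.contDiff_one.mul hη.contDiff_one
  have hin : ∀ {χ : E3 → ℝ}, ContDiff ℝ 1 χ → HasCompactSupport χ → ∀ U : Set E3,
      ⟪e, ∫ x in U, gradient χ x⟫_ℝ = ∫ x in U, fderiv ℝ χ x e := fun hχ hs U => by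
    rw [← integral_inner ((continuous_gradient hχ).integrable_of_hasCompactSupport
      (hasCompactSupport_gradient hs)).restrict]
    simp
  have heq : ∀ k, ⟪e, (∫ x in D, (φ k x • gradient η x + η x • gradient (φ k) x)) +
      ∫ x in exterior D, (ψ k x • gradient η x + η x • gradient (ψ k) x)⟫_ℝ =
      ∫ x in D, fderiv ℝ (fun y => (φ k y - ψ k y) * η y) x e := fun k => by
    have c1 := hcd (hφ k)
    have c2 := hcd (hψ k)
    have s1 : HasCompactSupport fun y => φ k y * η y := hη.2.mul_left
    have s2 : HasCompactSupport fun y => ψ k y * η y := hη.2.mul_left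
    have i : ∀ {χ : E3 → ℝ}, ContDiff ℝ 1 χ → HasCompactSupport χ →
        Integrable fun x => fderiv ℝ χ x e := fun h hs =>
      ((h.continuous_fderiv one_ne_zero).clm_apply continuous_const).integrable_of_hasCompactSupport
        (hs.fderiv_apply ℝ e)
    have z := integral_fderiv_eq_zero volume c2 s2 e
    rw [integral_eq_add_exterior hD (i c2 s2)] at z
    simp_rw [hprod (hφ k), hprod (hψ k)]
    rw [inner_add_right, hin c1 s1, hin c2 s2, eq_neg_of_add_eq_zero_right z, ← sub_eq_add_neg,
      ← integral_sub (i c1 s1).restrict (i c2 s2).restrict]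
    congr 1
    funext x
    rw [← sub_apply, ← fderiv_fun_sub (c1.differentiable one_ne_zero x)
      (c2.differentiable one_ne_zero x)]
    simp_rw [sub_mul]
  obtain ⟨C, hC⟩ := exists_trace_bound hD
  obtain ⟨M, hM⟩ := hη.continuous.bounded_above_of_compact_support hη.2
  set μΓ := (μH[2] : Measure E3).restrict (interface D)
  have hfin : μΓ univ < ⊤ := by
    rw [Measure.restrict_apply_univ]
    exact (measure_mono (interface_subset_frontier hD.isOpen)).trans_lt
      (hausdorffMeasure_frontier_lt_top hD)
  have hzero : Tendsto (fun k => ∫⁻ x, ‖(φ k x - ψ k x) * η x‖ₑ ∂μΓ) atTop (𝓝 0) := by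
    have hb : ∀ k, ∫⁻ x, ‖(φ k x - ψ k x) * η x‖ₑ ∂μΓ ≤ ENNReal.ofReal M *
        ((eLpNorm (fun x => φ k x - γ x) 2 μΓ + eLpNorm (fun x => ψ k x - γ x) 2 μΓ) *
          μΓ univ ^ (1 / (1 : ℝ≥0∞).toReal - 1 / (2 : ℝ≥0∞).toReal)) := fun k => by
      calc _ ≤ ∫⁻ x, ENNReal.ofReal M * ‖φ k x - ψ k x‖ₑ ∂μΓ := by
            refine lintegral_mono fun x => ?_
            rw [enorm_mul, mul_comm]
            gcongr
            rw [← ofReal_norm]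
            exact ENNReal.ofReal_le_ofReal (hM x)
        _ = ENNReal.ofReal M * eLpNorm (fun x => φ k x - ψ k x) 1 μΓ := by
            rw [lintegral_const_mul' _ _ ENNReal.ofReal_ne_top, eLpNorm_one_eq_lintegral_enorm]
        _ ≤ _ := by
            gcongr
            refine (eLpNorm_le_eLpNorm_mul_rpow_measure_univ (q := 2) one_le_two
              ((hφ k).continuous.sub (hψ k).continuous).aestronglyMeasurable).trans ?_
            gcongr
            have : φ k - ψ k = (fun x => φ k x - γ x) - fun x => ψ k x - γ x := by
              funext x; simp
            rw [this]
            exact eLpNorm_sub_le ((hφ k).continuous.aestronglyMeasurable.sub hγ.1)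
              ((hψ k).continuous.aestronglyMeasurable.sub hγ.1) one_le_two
    refine tendsto_of_tendsto_of_tendsto_of_le_of_le tendsto_const_nhds ?_ (fun _ => zero_le) hb
    have h1 := ENNReal.Tendsto.mul_const (b := μΓ univ ^
      (1 / (1 : ℝ≥0∞).toReal - 1 / (2 : ℝ≥0∞).toReal)) (hφt.add hψt)
      (Or.inr (ENNReal.rpow_ne_top_of_nonneg (by norm_num) hfin.ne))
    simpa using ENNReal.Tendsto.const_mul h1 (Or.inr ENNReal.ofReal_ne_top)
  have hlim0 : Tendsto (fun k => ∫ x in D, fderiv ℝ (fun y => (φ k y - ψ k y) * η y) x e) atTop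
      (𝓝 0) := by
    rw [tendsto_zero_iff_enorm_tendsto_zero]
    have := ENNReal.Tendsto.const_mul (a := C * ‖e‖ₑ) hzero (Or.inr (by finiteness))
    rw [mul_zero] at this
    exact tendsto_of_tendsto_of_tendsto_of_le_of_le tendsto_const_nhds this (fun _ => zero_le)
      fun k => hC _ (((hφ k).contDiff_one.sub (hψ k).contDiff_one).mul hη.contDiff_one)
        hη.2.mul_left e
  have L' := (continuous_const.inner continuous_id : Continuous fun z : E3 => ⟪e, z⟫_ℝ).tendsto _
    |>.comp L
  have := tendsto_nhds_unique (L'.congr heq) hlim0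
  simp only [Measure.restrict_univ]
  rw [integral_eq_add_exterior hD iv, integral_eq_add_exterior hD iG, inner_neg_right,
    eq_neg_iff_add_eq_zero, ← this, ← inner_add_right]
  congr 1
  abel

end Glue

/-! ### Mollification -/

/-- The mollifying kernel, before normalization, at scale `1 / (k + 1)`. -/
noncomputable def molBump (k : ℕ) : ContDiffBump (0 : E3) :=
  ⟨1 / (2 * (k + 1)), 1 / (k + 1), by positivity, by gcongr; linarith⟩

/-- The mollification of `F` at scale `1 / (k + 1)`. -/
noncomputable def mollify {V : Type*} [NormedAddCommGroup V] [NormedSpace ℝ V] (k : ℕ) (F : E3 → V) :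
    E3 → V :=
  convolution ((molBump k).normed volume) F (ContinuousLinearMap.lsmul ℝ ℝ) volume

section

variable {V : Type*} [NormedAddCommGroup V]

/-- Translations act continuously on `L²`. -/
lemma tendsto_eLpNorm_translate {F : E3 → V} (hF : MemLp F 2 volume) :
    Tendsto (fun t : E3 => eLpNorm (fun x => F (x - t) - F x) 2 volume) (𝓝 0) (𝓝 0) := by
  let τ : E3 → C(E3, E3) := fun t => ⟨fun x => x - t, by fun_prop⟩
  have hτ : Continuous τ :=
    ContinuousMap.continuous_of_continuous_uncurry _ (by
      change Continuous fun p : E3 × E3 => p.2 - p.1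
      fun_prop)
  have hm : ∀ t, MeasurePreserving (τ t) (volume : Measure E3) volume := fun t =>
    measurePreserving_sub_right volume t
  have h := Filter.Tendsto.compMeasurePreservingLp (f := fun _ : E3 => hF.toLp)
    (tendsto_const_nhds (x := hF.toLp)) (hτ.tendsto 0) hm (hm 0) (by norm_num)
  rw [tendsto_iff_edist_tendsto_0] at h
  refine h.congr fun t => ?_
  rw [Lp.toLp_compMeasurePreserving, Lp.toLp_compMeasurePreserving, Lp.edist_toLp_toLp]
  congr 1
  funext x
  simp [τ]

lemma lintegral_enorm_sq_eq_eLpNorm_sq {α : Type*} [MeasurableSpace α] {μ : Measure α}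
    (f : α → V) : ∫⁻ x, ‖f x‖ₑ ^ 2 ∂μ = eLpNorm f 2 μ ^ 2 := by
  rw [eLpNorm_eq_lintegral_rpow_enorm_toReal two_ne_zero ENNReal.ofNat_ne_top,
    ← ENNReal.rpow_natCast, ← ENNReal.rpow_mul]
  simp

variable [NormedSpace ℝ V]

lemma mollify_apply (k : ℕ) (F : E3 → V) (x : E3) :
    mollify k F x = ∫ t, (molBump k).normed volume t • F (x - t) :=
  convolution_def _

lemma mollify_apply' (k : ℕ) (F : E3 → V) (x : E3) :
    mollify k F x = ∫ t, (molBump k).normed volume (x - t) • F t :=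
  convolution_eq_swap _

lemma molBump_rOut (k : ℕ) : (molBump k).rOut = 1 / (k + 1) := rfl

variable [CompleteSpace V]

/-- Mollifications converge in `L²`. -/
lemma tendsto_mollify {F : E3 → V} (hF : MemLp F 2 volume) :
    Tendsto (fun k => ∫⁻ x, ‖mollify k F x - F x‖ₑ ^ 2) atTop (𝓝 0) := by
  -- Passing to a strongly measurable representative makes Tonelli's theorem applicable.
  wlog hsm : StronglyMeasurable F generalizing F
  · have h1 := this (hF.ae_eq hF.1.ae_eq_mk) hF.1.stronglyMeasurable_mk
    refine h1.congr fun k => lintegral_congr_ae ?_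
    have : mollify k F = mollify k (hF.1.mk F) :=
      convolution_congr _ (ae_eq_refl _) hF.1.ae_eq_mk
    rw [this]
    filter_upwards [hF.1.ae_eq_mk] with x hx
    rw [hx]
  have hloc : LocallyIntegrable F := hF.locallyIntegrable one_le_two
  have hbound : ∀ k, ∫⁻ x, ‖mollify k F x - F x‖ₑ ^ 2 ≤
      ∫⁻ t, ‖(molBump k).normed volume t‖ₑ * ∫⁻ x, ‖F (x - t) - F x‖ₑ ^ 2 := fun k => by
    set ρ := (molBump k).normed (volume : Measure E3)
    have hρc : Continuous ρ := (molBump k).continuous_normed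
    have hρs : HasCompactSupport ρ := (molBump k).hasCompactSupport_normed
    have hρ1 : ∫ t, ρ t = 1 := (molBump k).integral_normed
    have hρi : Integrable ρ := hρc.integrable_of_hasCompactSupport hρs
    have hρl : ∫⁻ t, ‖ρ t‖ₑ = 1 := by
      have : ∀ t, ‖ρ t‖ₑ = ENNReal.ofReal (ρ t) := fun t =>
        Real.enorm_of_nonneg ((molBump k).nonneg_normed t)
      simp_rw [this]
      rw [← ofReal_integral_eq_lintegral_ofReal hρi
        (Eventually.of_forall (molBump k).nonneg_normed), hρ1, ENNReal.ofReal_one]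
    have hmeas : StronglyMeasurable fun p : E3 × E3 => F (p.1 - p.2) - F p.1 :=
      (hsm.comp_measurable (measurable_fst.sub measurable_snd)).sub
        (hsm.comp_measurable measurable_fst)
    calc ∫⁻ x, ‖mollify k F x - F x‖ₑ ^ 2
        ≤ ∫⁻ x, ∫⁻ t, ‖ρ t‖ₑ * ‖F (x - t) - F x‖ₑ ^ 2 := by
          refine lintegral_mono fun x => ?_
          have i1 : Integrable fun t => ρ t • F (x - t) :=
            (hρs.convolutionExists_left (ContinuousLinearMap.lsmul ℝ ℝ) hρc hloc) x
          have i2 : Integrable fun t => ρ t • F x := hρi.smul_const _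
          have e : mollify k F x - F x = ∫ t, ρ t • (F (x - t) - F x) := by
            simp_rw [smul_sub]
            rw [integral_sub i1 i2, integral_smul_const, hρ1, one_smul, mollify_apply]
          have hFx : AEMeasurable fun t => ‖F (x - t) - F x‖ₑ :=
            (hmeas.comp_measurable (measurable_const.prodMk measurable_id)).enorm.aemeasurable
          have hs : ∀ t, ‖ρ t‖ₑ ^ (1 / 2 : ℝ) * ‖ρ t‖ₑ ^ (1 / 2 : ℝ) = ‖ρ t‖ₑ := fun t => by
            rw [← ENNReal.rpow_add_of_nonneg _ _ (by norm_num) (by norm_num)]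
            norm_num
          calc ‖mollify k F x - F x‖ₑ ^ 2
              ≤ (∫⁻ t, ‖ρ t‖ₑ ^ (1 / 2 : ℝ) * (‖ρ t‖ₑ ^ (1 / 2 : ℝ) * ‖F (x - t) - F x‖ₑ)) ^ 2 := by
                rw [e]
                gcongr
                refine (enorm_integral_le_lintegral_enorm _).trans (le_of_eq ?_)
                refine lintegral_congr fun t => ?_
                rw [enorm_smul, ← mul_assoc, hs]
            _ ≤ (∫⁻ t, (‖ρ t‖ₑ ^ (1 / 2 : ℝ)) ^ 2) *
                ∫⁻ t, (‖ρ t‖ₑ ^ (1 / 2 : ℝ) * ‖F (x - t) - F x‖ₑ) ^ 2 :=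
                lintegral_mul_sq_le (hρc.enorm.measurable.pow_const _).aemeasurable
                  ((hρc.enorm.measurable.pow_const _).aemeasurable.mul hFx)
            _ = _ := by
                simp_rw [mul_pow, sq (‖ρ _‖ₑ ^ (1 / 2 : ℝ)), hs, hρl, one_mul]
      _ = ∫⁻ t, ∫⁻ x, ‖ρ t‖ₑ * ‖F (x - t) - F x‖ₑ ^ 2 := by
          refine lintegral_lintegral_swap ?_
          exact ((hρc.enorm.measurable.comp measurable_snd).mul
            (hmeas.enorm.pow_const 2)).aemeasurable
      _ = _ := by
          refine lintegral_congr fun t => ?_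
          rw [lintegral_const_mul' _ _ enorm_ne_top]
  rw [ENNReal.tendsto_nhds_zero]
  intro ε hε
  have htr : Tendsto (fun t : E3 => ∫⁻ x, ‖F (x - t) - F x‖ₑ ^ 2) (𝓝 0) (𝓝 0) := by
    simp_rw [lintegral_enorm_sq_eq_eLpNorm_sq]
    simpa [Function.comp_def] using
      (ENNReal.continuous_pow 2).tendsto 0 |>.comp (tendsto_eLpNorm_translate hF)
  obtain ⟨δ, hδ, hb⟩ := Metric.eventually_nhds_iff_ball.1 (ENNReal.tendsto_nhds_zero.1 htr ε hε)
  have hk : ∀ᶠ k : ℕ in atTop, (1 : ℝ) / (k + 1) < δ :=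
    tendsto_one_div_add_atTop_nhds_zero_nat.eventually (gt_mem_nhds hδ)
  filter_upwards [hk] with k hk
  refine (hbound k).trans ?_
  have hρi : Integrable ((molBump k).normed (volume : Measure E3)) :=
    (molBump k).continuous_normed.integrable_of_hasCompactSupport (molBump k).hasCompactSupport_normed
  calc _ ≤ ∫⁻ t, ‖(molBump k).normed volume t‖ₑ * ε := by
        refine lintegral_mono fun t => ?_
        by_cases ht : t ∈ Metric.ball (0 : E3) δ
        · gcongr
          exact hb t ht
        · have : (molBump k).normed (volume : Measure E3) t = 0 := by
            rw [← Function.notMem_support, (molBump k).support_normed_eq]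
            refine fun h => ht (Metric.ball_subset_ball ?_ h)
            rw [molBump_rOut]
            exact hk.le
          simp [this]
    _ = ε := by
        have : ∀ t, ‖(molBump k).normed (volume : Measure E3) t‖ₑ =
            ENNReal.ofReal ((molBump k).normed volume t) := fun t =>
          Real.enorm_of_nonneg ((molBump k).nonneg_normed t)
        simp_rw [this]
        rw [lintegral_mul_const _ (molBump k).continuous_normed.measurable.ennreal_ofReal,
          ← ofReal_integral_eq_lintegral_ofReal hρi
          (Eventually.of_forall (molBump k).nonneg_normed), (molBump k).integral_normed,
          ENNReal.ofReal_one, one_mul]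
    _ ≤ ε := le_rfl

end

lemma isTest_mollify (k : ℕ) {v : E3 → ℝ} (hv : LocallyIntegrable v) (hs : HasCompactSupport v) :
    IsTest (mollify k v) :=
  ⟨(molBump k).hasCompactSupport_normed.contDiff_convolution_left _ (molBump k).contDiff_normed hv,
    (molBump k).hasCompactSupport_normed.convolution _ hs⟩

/-- Mollification commutes with weak differentiation. -/
lemma gradient_mollify (k : ℕ) {v : E3 → ℝ} {G : E3 → E3} (h : HasWeakGrad univ v G) (x : E3) :
    gradient (mollify k v) x = mollify k G x := by
  set ρ := (molBump k).normed (volume : Measure E3) with hρ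
  have hv : LocallyIntegrable v := locallyIntegrableOn_univ.1 h.1
  have hG : LocallyIntegrable G := locallyIntegrableOn_univ.1 h.2.1
  have hρs : HasCompactSupport ρ := (molBump k).hasCompactSupport_normed
  have hρd : ContDiff ℝ ∞ ρ := (molBump k).contDiff_normed
  have hρ1 : ContDiff ℝ 1 ρ := (molBump k).contDiff_normed (n := 1)
  have hφ : IsTest fun y => ρ (x - y) :=
    ⟨hρd.comp (contDiff_const.sub contDiff_id), hρs.comp_homeomorph (Homeomorph.subLeft x)⟩
  have hd := (hρs.hasFDerivAt_convolution_left (ContinuousLinearMap.lsmul ℝ ℝ) hρ1 hv x).fderiv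
  refine ext_inner_right ℝ fun e => ?_
  rw [inner_gradient_left]
  have hd' : fderiv ℝ (mollify k v) x e = ∫ y, fderiv ℝ ρ (x - y) e * v y := by
    change fderiv ℝ (convolution ρ v (ContinuousLinearMap.lsmul ℝ ℝ) volume) x e = _
    rw [hd, convolution_eq_swap]
    have hi : Integrable fun t => ((ContinuousLinearMap.precompL E3
        (ContinuousLinearMap.lsmul ℝ ℝ : ℝ →L[ℝ] ℝ →L[ℝ] ℝ)) (fderiv ℝ ρ (x - t))) (v t) := by
      have := (hρs.fderiv ℝ).convolutionExists_left (ContinuousLinearMap.precompL E3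
        (ContinuousLinearMap.lsmul ℝ ℝ : ℝ →L[ℝ] ℝ →L[ℝ] ℝ)) (hρ1.continuous_fderiv one_ne_zero)
        hv x
      exact this.integrable_swap
    rw [ContinuousLinearMap.integral_apply hi]
    rfl
  have hi : Integrable fun t => ρ (x - t) • G t := by
    simpa using integrable_smul_of_tsupport_subset h.2.1 hφ.continuous hφ.2 (subset_univ _)
  rw [hd', mollify_apply', ← hρ, real_inner_comm, ← integral_inner hi]
  have := h.integral_mul_fderiv hφ (subset_univ _) e
  have e1 : ∀ y, fderiv ℝ (fun y => ρ (x - y)) y e = -fderiv ℝ ρ (x - y) e := fun y => by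
    have := ((hρ1.differentiable one_ne_zero (x - y)).hasFDerivAt.comp y
      ((hasFDerivAt_id y).const_sub x)).fderiv
    change fderiv ℝ (ρ ∘ fun y => x - y) y e = _
    rw [this]
    simp
  simp only [Measure.restrict_univ, e1, mul_neg, integral_neg, neg_inj] at this
  simp_rw [mul_comm (fderiv ℝ ρ _ e), this, inner_smul_right, real_inner_comm]

/-- Approximation of a compactly supported function by test functions in `H¹`, and also uniformly
if the function is Lipschitz. -/
lemma exists_test_tendsto_of_hasCompactSupport {v : E3 → ℝ} {G : E3 → E3} (hv : MemLp v 2 volume)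
    (hG : MemLp G 2 volume) (hs : HasCompactSupport v) (h : HasWeakGrad univ v G) :
    ∃ φ : ℕ → E3 → ℝ, (∀ k, IsTest (φ k)) ∧
      Tendsto (fun k => energy unitWeight univ (fun x => φ k x - v x)
        (fun x => gradient (φ k) x - G x)) atTop (𝓝 0) ∧
      ∀ C : ℝ≥0, LipschitzWith C v → ∀ k x, |φ k x - v x| ≤ C / (k + 1) := by
  refine ⟨fun k => mollify k v, fun k => isTest_mollify k (hv.locallyIntegrable one_le_two) hs,
    ?_, fun C hC k x => ?_⟩
  · have h1 := (tendsto_mollify hG).add (tendsto_mollify hv)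
    rw [add_zero] at h1
    refine h1.congr fun k => ?_
    unfold energy
    simp_rw [gradient_mollify k h]
    rw [Measure.restrict_univ, ← lintegral_add_left']
    · simp [unitWeight]
    · refine AEStronglyMeasurable.enorm ?_ |>.pow_const 2
      refine AEStronglyMeasurable.sub ?_ hG.1
      have : mollify k G = gradient (mollify k v) := funext fun x => (gradient_mollify k h x).symm
      rw [this]
      exact (measurable_gradient _).aestronglyMeasurable
  · rw [← Real.dist_eq]
    refine ContDiffBump.dist_normed_convolution_le (φ := molBump k) hv.1 fun y hy => ?_
    refine (hC.dist_le_mul y x).trans ?_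
    rw [div_eq_mul_one_div]
    gcongr
    exact (Metric.mem_ball.1 hy).le

/-! ### Density of test functions and Hardy's inequality -/

lemma memLp_two_of_lintegral {α F : Type*} [MeasurableSpace α] {μ : Measure α}
    [NormedAddCommGroup F] {f : α → F} (hf : AEStronglyMeasurable f μ)
    (h : ∫⁻ x, ‖f x‖ₑ ^ 2 ∂μ < ⊤) : MemLp f 2 μ := by
  refine ⟨hf, ?_⟩
  rw [eLpNorm_lt_top_iff_lintegral_rpow_enorm_lt_top two_ne_zero ENNReal.ofNat_ne_top]
  simpa using h

lemma energy_density_eq {c : E3 → ℝ} (hc : IsWeight c) (v : E3 → ℝ) (g : E3 → E3) (x : E3) :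
    ‖g x‖ₑ ^ 2 + ‖v x‖ₑ ^ 2 / ENNReal.ofReal (c x) =
      ENNReal.ofReal (‖g x‖ ^ 2 + |v x| ^ 2 / c x) := by
  have hpos : 0 < c x := zero_lt_one.trans_le (hc.one_le x)
  rw [ENNReal.ofReal_add (by positivity) (by positivity), ENNReal.ofReal_div_of_pos hpos,
    ENNReal.ofReal_pow (norm_nonneg _), ENNReal.ofReal_pow (abs_nonneg _), ofReal_norm,
    ← Real.norm_eq_abs, ofReal_norm]

lemma aemeasurable_energy_density {c : E3 → ℝ} (hc : IsWeight c) {U : Set E3} {v : E3 → ℝ}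
    {g : E3 → E3} (hv : AEStronglyMeasurable v (volume.restrict U))
    (hg : AEStronglyMeasurable g (volume.restrict U)) :
    AEMeasurable (fun x => ‖g x‖ₑ ^ 2 + ‖v x‖ₑ ^ 2 / ENNReal.ofReal (c x)) (volume.restrict U) :=
  (hg.enorm.pow_const 2).add ((hv.enorm.pow_const 2).div hc.measurable.aemeasurable)

/-- The product rule for a test function and a weakly differentiable function. -/
lemma HasWeakGrad.test_mul {v : E3 → ℝ} {G : E3 → E3} (h : HasWeakGrad univ v G) {η : E3 → ℝ}
    (hη : IsTest η) :
    HasWeakGrad univ (fun x => η x * v x) (fun x => η x • G x + v x • gradient η x) := by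
  have hv := locallyIntegrableOn_univ.1 h.1
  have hG := locallyIntegrableOn_univ.1 h.2.1
  have hgc := continuous_gradient hη.contDiff_one
  have hgs := hasCompactSupport_gradient hη.2
  have i1 : Integrable fun x => η x • G x :=
    hG.integrable_smul_left_of_hasCompactSupport hη.continuous hη.2
  have i2 : Integrable fun x => v x • gradient η x := by
    simpa using integrable_smul_of_tsupport_subset' h.1 hgc hgs (subset_univ _)
  have i3 : Integrable fun x => η x * v x :=
    hv.integrable_smul_left_of_hasCompactSupport hη.continuous hη.2
  refine ⟨locallyIntegrableOn_univ.2 i3.locallyIntegrable,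
    locallyIntegrableOn_univ.2 (i1.add i2).locallyIntegrable, fun φ hφ _ => ?_⟩
  have hp : IsTest fun x => η x * φ x := ⟨hη.1.mul hφ.1, hη.2.mul_right⟩
  have e := h.2.2 _ hp (subset_univ _)
  have hd : ∀ x, gradient (fun x => η x * φ x) x = η x • gradient φ x + φ x • gradient η x :=
    fun x => gradient_mul (hη.contDiff_one.differentiable one_ne_zero x)
      (hφ.contDiff_one.differentiable one_ne_zero x)
  have j1 : Integrable fun x => (η x * v x) • gradient φ x := by
    simpa using integrable_smul_of_tsupport_subset' (U := univ)
      (locallyIntegrableOn_univ.2 i3.locallyIntegrable)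
      (continuous_gradient hφ.contDiff_one) (hasCompactSupport_gradient hφ.2) (subset_univ _)
  have j2 : Integrable fun x => (φ x * v x) • gradient η x := by
    have : Integrable fun x => φ x * v x :=
      hv.integrable_smul_left_of_hasCompactSupport hφ.continuous hφ.2
    simpa using integrable_smul_of_tsupport_subset' (U := univ)
      (locallyIntegrableOn_univ.2 this.locallyIntegrable) hgc hgs (subset_univ _)
  have j3 : Integrable fun x => (η x * φ x) • G x :=
    hG.integrable_smul_left_of_hasCompactSupport hp.continuous hp.2
  have e1 : ∫ x, v x • gradient (fun x => η x * φ x) x =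
      (∫ x, (η x * v x) • gradient φ x) + ∫ x, (φ x * v x) • gradient η x := by
    rw [← integral_add j1 j2]
    congr 1
    funext x
    rw [hd]
    module
  have e2 : ∫ x, φ x • (η x • G x + v x • gradient η x) =
      (∫ x, (η x * φ x) • G x) + ∫ x, (φ x * v x) • gradient η x := by
    rw [← integral_add j3 j2]
    congr 1
    funext x
    module
  simp only [Measure.restrict_univ] at e ⊢
  rw [e2, neg_add, ← e, e1]
  abel

/-- Cutting off at larger and larger radii converges in the weighted energy: on the region where
the cut-off at radius `R` varies, its gradient is of order `1 / R`, and so are the inverse square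
roots of the weight. -/
lemma exists_cutoff_tendsto {v : E3 → ℝ} {G : E3 → E3} (h : HasWeakGrad univ v G)
    (he : energy decayWeight univ v G < ⊤) :
    ∃ (V : ℕ → E3 → ℝ) (H : ℕ → E3 → E3), (∀ k, MemLp (V k) 2 volume) ∧
      (∀ k, MemLp (H k) 2 volume) ∧ (∀ k, HasCompactSupport (V k)) ∧
      (∀ k, HasWeakGrad univ (V k) (H k)) ∧
      Tendsto (fun k => energy decayWeight univ (fun x => V k x - v x) (fun x => H k x - G x))
        atTop (𝓝 0) := by
  have hvm : AEStronglyMeasurable v volume := (locallyIntegrableOn_univ.1 h.1).aestronglyMeasurable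
  have hGm : AEStronglyMeasurable G volume :=
    (locallyIntegrableOn_univ.1 h.2.1).aestronglyMeasurable
  let b : ContDiffBump (0 : E3) := ⟨1, 2, one_pos, one_lt_two⟩
  have hb : IsTest b := ⟨b.contDiff, b.hasCompactSupport⟩
  obtain ⟨M, hM⟩ := (continuous_gradient hb.contDiff_one).bounded_above_of_compact_support
    (hasCompactSupport_gradient hb.2)
  have hM0 : 0 ≤ M := (norm_nonneg _).trans (hM 0)
  let s : ℕ → ℝ := fun k => 1 / (k + 1)
  have hs0 : ∀ k, 0 < s k := fun k => by positivity
  have hs1 : ∀ k, s k ≤ 1 := fun k => by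
    simp only [s]
    rw [div_le_one (by positivity)]
    linarith [(Nat.cast_nonneg k : (0 : ℝ) ≤ k)]
  let η : ℕ → E3 → ℝ := fun k x => b (s k • x)
  have hη : ∀ k, IsTest (η k) := fun k =>
    ⟨hb.1.comp (contDiff_const_smul (s k)), hb.2.comp_homeomorph (Homeomorph.smulOfNeZero _ (hs0 k).ne')⟩
  have hgη : ∀ k x, gradient (η k) x = s k • gradient b (s k • x) := fun k x => by
    refine ext_inner_right ℝ fun e => ?_
    have h1 : HasFDerivAt (fun x : E3 => s k • x) (s k • ContinuousLinearMap.id ℝ E3) x :=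
      (hasFDerivAt_id x).const_smul (s k)
    have := ((hb.contDiff_one.differentiable one_ne_zero (s k • x)).hasFDerivAt.comp x h1).fderiv
    rw [inner_gradient_left, inner_smul_left, inner_gradient_left]
    change fderiv ℝ (b ∘ fun x => s k • x) x e = _
    rw [this]
    simp
  have hη1 : ∀ k x, |η k x| ≤ 1 := fun k x => by
    rw [abs_of_nonneg b.nonneg]; exact b.le_one
  have hη1' : ∀ k x, |η k x - 1| ≤ 1 := fun k x => by
    rw [abs_le]
    exact ⟨by linarith [(b.nonneg : 0 ≤ b (s k • x))], by linarith [(b.le_one : b (s k • x) ≤ 1)]⟩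
  have hin : ∀ k x, s k * ‖x‖ < 1 → η k x = 1 ∧ gradient (η k) x = 0 := fun k x hx => by
    have hm : s k • x ∈ Metric.ball (0 : E3) 1 := by
      rw [mem_ball_zero_iff, norm_smul, Real.norm_of_nonneg (hs0 k).le]
      exact hx
    refine ⟨b.one_of_mem_closedBall (Metric.ball_subset_closedBall hm), ?_⟩
    have : gradient b (s k • x) = gradient (fun _ => (1 : ℝ)) (s k • x) := by
      refine Filter.EventuallyEq.gradient_eq ?_
      filter_upwards [Metric.isOpen_ball.mem_nhds hm] with y hy
      exact b.one_of_mem_closedBall (Metric.ball_subset_closedBall hy)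
    rw [hgη, this]
    simp
  have hout : ∀ k x, 2 < s k * ‖x‖ → η k x = 0 ∧ gradient (η k) x = 0 := fun k x hx => by
    have hm : s k • x ∉ tsupport b := by
      rw [b.tsupport_eq, mem_closedBall_zero_iff, norm_smul, Real.norm_of_nonneg (hs0 k).le]
      exact not_le.2 hx
    refine ⟨image_eq_zero_of_notMem_tsupport (f := b) hm, ?_⟩
    rw [hgη, image_eq_zero_of_notMem_tsupport fun h => hm (tsupport_gradient_subset _ h), smul_zero]
  have hwpos : ∀ x : E3, 0 < decayWeight x := fun x =>
    zero_lt_one.trans_le (isWeight_decayWeight.one_le x)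
  have hgb : ∀ k x, ‖gradient (η k) x‖ ^ 2 ≤ 5 * M ^ 2 / decayWeight x := fun k x => by
    by_cases hx : 2 < s k * ‖x‖
    · rw [(hout k x hx).2]
      have := hwpos x
      rw [norm_zero, zero_pow two_ne_zero]
      positivity
    · rw [le_div_iff₀ (hwpos x), hgη, norm_smul, Real.norm_of_nonneg (hs0 k).le, mul_pow]
      have a1 : ‖gradient b (s k • x)‖ ^ 2 ≤ M ^ 2 := by
        gcongr; exact hM _
      have a2 : s k ^ 2 * decayWeight x ≤ 5 := by
        have : (s k * ‖x‖) ^ 2 ≤ 2 ^ 2 := by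
          have := mul_nonneg (hs0 k).le (norm_nonneg x)
          gcongr; exact not_lt.1 hx
        have : s k ^ 2 ≤ 1 := by nlinarith [hs0 k, hs1 k]
        simp only [decayWeight]
        nlinarith
      calc s k ^ 2 * ‖gradient b (s k • x)‖ ^ 2 * decayWeight x
          = (s k ^ 2 * decayWeight x) * ‖gradient b (s k • x)‖ ^ 2 := by ring
        _ ≤ 5 * M ^ 2 := by gcongr
  let V : ℕ → E3 → ℝ := fun k x => η k x * v x
  let H : ℕ → E3 → E3 := fun k x => η k x • G x + v x • gradient (η k) x
  have hVm : ∀ k, AEStronglyMeasurable (V k) volume := fun k =>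
    (hη k).continuous.aestronglyMeasurable.mul hvm
  have hHm : ∀ k, AEStronglyMeasurable (H k) volume := fun k =>
    ((hη k).continuous.aestronglyMeasurable.smul hGm).add
      (hvm.smul (continuous_gradient (hη k).contDiff_one).aestronglyMeasurable)
  let d : E3 → ℝ≥0∞ := fun x => ‖G x‖ₑ ^ 2 + ‖v x‖ₑ ^ 2 / ENNReal.ofReal (decayWeight x)
  have hd : ∫⁻ x, d x < ⊤ := by simpa [energy] using he
  have hdom : ∀ k x, ‖H k x - G x‖ₑ ^ 2 + ‖V k x - v x‖ₑ ^ 2 / ENNReal.ofReal (decayWeight x) ≤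
      ENNReal.ofReal (10 * M ^ 2 + 2) * d x := fun k x => by
    simp only [d]
    rw [energy_density_eq isWeight_decayWeight (fun x => V k x - v x) (fun x => H k x - G x),
      energy_density_eq isWeight_decayWeight, ← ENNReal.ofReal_mul (by positivity)]
    refine ENNReal.ofReal_le_ofReal ?_
    have a1 : ‖H k x - G x‖ ≤ ‖G x‖ + |v x| * ‖gradient (η k) x‖ := by
      have : H k x - G x = (η k x - 1) • G x + v x • gradient (η k) x := by
        simp only [H]; module
      rw [this]
      refine (norm_add_le _ _).trans ?_
      rw [norm_smul, norm_smul, Real.norm_eq_abs, Real.norm_eq_abs]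
      gcongr
      exact mul_le_of_le_one_left (norm_nonneg _) (hη1' k x)
    have a2 : ‖H k x - G x‖ ^ 2 ≤ 2 * ‖G x‖ ^ 2 + 10 * M ^ 2 * (|v x| ^ 2 / decayWeight x) := by
      have c1 : ‖H k x - G x‖ ^ 2 ≤ (‖G x‖ + |v x| * ‖gradient (η k) x‖) ^ 2 := by gcongr
      have c2 : |v x| ^ 2 * ‖gradient (η k) x‖ ^ 2 ≤ |v x| ^ 2 * (5 * M ^ 2 / decayWeight x) := by
        gcongr; exact hgb k x
      have c3 : |v x| ^ 2 * (5 * M ^ 2 / decayWeight x) = 5 * M ^ 2 * (|v x| ^ 2 / decayWeight x) := by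
        ring
      nlinarith [sq_nonneg (‖G x‖ - |v x| * ‖gradient (η k) x‖)]
    have a3 : |V k x - v x| ^ 2 / decayWeight x ≤ |v x| ^ 2 / decayWeight x := by
      have h1 : V k x - v x = (η k x - 1) * v x := by simp only [V]; ring
      have h2 : |V k x - v x| ≤ |v x| := by
        rw [h1, abs_mul]
        exact mul_le_of_le_one_left (abs_nonneg _) (hη1' k x)
      exact div_le_div_of_nonneg_right (pow_le_pow_left₀ (abs_nonneg _) h2 2) (hwpos x).le
    have a4 : 0 ≤ |v x| ^ 2 / decayWeight x := by have := hwpos x; positivity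
    nlinarith [mul_nonneg (sq_nonneg M) (sq_nonneg ‖G x‖)]
  refine ⟨V, H, fun k => ?_, fun k => ?_, fun k => (hη k).2.mul_right,
    fun k => h.test_mul (hη k), ?_⟩
  · refine memLp_two_of_lintegral (hVm k) ?_
    have hb : ∀ x, ‖V k x‖ₑ ^ 2 ≤ ENNReal.ofReal (1 + 4 / s k ^ 2) * d x := fun x => by
      simp only [d]
      rw [energy_density_eq isWeight_decayWeight, ← ENNReal.ofReal_mul (by positivity),
        ← ofReal_norm, ← ENNReal.ofReal_pow (norm_nonneg _)]
      refine ENNReal.ofReal_le_ofReal ?_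
      have hw := hwpos x
      by_cases hx : 2 < s k * ‖x‖
      · simp only [V, (hout k x hx).1, zero_mul, norm_zero, zero_pow two_ne_zero]
        positivity
      · have a1 : ‖V k x‖ ^ 2 ≤ |v x| ^ 2 := by
          simp only [V, norm_mul, Real.norm_eq_abs]
          gcongr
          exact mul_le_of_le_one_left (abs_nonneg _) (hη1 k x)
        have a2 : decayWeight x ≤ 1 + 4 / s k ^ 2 := by
          have : (s k * ‖x‖) ^ 2 ≤ 2 ^ 2 := by
            have := mul_nonneg (hs0 k).le (norm_nonneg x)
            gcongr; exact not_lt.1 hx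
          have := hs0 k
          rw [decayWeight, add_le_add_iff_left, le_div_iff₀ (by positivity)]
          nlinarith
        calc ‖V k x‖ ^ 2 ≤ |v x| ^ 2 := a1
          _ = decayWeight x * (|v x| ^ 2 / decayWeight x) := by field_simp
          _ ≤ (1 + 4 / s k ^ 2) * (‖G x‖ ^ 2 + |v x| ^ 2 / decayWeight x) := by
            have : 0 ≤ ‖G x‖ ^ 2 := by positivity
            gcongr
            linarith
    refine (lintegral_mono hb).trans_lt ?_
    rw [lintegral_const_mul' _ _ ENNReal.ofReal_ne_top]
    exact ENNReal.mul_lt_top ENNReal.ofReal_lt_top hd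
  · have hG2 : MemLp G 2 volume := by
      simpa using memLp_of_energy (U := univ) (by simpa using hGm) he
    have : MemLp (fun x => H k x - G x) 2 volume := by
      refine memLp_two_of_lintegral ((hHm k).sub hGm) ?_
      refine (lintegral_mono fun x => le_self_add.trans (hdom k x)).trans_lt ?_
      rw [lintegral_const_mul' _ _ ENNReal.ofReal_ne_top]
      exact ENNReal.mul_lt_top ENNReal.ofReal_lt_top hd
    refine (this.add hG2).ae_eq (Eventually.of_forall fun x => ?_)
    simp
  · have hlim := tendsto_lintegral_of_dominated_convergence' (μ := volume)
      (F := fun k x => ‖H k x - G x‖ₑ ^ 2 +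
        ‖V k x - v x‖ₑ ^ 2 / ENNReal.ofReal (decayWeight x)) (f := fun _ => 0)
      (fun x => ENNReal.ofReal (10 * M ^ 2 + 2) * d x) (fun k => by
        have := aemeasurable_energy_density (U := univ) isWeight_decayWeight
          (v := fun x => V k x - v x) (g := fun x => H k x - G x)
          (by rw [Measure.restrict_univ]; exact (hVm k).sub hvm)
          (by rw [Measure.restrict_univ]; exact (hHm k).sub hGm)
        simpa using this) (fun k => Eventually.of_forall (hdom k))
      (by
        rw [lintegral_const_mul' _ _ ENNReal.ofReal_ne_top]
        exact (ENNReal.mul_lt_top ENNReal.ofReal_lt_top hd).ne)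
      (Eventually.of_forall fun x => by
        have : Tendsto (fun k => s k * ‖x‖) atTop (𝓝 0) := by
          have := tendsto_one_div_add_atTop_nhds_zero_nat (𝕜 := ℝ).mul_const ‖x‖
          rwa [zero_mul] at this
        refine tendsto_const_nhds.congr' ?_
        filter_upwards [this.eventually (gt_mem_nhds one_pos)] with k hk
        obtain ⟨e1, e2⟩ := hin k x hk
        simp [V, H, e1, e2])
    simpa [energy] using hlim

/-- Test functions are dense in the weighted energy. -/
lemma exists_test_tendsto {v : E3 → ℝ} {G : E3 → E3} (h : HasWeakGrad univ v G)
    (he : energy decayWeight univ v G < ⊤) :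
    ∃ φ : ℕ → E3 → ℝ, (∀ k, IsTest (φ k)) ∧
      Tendsto (fun k => energy decayWeight univ (fun x => φ k x - v x)
        (fun x => gradient (φ k) x - G x)) atTop (𝓝 0) := by
  obtain ⟨V, H, h1, h2, h3, h4, h5⟩ := exists_cutoff_tendsto h he
  have hex : ∀ k : ℕ, ∃ φ : E3 → ℝ, IsTest φ ∧ energy unitWeight univ (fun x => φ x - V k x)
      (fun x => gradient φ x - H k x) ≤ ENNReal.ofReal (1 / (k + 1)) := fun k => by
    obtain ⟨φ, hφ, hl, -⟩ := exists_test_tendsto_of_hasCompactSupport (h1 k) (h2 k) (h3 k) (h4 k)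
    obtain ⟨j, hj⟩ := (ENNReal.tendsto_nhds_zero.1 hl (ENNReal.ofReal (1 / (k + 1)))
      (by simp; positivity)).exists
    exact ⟨φ j, hφ j, hj⟩
  choose φ hφ hφe using hex
  refine ⟨φ, hφ, ?_⟩
  have hz : Tendsto (fun k : ℕ => ENNReal.ofReal (1 / ((k : ℝ) + 1))) atTop (𝓝 0) := by
    simpa using ENNReal.tendsto_ofReal tendsto_one_div_add_atTop_nhds_zero_nat
  have hsum := (ENNReal.Tendsto.const_mul (a := 2) hz (Or.inr (by norm_num))).add
    (ENNReal.Tendsto.const_mul (a := 2) h5 (Or.inr (by norm_num)))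
  simp only [mul_zero, add_zero] at hsum
  refine tendsto_of_tendsto_of_tendsto_of_le_of_le tendsto_const_nhds hsum (fun _ => zero_le)
    fun k => ?_
  have := energy_add_le isWeight_decayWeight (U := univ) (v := fun x => φ k x - V k x)
    (v' := fun x => V k x - v x) (g := fun x => gradient (φ k) x - H k x)
    (g' := fun x => H k x - G x)
    (by rw [Measure.restrict_univ]; exact (hφ k).continuous.aestronglyMeasurable.sub (h1 k).1)
    (by rw [Measure.restrict_univ]
        exact (measurable_gradient _).aestronglyMeasurable.sub (h2 k).1)
  simp only [sub_add_sub_cancel] at this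
  refine this.trans ?_
  gcongr
  exact (decayEnergy_le_unitEnergy _ _ _).trans (hφe k)

/-- The vector field `P x` has divergence `x · ∇P + 3 P`, whose integral vanishes. -/
lemma integral_fderiv_apply_self {P : E3 → ℝ} (h : ContDiff ℝ 1 P) (hs : HasCompactSupport P) :
    ∫ x, (fderiv ℝ P x x + 3 * P x) = 0 := by
  have hc : ∀ i : Fin 3, ContDiff ℝ 1 fun x : E3 => P x * x i := fun i =>
    h.mul (EuclideanSpace.proj (𝕜 := ℝ) i).contDiff
  have hs' : ∀ i : Fin 3, HasCompactSupport fun x : E3 => P x * x i := fun i => hs.mul_right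
  let e : Fin 3 → E3 := fun i => EuclideanSpace.single i 1
  have hd : ∀ (i : Fin 3) (x : E3), fderiv ℝ (fun x : E3 => P x * x i) x (e i) =
      x i * fderiv ℝ P x (e i) + P x := fun i x => by
    have h1 : HasFDerivAt (fun x : E3 => x i) (EuclideanSpace.proj (𝕜 := ℝ) i) x :=
      (EuclideanSpace.proj (𝕜 := ℝ) i : E3 →L[ℝ] ℝ).hasFDerivAt
    have := ((h.differentiable one_ne_zero x).hasFDerivAt.mul h1).fderiv
    change fderiv ℝ (P * fun x : E3 => x i) x (e i) = _
    rw [this]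
    simp [e]
    ring
  have hi : ∀ i : Fin 3, Integrable fun x => fderiv ℝ (fun x : E3 => P x * x i) x (e i) := fun i =>
    (((hc i).continuous_fderiv one_ne_zero).clm_apply
      continuous_const).integrable_of_hasCompactSupport ((hs' i).fderiv_apply ℝ _)
  have hx : ∀ x : E3, fderiv ℝ P x x + 3 * P x =
      ∑ i : Fin 3, fderiv ℝ (fun x : E3 => P x * x i) x (e i) := fun x => by
    simp_rw [hd]
    have hx : fderiv ℝ P x x = ∑ i : Fin 3, x i * fderiv ℝ P x (e i) := by
      have : x = ∑ i : Fin 3, x i • e i := by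
        ext j
        simp [e, Finset.sum_apply, Pi.single_apply]
      calc fderiv ℝ P x x = fderiv ℝ P x (∑ i : Fin 3, x i • e i) := congrArg _ this
        _ = _ := by simp only [map_sum, map_smul, smul_eq_mul]
    rw [hx, Finset.sum_add_distrib]
    simp
  simp_rw [hx]
  rw [integral_finsetSum _ fun i _ => hi i]
  simp [integral_fderiv_eq_zero volume (hc _) (hs' _)]

/-- Hardy's inequality for test functions. The vector field `x / (1 + |x|²)` has divergence at least
`1 / (1 + |x|²)` and length at most `(1 + |x|²)^{-1/2}`. -/
lemma hardy_test {ψ : E3 → ℝ} (hψ : IsTest ψ) :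
    ∫ x, ψ x ^ 2 / decayWeight x ≤ 4 * ∫ x, ‖gradient ψ x‖ ^ 2 := by
  have hw : ContDiff ℝ 1 decayWeight := contDiff_const.add (contDiff_norm_sq ℝ)
  have hwpos : ∀ x : E3, 0 < decayWeight x := fun x =>
    zero_lt_one.trans_le (isWeight_decayWeight.one_le x)
  set P : E3 → ℝ := fun x => ψ x ^ 2 / decayWeight x with hP
  have hPc : ContDiff ℝ 1 P := (hψ.contDiff_one.pow 2).div hw fun x => (hwpos x).ne'
  have hPs : HasCompactSupport P := hψ.2.mono fun x hx h0 => hx (by simp [hP, h0])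
  have hPd : ∀ x, fderiv ℝ P x x = 2 * ψ x * ⟪gradient ψ x, x⟫_ℝ / decayWeight x -
      2 * ψ x ^ 2 * ‖x‖ ^ 2 / decayWeight x ^ 2 := fun x => by
    have d1 : HasFDerivAt decayWeight (2 • innerSL ℝ x) x :=
      ((hasStrictFDerivAt_norm_sq x).hasFDerivAt).const_add 1
    have d2 := (hψ.contDiff_one.differentiable one_ne_zero x).hasFDerivAt
    have d3 : HasFDerivAt (fun x => (decayWeight x)⁻¹)
        (-((decayWeight x ^ 2)⁻¹) • (2 • innerSL ℝ x)) x := by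
      have := (hasDerivAt_inv (hwpos x).ne').comp_hasFDerivAt x d1
      exact this
    have d4 : HasFDerivAt P _ x := (d2.pow 2).mul d3
    rw [d4.fderiv, inner_gradient_left]
    simp
    field_simp
    ring
  have i1 : Integrable fun x => ‖gradient ψ x‖ ^ 2 := by
    refine ((continuous_gradient hψ.contDiff_one).norm.pow 2).integrable_of_hasCompactSupport ?_
    exact (hasCompactSupport_gradient hψ.2).mono fun x hx h0 => hx (by simp [h0])
  have i2 : Integrable P := hPc.continuous.integrable_of_hasCompactSupport hPs
  have i3 : Integrable fun x => fderiv ℝ P x x + 3 * P x := by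
    refine Integrable.add ?_ (i2.const_mul 3)
    refine ((hPc.continuous_fderiv one_ne_zero).clm_apply continuous_id).integrable_of_hasCompactSupport
      ((hPs.fderiv ℝ).mono fun x hx h0 => hx (by simp [h0]))
  have hnonneg : 0 ≤ ∫ x, (2 * ‖gradient ψ x‖ ^ 2 - 1 / 2 * P x + (fderiv ℝ P x x + 3 * P x)) := by
    refine integral_nonneg fun x => ?_
    have hw0 := hwpos x
    simp only [Pi.zero_apply]
    rw [hPd]
    have c1 : |⟪gradient ψ x, x⟫_ℝ| ≤ ‖gradient ψ x‖ * ‖x‖ := abs_real_inner_le_norm _ _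
    set a := ⟪gradient ψ x, x⟫_ℝ
    set w := decayWeight x with hwdef
    set g := ‖gradient ψ x‖
    have hx : ‖x‖ ^ 2 = w - 1 := by simp [hwdef, decayWeight]
    have ha : a ^ 2 ≤ g ^ 2 * (w - 1) := by
      rw [← hx, ← mul_pow]
      exact sq_le_sq' (neg_le_of_abs_le c1) (le_of_abs_le c1)
    have key : 2 * g ^ 2 - 1 / 2 * P x + (2 * ψ x * a / w - 2 * ψ x ^ 2 * ‖x‖ ^ 2 / w ^ 2 + 3 * P x)
        = (2 * (g ^ 2 * w ^ 2 - a ^ 2) + 2 * (a + ψ x / 2) ^ 2 + 2 * ψ x ^ 2 + 2 * a * ψ x * (w - 1)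
          + ψ x ^ 2 / 2 * (w - 1)) / w ^ 2 := by
      rw [hx, hP]
      simp only
      rw [← hwdef]
      field_simp
      ring
    rw [key]
    have hw1 : 1 ≤ w := isWeight_decayWeight.one_le x
    have h3 : a ^ 2 * w ≤ g ^ 2 * (w - 1) * w := by gcongr
    refine div_nonneg ?_ (by positivity)
    nlinarith [sq_nonneg (a + ψ x / 2), mul_nonneg (sub_nonneg.2 hw1) (sq_nonneg (2 * a + ψ x)),
      sq_nonneg g, mul_nonneg (sq_nonneg g) (hw0.le), mul_nonneg (sq_nonneg a) (sub_nonneg.2 hw1)]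
  have i4 : Integrable fun x => 2 * ‖gradient ψ x‖ ^ 2 := i1.const_mul 2
  have i5 : Integrable fun x => 1 / 2 * P x := i2.const_mul _
  have i6 : Integrable fun x => 2 * ‖gradient ψ x‖ ^ 2 - 1 / 2 * P x := i4.sub i5
  rw [integral_add i6 i3, integral_fderiv_apply_self hPc hPs, integral_sub i4 i5,
    integral_const_mul, integral_const_mul] at hnonneg
  linarith

/-- Hardy's inequality: the weighted energy is controlled by the gradient alone. -/
lemma energy_le_of_hasWeakGrad {v : E3 → ℝ} {G : E3 → E3} (h : HasWeakGrad univ v G)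
    (he : energy decayWeight univ v G < ⊤) :
    energy decayWeight univ v G ≤ 42 * ∫⁻ x, ‖G x‖ₑ ^ 2 := by
  have htest : ∀ ψ : E3 → ℝ, IsTest ψ →
      energy decayWeight univ ψ (gradient ψ) ≤ 5 * ∫⁻ x, ‖gradient ψ x‖ₑ ^ 2 := fun ψ hψ => by
    have i1 : Integrable fun x => ‖gradient ψ x‖ ^ 2 := by
      refine ((continuous_gradient hψ.contDiff_one).norm.pow 2).integrable_of_hasCompactSupport ?_
      exact (hasCompactSupport_gradient hψ.2).mono fun x hx h0 => hx (by simp [h0])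
    have hwpos : ∀ x : E3, 0 < decayWeight x := fun x =>
      zero_lt_one.trans_le (isWeight_decayWeight.one_le x)
    have i2 : Integrable fun x => ψ x ^ 2 / decayWeight x :=
      ((hψ.continuous.pow 2).div isWeight_decayWeight.continuous fun x =>
        (hwpos x).ne').integrable_of_hasCompactSupport
        (hψ.2.mono fun x hx h0 => hx (by simp [h0]))
    have e1 : ∀ x, ‖gradient ψ x‖ₑ ^ 2 = ENNReal.ofReal (‖gradient ψ x‖ ^ 2) := fun x => by
      rw [ENNReal.ofReal_pow (norm_nonneg _), ofReal_norm]
    unfold energy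
    simp_rw [energy_density_eq isWeight_decayWeight, e1, sq_abs]
    have i3 : Integrable fun x => ‖gradient ψ x‖ ^ 2 + ψ x ^ 2 / decayWeight x := i1.add i2
    rw [Measure.restrict_univ, ← ofReal_integral_eq_lintegral_ofReal i1
      (Eventually.of_forall fun x => by positivity), ← ofReal_integral_eq_lintegral_ofReal i3
      (Eventually.of_forall fun x => by
        have := hwpos x
        change 0 ≤ ‖gradient ψ x‖ ^ 2 + ψ x ^ 2 / decayWeight x
        positivity)]
    have : (5 : ℝ≥0∞) = ENNReal.ofReal 5 := by norm_num
    rw [this, ← ENNReal.ofReal_mul (by norm_num)]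
    refine ENNReal.ofReal_le_ofReal ?_
    have := hardy_test hψ
    rw [integral_add i1 i2]
    linarith
  obtain ⟨φ, hφ, hl⟩ := exists_test_tendsto h he
  have hvm : AEStronglyMeasurable v volume := (locallyIntegrableOn_univ.1 h.1).aestronglyMeasurable
  have hGm : AEStronglyMeasurable G volume :=
    (locallyIntegrableOn_univ.1 h.2.1).aestronglyMeasurable
  have hb : ∀ k, energy decayWeight univ v G ≤ 42 * energy decayWeight univ (fun x => φ k x - v x)
      (fun x => gradient (φ k) x - G x) + 42 * ∫⁻ x, ‖G x‖ₑ ^ 2 := fun k => by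
    set ε := energy decayWeight univ (fun x => φ k x - v x) (fun x => gradient (φ k) x - G x)
    have hφm : AEStronglyMeasurable (φ k) volume := (hφ k).continuous.aestronglyMeasurable
    have hgm : AEStronglyMeasurable (gradient (φ k)) volume :=
      (measurable_gradient _).aestronglyMeasurable
    have b1 : energy decayWeight univ v G ≤
        2 * energy decayWeight univ (φ k) (gradient (φ k)) + 2 * ε := by
      have := energy_add_le isWeight_decayWeight (U := univ) (v := φ k) (g := gradient (φ k))
        (v' := fun x => v x - φ k x) (g' := fun x => G x - gradient (φ k) x)
        (by simpa using hφm) (by simpa using hgm)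
      simp only [add_sub_cancel] at this
      refine this.trans (le_of_eq ?_)
      congr 2
      refine lintegral_congr fun x => ?_
      rw [← enorm_neg, neg_sub, ← enorm_neg (v x - φ k x), neg_sub]
    have b2 : ∫⁻ x, ‖gradient (φ k) x‖ₑ ^ 2 ≤ 2 * ε + 2 * ∫⁻ x, ‖G x‖ₑ ^ 2 := by
      have hε : ∫⁻ x, ‖gradient (φ k) x - G x‖ₑ ^ 2 ≤ ε := by
        have := lintegral_enorm_sq_le_energy (c := decayWeight) (U := univ)
          (fun x => φ k x - v x) (fun x => gradient (φ k) x - G x)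
        simpa using this
      calc _ ≤ ∫⁻ x, (2 * ‖gradient (φ k) x - G x‖ₑ ^ 2 + 2 * ‖G x‖ₑ ^ 2) := by
            refine lintegral_mono fun x => ?_
            simpa using enorm_add_sq_le (gradient (φ k) x - G x) (G x)
        _ = 2 * (∫⁻ x, ‖gradient (φ k) x - G x‖ₑ ^ 2) + 2 * ∫⁻ x, ‖G x‖ₑ ^ 2 := by
            have hm : AEMeasurable fun x => 2 * ‖gradient (φ k) x - G x‖ₑ ^ 2 :=
              ((hgm.sub hGm).enorm.pow_const 2).const_mul 2
            rw [lintegral_add_left' hm,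
              lintegral_const_mul' _ _ (by norm_num), lintegral_const_mul' _ _ (by norm_num)]
        _ ≤ _ := by gcongr
    calc _ ≤ 2 * (5 * (2 * ε + 2 * ∫⁻ x, ‖G x‖ₑ ^ 2)) + 2 * ε :=
          b1.trans (by gcongr; exact (htest _ (hφ k)).trans (by gcongr))
      _ = 22 * ε + 20 * ∫⁻ x, ‖G x‖ₑ ^ 2 := by ring
      _ ≤ _ := by gcongr <;> norm_num
  have hlim := (ENNReal.Tendsto.const_mul (a := 42) hl (Or.inr (by norm_num))).add_const
    (42 * ∫⁻ x, ‖G x‖ₑ ^ 2)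
  rw [mul_zero, zero_add] at hlim
  exact ge_of_tendsto' hlim hb

/-! ### Bi-Lipschitz maps close to the identity -/

/-- An antilipschitz map enlarges volumes by at most the cube of its constant under preimages. -/
lemma volume_preimage_le {K : ℝ≥0} {T : E3 → E3} (hT : AntilipschitzWith K T) (s : Set E3) :
    volume (T ⁻¹' s) ≤ (K : ℝ≥0∞) ^ 3 * volume s := by
  have h0 := Measure.isAddLeftInvariant_eq_smul (volume : Measure E3) (μH[(3 : ℕ)] : Measure E3)
  have h1 := hT.hausdorffMeasure_preimage_le (d := (3 : ℕ)) (by positivity) s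
  rw [ENNReal.rpow_natCast] at h1
  rw [h0]
  simp only [Measure.smul_apply, ENNReal.smul_def, smul_eq_mul]
  rw [mul_left_comm]
  gcongr

/-- `T` and `S` are inverse to each other, and both differ from the identity by a map that is
Lipschitz with constant `δ` and bounded by `δ`. -/
structure NearId (δ : ℝ≥0) (T S : E3 → E3) : Prop where
  le_half : δ ≤ 1 / 2
  left : Function.LeftInverse S T
  right : Function.RightInverse S T
  lip : LipschitzWith δ fun x => T x - x
  lip_symm : LipschitzWith δ fun x => S x - x
  bound : ∀ x, ‖T x - x‖ ≤ δ
  bound_symm : ∀ x, ‖S x - x‖ ≤ δ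

namespace NearId

variable {δ : ℝ≥0} {T S : E3 → E3}

lemma symm (h : NearId δ T S) : NearId δ S T :=
  ⟨h.le_half, h.right, h.left, h.lip_symm, h.lip, h.bound_symm, h.bound⟩

lemma lipschitz (h : NearId δ T S) : LipschitzWith (1 + δ) T := by
  simpa using LipschitzWith.id.add h.lip

lemma antilipschitz (h : NearId δ T S) : AntilipschitzWith (1 + δ) T :=
  h.symm.lipschitz.to_rightInverse h.left

lemma one_add_le_two (h : NearId δ T S) : 1 + δ ≤ 2 := by
  have := h.le_half
  rw [← NNReal.coe_le_coe] at this ⊢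
  push_cast at *
  linarith

/-- The homeomorphism given by `T` and `S`. -/
def homeomorph (h : NearId δ T S) : E3 ≃ₜ E3 where
  toFun := T
  invFun := S
  left_inv := h.left
  right_inv := h.right
  continuous_toFun := h.lipschitz.continuous
  continuous_invFun := h.symm.lipschitz.continuous

lemma measurableEmbedding (h : NearId δ T S) : MeasurableEmbedding T :=
  h.homeomorph.measurableEmbedding

lemma preimage_image (h : NearId δ T S) (U : Set E3) : T ⁻¹' (T '' U) = U :=
  h.left.injective.preimage_image U

lemma exterior_image (h : NearId δ T S) (D : Set E3) : exterior (T '' D) = T '' exterior D := by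
  have h1 := h.homeomorph.image_closure D
  have h2 := image_compl_eq (s := closure D) h.homeomorph.bijective
  rw [exterior, exterior]
  exact (congrArg _ h1.symm).trans h2.symm

lemma isOpen_image (h : NearId δ T S) {U : Set E3} (hU : IsOpen U) : IsOpen (T '' U) :=
  h.homeomorph.isOpen_image.2 hU

lemma map_volume_le (h : NearId δ T S) :
    (volume : Measure E3).map T ≤ ((1 + δ : ℝ≥0) : ℝ≥0∞) ^ 3 • volume := by
  refine Measure.le_iff.2 fun s hs => ?_
  rw [h.measurableEmbedding.map_apply, Measure.smul_apply, smul_eq_mul]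
  exact volume_preimage_le h.antilipschitz s

lemma quasiMeasurePreserving (h : NearId δ T S) :
    Measure.QuasiMeasurePreserving T volume volume :=
  ⟨h.measurableEmbedding.measurable,
    (Measure.absolutelyContinuous_of_le h.map_volume_le).trans Measure.smul_absolutelyContinuous⟩

lemma quasiMeasurePreserving_restrict (h : NearId δ T S) (U : Set E3) :
    Measure.QuasiMeasurePreserving T (volume.restrict U) (volume.restrict (T '' U)) := by
  refine ⟨h.measurableEmbedding.measurable, ?_⟩
  have := h.measurableEmbedding.restrict_map volume (T '' U)
  rw [h.preimage_image] at this
  rw [← this]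
  exact h.quasiMeasurePreserving.absolutelyContinuous.restrict _

/-- The constant is `(1 + δ)³` for `δ = 1`. As `T` is a measurable embedding, `F` need not be
measurable. -/
lemma lintegral_comp_le (h : NearId δ T S) (U : Set E3) (F : E3 → ℝ≥0∞) :
    ∫⁻ x in U, F (T x) ≤ 8 * ∫⁻ x in T '' U, F x := by
  have e := h.measurableEmbedding.restrict_map volume (T '' U)
  rw [h.preimage_image] at e
  rw [← h.measurableEmbedding.lintegral_map, ← e]
  calc ∫⁻ x in T '' U, F x ∂(volume.map T)
      ≤ ∫⁻ x in T '' U, F x ∂(((1 + δ : ℝ≥0) : ℝ≥0∞) ^ 3 • volume) :=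
        lintegral_mono' (Measure.restrict_mono le_rfl h.map_volume_le) le_rfl
    _ = ((1 + δ : ℝ≥0) : ℝ≥0∞) ^ 3 * ∫⁻ x in T '' U, F x := by
        rw [Measure.restrict_smul, lintegral_smul_measure, smul_eq_mul]
    _ ≤ 2 ^ 3 * ∫⁻ x in T '' U, F x := by
        gcongr
        exact_mod_cast h.one_add_le_two
    _ = _ := by norm_num

lemma map_hausdorffMeasure_le (h : NearId δ T S) (Γ : Set E3) :
    ((μH[2] : Measure E3).restrict Γ).map T ≤ (4 : ℝ≥0∞) • (μH[2]).restrict (T '' Γ) := by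
  have e := h.measurableEmbedding.restrict_map μH[2] (T '' Γ)
  rw [h.preimage_image] at e
  rw [← e, ← Measure.restrict_smul]
  refine Measure.restrict_mono le_rfl (Measure.le_iff.2 fun s hs => ?_)
  rw [h.measurableEmbedding.map_apply, Measure.smul_apply, smul_eq_mul]
  refine (h.antilipschitz.hausdorffMeasure_preimage_le zero_le_two s).trans ?_
  gcongr
  rw [ENNReal.rpow_two]
  calc ((1 + δ : ℝ≥0) : ℝ≥0∞) ^ 2 ≤ 2 ^ 2 := by
        gcongr
        exact_mod_cast h.one_add_le_two
    _ = 4 := by norm_num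

lemma integrable_comp (h : NearId δ T S) {F : Type*} [NormedAddCommGroup F] {f : E3 → F}
    (hf : Integrable f) : Integrable fun x => f (T x) := by
  refine (h.measurableEmbedding.integrable_map_iff (g := f)).1 ?_
  exact (hf.smul_measure (by finiteness)).mono_measure h.map_volume_le

lemma memLp_comp (h : NearId δ T S) {F : Type*} [NormedAddCommGroup F] {f : E3 → F}
    (hf : MemLp f 2 volume) : MemLp (fun x => f (T x)) 2 volume := by
  refine (h.measurableEmbedding.memLp_map_measure_iff (g := f)).1 ?_
  exact MemLp.of_measure_le_smul (by finiteness) h.map_volume_le hf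

lemma integral_comp_le (h : NearId δ T S) {f : E3 → ℝ} (hf : Integrable f) (h0 : ∀ x, 0 ≤ f x) :
    ∫ x, f (T x) ≤ (1 + δ) ^ 3 * ∫ x, f x := by
  rw [← h.measurableEmbedding.integral_map]
  refine (integral_mono_measure h.map_volume_le (Eventually.of_forall h0)
    (hf.smul_measure (by finiteness))).trans (le_of_eq ?_)
  rw [integral_smul_measure, ENNReal.toReal_pow, ENNReal.coe_toReal, smul_eq_mul]
  push_cast
  rfl

lemma le_integral_comp (h : NearId δ T S) {f : E3 → ℝ} (hf : Integrable f) (h0 : ∀ x, 0 ≤ f x) :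
    ∫ x, f x ≤ (1 + δ) ^ 3 * ∫ x, f (T x) := by
  have := h.symm.integral_comp_le (h.integrable_comp hf) fun x => h0 _
  simpa only [h.right _] using this

/-- A change of variables close to the identity changes integrals little. -/
lemma abs_integral_comp_sub_le (h : NearId δ T S) {f : E3 → ℝ} (hf : Integrable f) :
    |(∫ x, f (T x)) - ∫ x, f x| ≤ 7 * δ * ∫ x, |f x| := by
  have hδ : (δ : ℝ) ≤ 1 / 2 := by exact_mod_cast h.le_half
  have hδ0 : (0 : ℝ) ≤ δ := δ.2
  have key : ∀ g : E3 → ℝ, Integrable g → (∀ x, 0 ≤ g x) →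
      |(∫ x, g (T x)) - ∫ x, g x| ≤ 7 * δ * ∫ x, g x := fun g hg h0 => by
    have h1 := h.integral_comp_le hg h0
    have h2 := h.le_integral_comp hg h0
    have h3 : 0 ≤ ∫ x, g x := integral_nonneg h0
    -- The constant 7 comes from expanding the cube with `δ² ≤ δ`.
    have hK : (1 + δ : ℝ) ^ 3 ≤ 1 + 7 * δ := by nlinarith [mul_nonneg hδ0 hδ0]
    have h4 : (1 - 7 * δ : ℝ) * (1 + δ) ^ 3 ≤ 1 := by nlinarith [mul_nonneg hδ0 hδ0]
    rw [abs_le]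
    constructor
    · by_cases h5 : (1 - 7 * δ : ℝ) ≤ 0
      · have := integral_nonneg (μ := volume) (f := fun x => g (T x)) fun x => h0 _
        nlinarith
      · have h6 : (0 : ℝ) ≤ ∫ x, g (T x) := integral_nonneg fun x => h0 _
        have := mul_le_mul_of_nonneg_left h2 (le_of_not_ge h5)
        nlinarith [mul_le_mul_of_nonneg_right h4 h6]
    · nlinarith [mul_le_mul_of_nonneg_right hK h3]
  have hp := key _ hf.pos_part fun x => le_max_right _ _
  have hn := key _ hf.neg_part fun x => le_max_right _ _
  have e : ∀ x, f x = max (f x) 0 - max (-f x) 0 := fun x => by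
    rcases le_total 0 (f x) with h | h <;> simp [h]
  have e' : ∀ x, |f x| = max (f x) 0 + max (-f x) 0 := fun x => by
    rcases le_total 0 (f x) with h | h <;> simp [h, abs_of_nonneg, abs_of_nonpos]
  have i1 := integral_sub hf.pos_part hf.neg_part
  have i2 := integral_add hf.pos_part hf.neg_part
  have i3 := integral_sub (h.integrable_comp hf.pos_part) (h.integrable_comp hf.neg_part)
  simp only [← e] at i1 i3
  simp only [← e'] at i2
  rw [i1, i2, i3]
  rw [abs_le] at *
  constructor <;> linarith [hp.1, hp.2, hn.1, hn.2]

end NearId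

/-! ### Pull-back of gradients -/

/-- The pull-back `x ↦ (DT x)ᵀ G(T x)` of a gradient field, so that `∇(v ∘ T)` is the pull-back
of `∇v`. For a Lipschitz map `T`, the points where it is not differentiable are a null set. -/
noncomputable def pullGrad (T : E3 → E3) (G : E3 → E3) (x : E3) : E3 :=
  (fderiv ℝ T x).adjoint (G (T x))

lemma pullGrad_sub (T : E3 → E3) (G H : E3 → E3) (x : E3) :
    pullGrad T (fun y => G y - H y) x = pullGrad T G x - pullGrad T H x := by
  simp [pullGrad]

lemma gradient_comp {T : E3 → E3} {φ : E3 → ℝ} {x : E3} (hT : DifferentiableAt ℝ T x)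
    (hφ : DifferentiableAt ℝ φ (T x)) :
    gradient (fun y => φ (T y)) x = pullGrad T (gradient φ) x := by
  refine ext_inner_right ℝ fun e => ?_
  have : fderiv ℝ (fun y => φ (T y)) x = (fderiv ℝ φ (T x)).comp (fderiv ℝ T x) :=
    fderiv_comp x hφ hT
  rw [pullGrad, ContinuousLinearMap.adjoint_inner_left, inner_gradient_left, inner_gradient_left,
    this]
  rfl

namespace NearId

variable {δ : ℝ≥0} {T S : E3 → E3}

lemma norm_fderiv_le (h : NearId δ T S) (x : E3) : ‖fderiv ℝ T x‖ ≤ 1 + δ :=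
  norm_fderiv_le_of_lipschitz ℝ h.lipschitz

lemma norm_pullGrad_le (h : NearId δ T S) (G : E3 → E3) (x : E3) :
    ‖pullGrad T G x‖ ≤ 2 * ‖G (T x)‖ := by
  have h1 : (δ : ℝ) ≤ 1 / 2 := by exact_mod_cast h.le_half
  refine (ContinuousLinearMap.le_opNorm _ _).trans ?_
  gcongr
  rw [LinearIsometryEquiv.norm_map]
  linarith [h.norm_fderiv_le x]

lemma enorm_pullGrad_le (h : NearId δ T S) (G : E3 → E3) (x : E3) :
    ‖pullGrad T G x‖ₑ ≤ 2 * ‖G (T x)‖ₑ := by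
  have := h.norm_pullGrad_le G x
  rw [← ofReal_norm, ← ofReal_norm]
  refine (ENNReal.ofReal_le_ofReal this).trans (le_of_eq ?_)
  rw [ENNReal.ofReal_mul zero_le_two, ENNReal.ofReal_ofNat]

lemma ae_differentiableAt (h : NearId δ T S) : ∀ᵐ x : E3, DifferentiableAt ℝ T x :=
  h.lipschitz.ae_differentiableAt

lemma ae_comp {p : E3 → Prop} (h : NearId δ T S) (hp : ∀ᵐ x : E3, p x) : ∀ᵐ x : E3, p (T x) :=
  h.quasiMeasurePreserving.ae hp

lemma gradient_comp_ae (h : NearId δ T S) {φ : E3 → ℝ} (hφ : Differentiable ℝ φ) :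
    gradient (fun y => φ (T y)) =ᵐ[volume] pullGrad T (gradient φ) := by
  filter_upwards [h.ae_differentiableAt] with x hx
  exact gradient_comp hx (hφ _)

/-- Pulling back by `T` and then by its inverse is the identity. -/
lemma pullGrad_pullGrad_ae (h : NearId δ T S) (G : E3 → E3) :
    pullGrad S (pullGrad T G) =ᵐ[volume] G := by
  filter_upwards [h.symm.ae_differentiableAt, h.symm.ae_comp h.ae_differentiableAt] with x h1 h2
  have e : (fderiv ℝ T (S x)).comp (fderiv ℝ S x) = ContinuousLinearMap.id ℝ E3 := by
    rw [← fderiv_comp x h2 h1, h.right.comp_eq_id, fderiv_id]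
  refine ext_inner_right ℝ fun e' => ?_
  rw [pullGrad, pullGrad, ContinuousLinearMap.adjoint_inner_left,
    ContinuousLinearMap.adjoint_inner_left, h.right x]
  exact congrArg (fun L : E3 →L[ℝ] E3 => ⟪G x, L e'⟫_ℝ) e

lemma aestronglyMeasurable_pullGrad (h : NearId δ T S) {U : Set E3} {G : E3 → E3}
    (hG : AEStronglyMeasurable G (volume.restrict (T '' U))) :
    AEStronglyMeasurable (pullGrad T G) (volume.restrict U) := by
  have h1 : AEStronglyMeasurable (fun x => G (T x)) (volume.restrict U) :=
    hG.comp_quasiMeasurePreserving (h.quasiMeasurePreserving_restrict U)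
  have h2 : AEStronglyMeasurable (fun x => (fderiv ℝ T x).adjoint) (volume.restrict U) :=
    (ContinuousLinearMap.adjoint (𝕜 := ℝ) (E := E3) (F := E3)).continuous.comp_aestronglyMeasurable
      (measurable_fderiv ℝ T).aestronglyMeasurable
  exact (ContinuousLinearMap.id ℝ (E3 →L[ℝ] E3)).aestronglyMeasurable_comp₂ h2 h1

lemma memLp_pullGrad (h : NearId δ T S) {G : E3 → E3} (hG : MemLp G 2 volume) :
    MemLp (pullGrad T G) 2 volume := by
  have h1 := h.aestronglyMeasurable_pullGrad (U := univ) (G := G)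
    (hG.1.mono_measure Measure.restrict_le_self)
  rw [Measure.restrict_univ] at h1
  refine (h.memLp_comp hG).of_le_mul (c := 2) h1 (Eventually.of_forall fun x => ?_)
  exact h.norm_pullGrad_le G x

/-- The constant collects `2²` for the derivative or `4` for the weight, and `2³` for the volume. -/
lemma energy_comp_le (h : NearId δ T S) {c : E3 → ℝ} (hc : IsWeight c) (U : Set E3) (v : E3 → ℝ)
    (G : E3 → E3) :
    energy c U (fun x => v (T x)) (pullGrad T G) ≤ 32 * energy c (T '' U) v G := by
  have hδ : (δ : ℝ) ≤ 1 / 2 := by exact_mod_cast h.le_half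
  calc _ ≤ ∫⁻ x in U, 4 * (‖G (T x)‖ₑ ^ 2 + ‖v (T x)‖ₑ ^ 2 / ENNReal.ofReal (c (T x))) := by
        refine lintegral_mono fun x => ?_
        rw [mul_add]
        gcongr
        · calc ‖pullGrad T G x‖ₑ ^ 2 ≤ (2 * ‖G (T x)‖ₑ) ^ 2 := by
                gcongr; exact h.enorm_pullGrad_le G x
            _ = _ := by rw [mul_pow]; norm_num
        · have h1 : ENNReal.ofReal (c (T x)) ≤ 4 * ENNReal.ofReal (c x) := by
            rw [← ENNReal.ofReal_ofNat 4, ← ENNReal.ofReal_mul (by norm_num)]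
            exact ENNReal.ofReal_le_ofReal (hc.le_mul _ _ ((h.bound x).trans (by linarith)))
          rw [← mul_div_assoc, ENNReal.le_div_iff_mul_le (Or.inl (hc.ofReal_ne_zero _))
            (Or.inl ENNReal.ofReal_ne_top)]
          calc _ ≤ ‖v (T x)‖ₑ ^ 2 / ENNReal.ofReal (c x) * (4 * ENNReal.ofReal (c x)) := by gcongr
            _ = 4 * (‖v (T x)‖ₑ ^ 2 / ENNReal.ofReal (c x) * ENNReal.ofReal (c x)) := by ring
            _ = _ := by
              rw [ENNReal.div_mul_cancel (hc.ofReal_ne_zero _) ENNReal.ofReal_ne_top]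
    _ ≤ 4 * (8 * ∫⁻ x in T '' U, (‖G x‖ₑ ^ 2 + ‖v x‖ₑ ^ 2 / ENNReal.ofReal (c x))) := by
        rw [lintegral_const_mul' _ _ (by norm_num)]
        gcongr
        exact h.lintegral_comp_le U fun y => ‖G y‖ₑ ^ 2 + ‖v y‖ₑ ^ 2 / ENNReal.ofReal (c y)
    _ = _ := by rw [energy, ← mul_assoc]; norm_num

end NearId

lemma memLp_gradient_of_lipschitz {χ : E3 → ℝ} {C : ℝ≥0} (hC : LipschitzWith C χ)
    (hs : HasCompactSupport χ) : MemLp (gradient χ) 2 volume := by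
  refine MemLp.mono' (memLp_indicator_const 2 hs.isClosed.measurableSet (C : ℝ)
    (Or.inr hs.measure_lt_top.ne)) (measurable_gradient _).aestronglyMeasurable
    (Eventually.of_forall fun x => ?_)
  by_cases hx : x ∈ tsupport χ
  · rw [indicator_of_mem hx]
    exact norm_gradient_le_of_lipschitz hC x
  · rw [indicator_of_notMem hx, image_eq_zero_of_notMem_tsupport fun h =>
      hx (tsupport_gradient_subset _ h), norm_zero]

/-- Lipschitz functions with compact support can take the place of test functions in the
definition of traces. -/
lemma hasTraceWith_of_lipschitz {c : E3 → ℝ} (hc : IsWeight c) {U Γ : Set E3} (hΓ : μH[2] Γ < ⊤)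
    {v g : E3 → ℝ} {G : E3 → E3} {χ : ℕ → E3 → ℝ} (hχ : ∀ k, ∃ C, LipschitzWith C (χ k))
    (hs : ∀ k, HasCompactSupport (χ k))
    (hg : AEStronglyMeasurable g ((μH[2] : Measure E3).restrict Γ))
    (he : Tendsto (fun k => energy c U (fun x => χ k x - v x) (fun x => gradient (χ k) x - G x))
      atTop (𝓝 0))
    (ht : Tendsto (fun k => eLpNorm (fun x => χ k x - g x) 2 ((μH[2] : Measure E3).restrict Γ))
      atTop (𝓝 0)) : HasTraceWith c U Γ v G g := by
  set μΓ := (μH[2] : Measure E3).restrict Γ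
  have hfin : μΓ univ < ⊤ := by rwa [Measure.restrict_apply_univ]
  have hex : ∀ k : ℕ, ∃ φ : E3 → ℝ, IsTest φ ∧
      energy c U (fun x => φ x - χ k x) (fun x => gradient φ x - gradient (χ k) x) ≤
        ((k : ℝ≥0∞) + 1)⁻¹ ∧ ∀ x, |φ x - χ k x| ≤ ((k : ℝ) + 1)⁻¹ := fun k => by
    obtain ⟨C, hC⟩ := hχ k
    have m1 : MemLp (χ k) 2 volume := hC.continuous.memLp_of_hasCompactSupport (hs k)
    have m2 := memLp_gradient_of_lipschitz hC (hs k)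
    obtain ⟨φ, hφ, hφe, hφu⟩ := exists_test_tendsto_of_hasCompactSupport m1 m2 (hs k)
      (hasWeakGrad_of_lipschitz hC univ)
    have e1 : ∀ᶠ j in atTop, energy unitWeight univ (fun x => φ j x - χ k x)
        (fun x => gradient (φ j) x - gradient (χ k) x) ≤ ((k : ℝ≥0∞) + 1)⁻¹ :=
      (hφe.eventually_lt_const (by simp : (0 : ℝ≥0∞) < ((k : ℝ≥0∞) + 1)⁻¹)).mono fun _ h => h.le
    have e2 : ∀ᶠ j : ℕ in atTop, (C : ℝ) / (j + 1) ≤ ((k : ℝ) + 1)⁻¹ := by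
      have : Tendsto (fun j : ℕ => (C : ℝ) / (j + 1)) atTop (𝓝 0) := by
        have := (tendsto_one_div_add_atTop_nhds_zero_nat (𝕜 := ℝ)).const_mul (C : ℝ)
        rw [mul_zero] at this
        exact this.congr fun j => mul_one_div _ _
      exact (this.eventually_lt_const (by positivity)).mono fun _ h => h.le
    obtain ⟨j, hj1, hj2⟩ := (e1.and e2).exists
    refine ⟨φ j, hφ j, ?_, fun x => (hφu C hC j x).trans hj2⟩
    refine le_trans ?_ hj1
    refine (lintegral_mono fun x => ?_).trans (energy_mono_set (subset_univ U) _ _)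
    gcongr
    simpa [unitWeight] using hc.one_le x
  choose φ hφ hφe hφu using hex
  refine ⟨φ, hφ, ?_, ?_⟩
  · have hb : ∀ k, energy c U (fun x => φ k x - v x) (fun x => gradient (φ k) x - G x) ≤
        2 * ((k : ℝ≥0∞) + 1)⁻¹ +
          2 * energy c U (fun x => χ k x - v x) (fun x => gradient (χ k) x - G x) := fun k => by
      obtain ⟨C, hC⟩ := hχ k
      have := energy_add_le hc (U := U) (v := fun x => φ k x - χ k x)
        (v' := fun x => χ k x - v x) (g := fun x => gradient (φ k) x - gradient (χ k) x)
        (g' := fun x => gradient (χ k) x - G x)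
        ((hφ k).continuous.sub hC.continuous).aestronglyMeasurable
        ((measurable_gradient _).sub (measurable_gradient _)).aestronglyMeasurable
      simp only [sub_add_sub_cancel] at this
      refine this.trans ?_
      gcongr
      exact hφe k
    have hk : Tendsto (fun k : ℕ => ((k : ℝ≥0∞) + 1)⁻¹) atTop (𝓝 0) := by
      have := ENNReal.tendsto_inv_nat_nhds_zero.comp (tendsto_add_atTop_nat 1)
      exact this.congr fun k => by simp
    refine tendsto_of_tendsto_of_tendsto_of_le_of_le tendsto_const_nhds ?_ (fun _ => zero_le) hb
    have := (ENNReal.Tendsto.const_mul (a := 2) hk (Or.inr (by norm_num))).add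
      (ENNReal.Tendsto.const_mul (a := 2) he (Or.inr (by norm_num)))
    simpa using this
  · have hb : ∀ k, eLpNorm (fun x => φ k x - g x) 2 μΓ ≤
        μΓ univ ^ (2 : ℝ≥0∞).toReal⁻¹ * ENNReal.ofReal ((k : ℝ) + 1)⁻¹ +
          eLpNorm (fun x => χ k x - g x) 2 μΓ := fun k => by
      obtain ⟨C, hC⟩ := hχ k
      have e : (fun x => φ k x - g x) = (fun x => φ k x - χ k x) + fun x => χ k x - g x := by
        funext x; simp
      refine (congrArg (eLpNorm · 2 μΓ) e).le.trans ?_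
      refine (eLpNorm_add_le ((hφ k).continuous.sub hC.continuous).aestronglyMeasurable
        (hC.continuous.aestronglyMeasurable.sub hg) one_le_two).trans ?_
      refine add_le_add_left ?_ _
      exact eLpNorm_le_of_ae_bound (Eventually.of_forall fun x => hφu k x)
    have hk : Tendsto (fun k : ℕ => ENNReal.ofReal ((k : ℝ) + 1)⁻¹) atTop (𝓝 0) := by
      have := ENNReal.tendsto_ofReal (tendsto_one_div_add_atTop_nhds_zero_nat (𝕜 := ℝ))
      simpa using this
    refine tendsto_of_tendsto_of_tendsto_of_le_of_le tendsto_const_nhds ?_ (fun _ => zero_le) hb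
    have := (ENNReal.Tendsto.const_mul (a := μΓ univ ^ (2 : ℝ≥0∞).toReal⁻¹) hk
      (Or.inr (ENNReal.rpow_ne_top_of_nonneg (by norm_num) hfin.ne))).add ht
    simpa using this

/-! ### Functions composed with maps close to the identity -/

namespace NearId

variable {δ : ℝ≥0} {T S : E3 → E3}

lemma exists_lipschitz_comp (h : NearId δ T S) {φ : E3 → ℝ} (hφ : IsTest φ) :
    ∃ C, LipschitzWith C fun x => φ (T x) :=
  let ⟨_, hC⟩ := hφ.exists_lipschitz
  ⟨_, hC.comp h.lipschitz⟩

lemma hasCompactSupport_comp (h : NearId δ T S) {φ : E3 → ℝ} (hφ : HasCompactSupport φ) :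
    HasCompactSupport fun x => φ (T x) :=
  hφ.comp_homeomorph h.homeomorph

lemma energy_test_comp_le (h : NearId δ T S) {c : E3 → ℝ} (hc : IsWeight c) (U : Set E3)
    (v : E3 → ℝ) (G : E3 → E3) {φ : E3 → ℝ} (hφ : IsTest φ) :
    energy c U (fun x => φ (T x) - v (T x))
      (fun x => gradient (fun y => φ (T y)) x - pullGrad T G x) ≤
      32 * energy c (T '' U) (fun x => φ x - v x) (fun x => gradient φ x - G x) := by
  refine le_trans (le_of_eq (energy_congr (ae_eq_refl _) ?_))
    (h.energy_comp_le hc U (fun x => φ x - v x) fun x => gradient φ x - G x)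
  filter_upwards [ae_restrict_of_ae
    (h.gradient_comp_ae (hφ.contDiff_one.differentiable one_ne_zero))] with x hx
  rw [hx, pullGrad_sub]

lemma tendsto_energy_comp (h : NearId δ T S) {c : E3 → ℝ} (hc : IsWeight c) {U : Set E3}
    {v : E3 → ℝ} {G : E3 → E3} {φ : ℕ → E3 → ℝ} (hφ : ∀ k, IsTest (φ k))
    (he : Tendsto (fun k => energy c (T '' U) (fun x => φ k x - v x)
      (fun x => gradient (φ k) x - G x)) atTop (𝓝 0)) :
    Tendsto (fun k => energy c U (fun x => φ k (T x) - v (T x))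
      (fun x => gradient (fun y => φ k (T y)) x - pullGrad T G x)) atTop (𝓝 0) := by
  have := ENNReal.Tendsto.const_mul (a := 32) he (Or.inr (by norm_num))
  rw [mul_zero] at this
  exact tendsto_of_tendsto_of_tendsto_of_le_of_le tendsto_const_nhds this (fun _ => zero_le)
    fun k => h.energy_test_comp_le hc U v G (hφ k)

lemma hasTraceWith_comp (h : NearId δ T S) {c : E3 → ℝ} (hc : IsWeight c) {U Γ : Set E3}
    (hΓ : μH[2] Γ < ⊤) {v g : E3 → ℝ} {G : E3 → E3}
    (hg : MemLp g 2 ((μH[2] : Measure E3).restrict (T '' Γ)))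
    (ht : HasTraceWith c (T '' U) (T '' Γ) v G g) :
    HasTraceWith c U Γ (fun x => v (T x)) (pullGrad T G) (fun x => g (T x)) := by
  obtain ⟨φ, hφ, hφe, hφt⟩ := ht
  have hle : ∀ F : E3 → ℝ, eLpNorm (fun x => F (T x)) 2 ((μH[2] : Measure E3).restrict Γ) ≤
      4 ^ (1 / (2 : ℝ≥0∞)).toReal * eLpNorm F 2 ((μH[2] : Measure E3).restrict (T '' Γ)) :=
    fun F => by
      refine (h.measurableEmbedding.eLpNorm_map_measure (g := F)).symm.le.trans ?_
      exact (eLpNorm_mono_measure _ (h.map_hausdorffMeasure_le Γ)).trans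
        (eLpNorm_smul_measure_le _ _ _ _)
  refine hasTraceWith_of_lipschitz hc hΓ (χ := fun k x => φ k (T x))
    (fun k => h.exists_lipschitz_comp (hφ k)) (fun k => h.hasCompactSupport_comp (hφ k).2) ?_
    (h.tendsto_energy_comp hc hφ hφe) ?_
  · refine (h.measurableEmbedding.aestronglyMeasurable_map_iff (g := g)).1 ?_
    exact (hg.1.smul_measure 4).mono_measure (h.map_hausdorffMeasure_le Γ)
  · have := ENNReal.Tendsto.const_mul (a := 4 ^ (1 / (2 : ℝ≥0∞)).toReal) hφt
      (Or.inr (ENNReal.rpow_ne_top_of_nonneg (by positivity) (by norm_num)))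
    rw [mul_zero] at this
    exact tendsto_of_tendsto_of_tendsto_of_le_of_le tendsto_const_nhds this (fun _ => zero_le)
      fun k => hle fun x => φ k x - g x

lemma hasWeakGrad_comp (h : NearId δ T S) {c : E3 → ℝ} (hc : IsWeight c) {U Γ : Set E3}
    (hU : IsOpen U) {v g : E3 → ℝ} {G : E3 → E3} (hv : HasWeakGrad (T '' U) v G)
    (he : energy c (T '' U) v G < ⊤) (ht : HasTraceWith c (T '' U) Γ v G g) :
    HasWeakGrad U (fun x => v (T x)) (pullGrad T G) := by
  obtain ⟨φ, hφ, hφe, -⟩ := ht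
  have hfin : energy c U (fun x => v (T x)) (pullGrad T G) < ⊤ :=
    (h.energy_comp_le hc U v G).trans_lt (ENNReal.mul_lt_top (by norm_num) he)
  -- The approximating test functions turn into Lipschitz functions, whose weak gradients are known.
  refine hasWeakGrad_of_tendsto_energy hc (v := fun k x => φ k (T x)) (fun k => ?_) ?_ ?_
    (h.tendsto_energy_comp hc hφ hφe)
  · obtain ⟨C, hC⟩ := h.exists_lipschitz_comp (hφ k)
    exact hasWeakGrad_of_lipschitz hC U
  · exact locallyIntegrableOn_of_energy hc hU (hv.1.aestronglyMeasurable.comp_quasiMeasurePreserving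
      (h.quasiMeasurePreserving_restrict U)) hfin
  · refine locallyIntegrableOn_of_locallyIntegrable_restrict ?_
    exact (memLp_of_energy (h.aestronglyMeasurable_pullGrad hv.2.1.aestronglyMeasurable)
      hfin).locallyIntegrable one_le_two

/-- The space `W` of the perturbed partition is pulled back to that of the reference partition. -/
lemma hasGradW_comp (h : NearId δ T S) {D Γ : Set E3} (hD : IsOpen D) (hΓ : μH[2] Γ < ⊤)
    {v : E3 → ℝ} {G : E3 → E3} (hv : HasGradW (T '' D) (T '' Γ) v G) :
    HasGradW D Γ (fun x => v (T x)) (pullGrad T G) := by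
  obtain ⟨w1, w2, e1, e2, g, hg, t1, t2⟩ := hv
  rw [h.exterior_image] at w2 e2 t2
  refine ⟨h.hasWeakGrad_comp isWeight_unitWeight hD w1 e1 t1,
    h.hasWeakGrad_comp isWeight_decayWeight (isOpen_exterior D) w2 e2 t2,
    (h.energy_comp_le isWeight_unitWeight D v G).trans_lt (ENNReal.mul_lt_top (by norm_num) e1),
    (h.energy_comp_le isWeight_decayWeight _ v G).trans_lt (ENNReal.mul_lt_top (by norm_num) e2),
    fun x => g (T x), ?_, h.hasTraceWith_comp isWeight_unitWeight hΓ hg t1,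
    h.hasTraceWith_comp isWeight_decayWeight hΓ hg t2⟩
  refine (h.measurableEmbedding.memLp_map_measure_iff (g := g)).1 ?_
  exact MemLp.of_measure_le_smul (by norm_num) (h.map_hausdorffMeasure_le Γ) hg

/-- A test function changes little in `L²` under composition with a map close to the identity: the
difference is an integral of the gradient along the segments from `x` to `T x`. -/
lemma lintegral_test_comp_sub_le (h : NearId δ T S) {ψ : E3 → ℝ} (hψ : IsTest ψ) :
    ∫⁻ x, ‖ψ (T x) - ψ x‖ₑ ^ 2 ≤ 8 * (δ : ℝ≥0∞) ^ 2 * ∫⁻ x, ‖gradient ψ x‖ₑ ^ 2 := by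
  have hδ : (δ : ℝ) ≤ 1 / 2 := by exact_mod_cast h.le_half
  have hgc := continuous_gradient hψ.contDiff_one
  have hTc : Continuous T := h.lipschitz.continuous
  -- The map `R s` moves `x` to an intermediate point of the segment from `x` to `T x`. It need not be
  -- invertible; being antilipschitz is enough to bound integrals of compositions.
  set R : ℝ → E3 → E3 := fun s x => x + s • (T x - x) with hR
  have hRc : Continuous fun p : E3 × ℝ => R p.2 p.1 := by fun_prop
  have hRa : ∀ s ∈ Icc (0 : ℝ) 1, AntilipschitzWith 2 (R s) := fun s hs => by
    refine AntilipschitzWith.of_le_mul_dist fun x y => ?_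
    have h1 := h.lip.dist_le_mul x y
    rw [dist_eq_norm] at h1 ⊢
    rw [dist_eq_norm] at h1 ⊢
    have e : R s x - R s y = (x - y) + s • ((T x - x) - (T y - y)) := by
      simp only [hR, smul_sub]; abel
    have h2 : ‖x - y‖ ≤ ‖R s x - R s y‖ + ‖s • ((T x - x) - (T y - y))‖ := by
      rw [e]
      simpa using norm_sub_le ((x - y) + s • ((T x - x) - (T y - y)))
        (s • ((T x - x) - (T y - y)))
    rw [norm_smul, Real.norm_of_nonneg hs.1] at h2
    have h3 : s * ‖(T x - x) - (T y - y)‖ ≤ 1 * (1 / 2 * ‖x - y‖) :=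
      mul_le_mul hs.2 (h1.trans (by gcongr)) (norm_nonneg _) zero_le_one
    push_cast
    linarith
  have hRl : ∀ s ∈ Icc (0 : ℝ) 1, ∫⁻ x, ‖gradient ψ (R s x)‖ₑ ^ 2 ≤
      8 * ∫⁻ x, ‖gradient ψ x‖ₑ ^ 2 := fun s hs => by
    have hc : Continuous (R s) := hRc.comp (by fun_prop : Continuous fun x : E3 => (x, s))
    rw [← lintegral_map (f := fun x => ‖gradient ψ x‖ₑ ^ 2) (by fun_prop) hc.measurable,
      ← smul_eq_mul, ← lintegral_smul_measure]
    refine lintegral_mono' (Measure.le_iff.2 fun t ht => ?_) le_rfl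
    rw [Measure.map_apply hc.measurable ht, Measure.smul_apply, smul_eq_mul]
    refine (volume_preimage_le (hRa s hs) t).trans (le_of_eq ?_)
    norm_num
  have hpt : ∀ x, ‖ψ (T x) - ψ x‖ₑ ^ 2 ≤
      (δ : ℝ≥0∞) ^ 2 * ∫⁻ s in Icc (0 : ℝ) 1, ‖gradient ψ (R s x)‖ₑ ^ 2 := fun x => by
    have hd : ∀ s ∈ uIcc (0 : ℝ) 1, HasDerivAt (fun s => ψ (R s x))
        ⟪gradient ψ (R s x), T x - x⟫_ℝ s := fun s _ => by
      have h1 := (hψ.contDiff_one.differentiable one_ne_zero (R s x)).hasFDerivAt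
      have h2 : HasDerivAt (fun s => R s x) (T x - x) s := by
        simpa [hR] using ((hasDerivAt_id s).smul_const (T x - x)).const_add x
      rw [inner_gradient_left]
      exact h1.comp_hasDerivAt s h2
    have hcs : Continuous fun s => gradient ψ (R s x) :=
      hgc.comp (hRc.comp (by fun_prop : Continuous fun s : ℝ => (x, s)))
    have hI := intervalIntegral.integral_eq_sub_of_hasDerivAt hd
      ((hcs.inner continuous_const).intervalIntegrable _ _)
    have e1 : R 1 x = T x := by simp [hR]
    have e0 : R 0 x = x := by simp [hR]
    rw [e1, e0, intervalIntegral.integral_of_le zero_le_one, ← integral_Icc_eq_integral_Ioc] at hI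
    have hb : ‖ψ (T x) - ψ x‖ₑ ≤ δ * ∫⁻ s in Icc (0 : ℝ) 1, ‖gradient ψ (R s x)‖ₑ := by
      rw [← hI]
      refine (enorm_integral_le_lintegral_enorm _).trans ?_
      rw [← lintegral_const_mul' _ _ ENNReal.coe_ne_top]
      refine lintegral_mono fun s => ?_
      have h1 : ‖⟪gradient ψ (R s x), T x - x⟫_ℝ‖ ≤ δ * ‖gradient ψ (R s x)‖ := by
        rw [mul_comm]
        refine (norm_inner_le_norm _ _).trans ?_
        gcongr
        exact h.bound x
      have := ENNReal.ofReal_le_ofReal h1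
      rwa [ENNReal.ofReal_mul δ.coe_nonneg, ofReal_norm, ofReal_norm, ENNReal.ofReal_coe_nnreal] at this
    have hcsq := lintegral_mul_sq_le (μ := volume.restrict (Icc (0 : ℝ) 1))
      (f := fun _ => 1) (g := fun s => ‖gradient ψ (R s x)‖ₑ) aemeasurable_const
      hcs.enorm.measurable.aemeasurable
    simp only [one_mul, one_pow, lintegral_one, Measure.restrict_apply_univ, Real.volume_Icc,
      sub_zero, ENNReal.ofReal_one] at hcsq
    calc _ ≤ (δ * ∫⁻ s in Icc (0 : ℝ) 1, ‖gradient ψ (R s x)‖ₑ) ^ 2 := by gcongr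
      _ = (δ : ℝ≥0∞) ^ 2 * (∫⁻ s in Icc (0 : ℝ) 1, ‖gradient ψ (R s x)‖ₑ) ^ 2 := mul_pow _ _ _
      _ ≤ _ := by gcongr
  calc _ ≤ ∫⁻ x, (δ : ℝ≥0∞) ^ 2 * ∫⁻ s in Icc (0 : ℝ) 1, ‖gradient ψ (R s x)‖ₑ ^ 2 :=
        lintegral_mono hpt
    _ = (δ : ℝ≥0∞) ^ 2 * ∫⁻ s in Icc (0 : ℝ) 1, ∫⁻ x, ‖gradient ψ (R s x)‖ₑ ^ 2 := by
        rw [lintegral_const_mul' _ _ (by finiteness), lintegral_lintegral_swap]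
        exact ((hgc.comp hRc).enorm.measurable.pow_const 2).aemeasurable
    _ ≤ (δ : ℝ≥0∞) ^ 2 * ∫⁻ _ in Icc (0 : ℝ) 1, 8 * ∫⁻ x, ‖gradient ψ x‖ₑ ^ 2 := by
        refine mul_le_mul_right ?_ _
        exact setLIntegral_mono' measurableSet_Icc hRl
    _ = _ := by
        rw [setLIntegral_const, Real.volume_Icc]
        simp only [sub_zero, ENNReal.ofReal_one, mul_one]
        ring

end NearId

/-! ### Perturbation of the bilinear form -/

/-- The norm of `L²(ℝ³)` as a real number. -/
noncomputable def l2Norm {F : Type*} [NormedAddCommGroup F] (g : E3 → F) : ℝ :=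
  (eLpNorm g 2 volume).toReal

lemma l2Norm_nonneg {F : Type*} [NormedAddCommGroup F] (g : E3 → F) : 0 ≤ l2Norm g :=
  ENNReal.toReal_nonneg

lemma integrable_norm_mul_norm {F F' : Type*} [NormedAddCommGroup F] [NormedAddCommGroup F']
    {g : E3 → F} {k : E3 → F'} (hg : MemLp g 2 volume) (hk : MemLp k 2 volume) :
    Integrable fun x => ‖g x‖ * ‖k x‖ :=
  hg.norm.integrable_mul hk.norm

lemma integral_norm_mul_norm_le {F F' : Type*} [NormedAddCommGroup F] [NormedAddCommGroup F']
    {g : E3 → F} {k : E3 → F'} (hg : MemLp g 2 volume) (hk : MemLp k 2 volume) :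
    ∫ x, ‖g x‖ * ‖k x‖ ≤ l2Norm g * l2Norm k := by
  have h1 : ∫⁻ x, ‖g x‖ₑ * ‖k x‖ₑ ≤ eLpNorm g 2 volume * eLpNorm k 2 volume := by
    refine (ENNReal.pow_le_pow_left_iff two_ne_zero).1 ?_
    rw [mul_pow, ← lintegral_enorm_sq_eq_eLpNorm_sq, ← lintegral_enorm_sq_eq_eLpNorm_sq]
    exact lintegral_mul_sq_le hg.1.enorm hk.1.enorm
  rw [integral_eq_lintegral_of_nonneg_ae (Eventually.of_forall fun x => by positivity)
    (integrable_norm_mul_norm hg hk).1, l2Norm, l2Norm, ← ENNReal.toReal_mul]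
  refine ENNReal.toReal_mono (ENNReal.mul_ne_top hg.2.ne hk.2.ne) (le_trans (le_of_eq ?_) h1)
  refine lintegral_congr fun x => ?_
  rw [ENNReal.ofReal_mul (norm_nonneg _), ofReal_norm, ofReal_norm]

lemma memLp_bdd_smul {F : Type*} [NormedAddCommGroup F] [NormedSpace ℝ F] {A : E3 → ℝ} {M : ℝ}
    (hA : Measurable A) (hM : ∀ x, |A x| ≤ M) {g : E3 → F} (hg : MemLp g 2 volume) :
    MemLp (fun x => A x • g x) 2 volume := by
  refine hg.of_le_mul (c := M) (hA.aestronglyMeasurable.smul hg.1) (Eventually.of_forall fun x => ?_)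
  rw [norm_smul, Real.norm_eq_abs]
  gcongr
  exact hM x

lemma integrable_inner {F : Type*} [NormedAddCommGroup F] [InnerProductSpace ℝ F] {g k : E3 → F}
    (hg : MemLp g 2 volume) (hk : MemLp k 2 volume) :
    Integrable fun x => ⟪g x, k x⟫_ℝ :=
  (integrable_norm_mul_norm hg hk).mono' (hg.1.inner hk.1)
    (Eventually.of_forall fun _ => norm_inner_le_norm _ _)

lemma integrable_mul_inner {A : E3 → ℝ} {M : ℝ} (hA : Measurable A) (hM : ∀ x, |A x| ≤ M)
    {g k : E3 → E3} (hg : MemLp g 2 volume) (hk : MemLp k 2 volume) :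
    Integrable fun x => A x * ⟪g x, k x⟫_ℝ := by
  simpa [inner_smul_left] using integrable_inner (memLp_bdd_smul hA hM hg) hk

/-- If `L` is close to the identity, then so is `L Lᵀ`. -/
lemma abs_inner_adjoint_sub_le {δ : ℝ} (hδ : δ ≤ 1 / 2) {L : E3 →L[ℝ] E3}
    (hL : ‖L - ContinuousLinearMap.id ℝ E3‖ ≤ δ) (a b : E3) :
    |⟪L.adjoint a, L.adjoint b⟫_ℝ - ⟪a, b⟫_ℝ| ≤ 3 * δ * (‖a‖ * ‖b‖) := by
  set P := (L - ContinuousLinearMap.id ℝ E3).adjoint with hP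
  have hPn : ‖P‖ ≤ δ := by rwa [hP, LinearIsometryEquiv.norm_map]
  have hPa : ∀ z, ‖P z‖ ≤ δ * ‖z‖ := fun z => P.le_of_opNorm_le hPn z
  have e : ∀ z, L.adjoint z = z + P z := fun z => by
    rw [hP, map_sub, ContinuousLinearMap.adjoint_id]
    simp
  have hδ0 : 0 ≤ δ := (norm_nonneg _).trans hL
  have e2 : ⟪L.adjoint a, L.adjoint b⟫_ℝ - ⟪a, b⟫_ℝ = ⟪a, P b⟫_ℝ + ⟪P a, b⟫_ℝ + ⟪P a, P b⟫_ℝ := by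
    rw [e, e]
    simp only [inner_add_left, inner_add_right]
    ring
  rw [e2]
  have b1 : |⟪a, P b⟫_ℝ| ≤ ‖a‖ * (δ * ‖b‖) :=
    (abs_real_inner_le_norm _ _).trans (by gcongr; exact hPa b)
  have b2 : |⟪P a, b⟫_ℝ| ≤ (δ * ‖a‖) * ‖b‖ :=
    (abs_real_inner_le_norm _ _).trans (by gcongr; exact hPa a)
  have b3 : |⟪P a, P b⟫_ℝ| ≤ (δ * ‖a‖) * (δ * ‖b‖) :=
    (abs_real_inner_le_norm _ _).trans (by gcongr; exacts [hPa a, hPa b])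
  have b4 : δ * δ * (‖a‖ * ‖b‖) ≤ δ * 1 * (‖a‖ * ‖b‖) := by gcongr; linarith
  refine (abs_add_three _ _ _).trans ?_
  linarith

namespace NearId

variable {δ : ℝ≥0} {T S : E3 → E3}

lemma norm_fderiv_sub_id_le (h : NearId δ T S) {x : E3} (hx : DifferentiableAt ℝ T x) :
    ‖fderiv ℝ T x - ContinuousLinearMap.id ℝ E3‖ ≤ δ := by
  have := norm_fderiv_le_of_lipschitz ℝ h.lip (x₀ := x)
  rwa [fderiv_fun_sub hx differentiableAt_fun_id, fderiv_fun_id] at this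

/-- The bilinear form changes little under pull-back by a map close to the identity. The constant
collects `3 * 2³` for the derivative and `7` for the volume. -/
lemma abs_integral_inner_pullGrad_sub_le (h : NearId δ T S) {A : E3 → ℝ} {M : ℝ}
    (hA : Measurable A) (hM : ∀ x, |A x| ≤ M) {g k : E3 → E3} (hg : MemLp g 2 volume)
    (hk : MemLp k 2 volume) :
    |(∫ x, A (T x) * ⟪pullGrad T g x, pullGrad T k x⟫_ℝ) - ∫ x, A x * ⟪g x, k x⟫_ℝ| ≤
      31 * M * δ * (l2Norm g * l2Norm k) := by
  have hδ : (δ : ℝ) ≤ 1 / 2 := by exact_mod_cast h.le_half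
  have hM0 : 0 ≤ M := (abs_nonneg _).trans (hM 0)
  have hAT : Measurable fun x => A (T x) := hA.comp h.measurableEmbedding.measurable
  have hi := integrable_norm_mul_norm hg hk
  have hN := integral_norm_mul_norm_le hg hk
  have hN0 : 0 ≤ ∫ x, ‖g x‖ * ‖k x‖ := integral_nonneg fun x => by positivity
  have i0 := integrable_mul_inner hA hM hg hk
  have i1 := integrable_mul_inner hAT (fun x => hM _) (h.memLp_pullGrad hg) (h.memLp_pullGrad hk)
  have i2 := h.integrable_comp i0
  have h1 := h.abs_integral_comp_sub_le i0
  have h2 : ∫ x, |A x * ⟪g x, k x⟫_ℝ| ≤ M * ∫ x, ‖g x‖ * ‖k x‖ := by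
    rw [← integral_const_mul]
    refine integral_mono i0.abs (hi.const_mul M) fun x => ?_
    rw [abs_mul]
    exact mul_le_mul (hM x) (abs_real_inner_le_norm _ _) (abs_nonneg _) hM0
  have h3 : |(∫ x, A (T x) * ⟪pullGrad T g x, pullGrad T k x⟫_ℝ) -
      ∫ x, A (T x) * ⟪g (T x), k (T x)⟫_ℝ| ≤ M * (3 * δ) * ∫ x, ‖g (T x)‖ * ‖k (T x)‖ := by
    rw [← integral_sub i1 i2, ← integral_const_mul, ← Real.norm_eq_abs]
    refine (norm_integral_le_of_norm_le ((h.integrable_comp hi).const_mul (M * (3 * δ))) ?_)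
    filter_upwards [h.ae_differentiableAt] with x hx
    rw [← mul_sub, Real.norm_eq_abs, abs_mul, mul_assoc M]
    exact mul_le_mul (hM _) (abs_inner_adjoint_sub_le hδ (h.norm_fderiv_sub_id_le hx) _ _)
      (abs_nonneg _) hM0
  have h4 := h.integral_comp_le hi fun x => by positivity
  have h5 : (1 + δ : ℝ) ^ 3 ≤ 8 := by
    calc (1 + δ : ℝ) ^ 3 ≤ 2 ^ 3 := by gcongr; linarith
      _ = 8 := by norm_num
  calc _ ≤ M * (3 * δ) * (∫ x, ‖g (T x)‖ * ‖k (T x)‖) + 7 * δ * ∫ x, |A x * ⟪g x, k x⟫_ℝ| :=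
        (abs_sub_le _ _ _).trans (add_le_add h3 h1)
    _ ≤ M * (3 * δ) * (8 * ∫ x, ‖g x‖ * ‖k x‖) + 7 * δ * (M * ∫ x, ‖g x‖ * ‖k x‖) := by
        gcongr
        exact h4.trans (by gcongr)
    _ = 31 * M * δ * ∫ x, ‖g x‖ * ‖k x‖ := by ring
    _ ≤ _ := by gcongr

end NearId

/-! ### The perturbation maps -/

/-- The displacement `κ n` with compact support, as a bounded Lipschitz field. -/
lemma exists_lipschitz_smul {κt : E3 → ℝ} (hκ : ContDiff ℝ 1 κt) (hs : HasCompactSupport κt)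
    {nt : E3 → E3} (hn : LocallyLipschitz nt) :
    ∃ L M : ℝ≥0, LipschitzWith L (fun x => κt x • nt x) ∧ ∀ x, ‖κt x • nt x‖ ≤ M := by
  obtain ⟨Lκ, hLκ⟩ := ContDiff.lipschitzWith_of_hasCompactSupport hs hκ one_ne_zero
  obtain ⟨Mκ, hMκ⟩ := hκ.continuous.bounded_above_of_compact_support hs
  obtain ⟨Ln, hLn⟩ := hn.locallyLipschitzOn.exists_lipschitzOnWith_of_compact
    (s := tsupport κt) hs
  obtain ⟨Mn, hMn⟩ := hs.exists_bound_of_continuousOn (s := tsupport κt) hn.continuous.continuousOn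
  have hMκ0 : 0 ≤ Mκ := (norm_nonneg _).trans (hMκ 0)
  have hb : ∀ x ∈ tsupport κt, ‖nt x‖ ≤ Mn.toNNReal := fun x hx =>
    (hMn x hx).trans (Real.le_coe_toNNReal _)
  have h0 : ∀ x ∉ tsupport κt, κt x = 0 := fun x hx => image_eq_zero_of_notMem_tsupport hx
  -- It is enough that one of the two points lies in the support of `κt`: the Lipschitz constant of
  -- `nt` enters only if both do.
  have key : ∀ x ∈ tsupport κt, ∀ y, ‖κt x • nt x - κt y • nt y‖ ≤
      (Lκ * Mn.toNNReal + Mκ.toNNReal * Ln) * ‖x - y‖ := fun x hx y => by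
    have e : κt x • nt x - κt y • nt y = (κt x - κt y) • nt x + κt y • (nt x - nt y) := by
      rw [sub_smul, smul_sub]; abel
    have b1 : ‖(κt x - κt y) • nt x‖ ≤ Lκ * ‖x - y‖ * Mn.toNNReal := by
      rw [norm_smul]
      gcongr
      exacts [hLκ.norm_sub_le x y, hb x hx]
    have b2 : ‖κt y • (nt x - nt y)‖ ≤ Mκ.toNNReal * (Ln * ‖x - y‖) := by
      by_cases hy : y ∈ tsupport κt
      · rw [norm_smul]
        gcongr
        · exact (hMκ y).trans (Real.le_coe_toNNReal _)
        · exact hLn.norm_sub_le hx hy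
      · rw [h0 y hy, zero_smul, norm_zero]
        positivity
    rw [e]
    refine (norm_add_le _ _).trans ((add_le_add b1 b2).trans (le_of_eq ?_))
    ring
  refine ⟨Lκ * Mn.toNNReal + Mκ.toNNReal * Ln, Mκ.toNNReal * Mn.toNNReal,
    LipschitzWith.of_dist_le_mul fun x y => ?_, fun x => ?_⟩
  · rw [dist_eq_norm, dist_eq_norm]
    push_cast
    by_cases hx : x ∈ tsupport κt
    · exact key x hx y
    · by_cases hy : y ∈ tsupport κt
      · rw [norm_sub_rev, norm_sub_rev x]
        exact key y hy x
      · rw [h0 x hx, h0 y hy, zero_smul, zero_smul, sub_zero, norm_zero]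
        positivity
  · by_cases hx : x ∈ tsupport κt
    · rw [norm_smul]
      push_cast
      gcongr
      exacts [(hMκ x).trans (Real.le_coe_toNNReal _), hb x hx]
    · rw [h0 x hx, zero_smul, norm_zero]
      positivity

/-- The sum of the identity and a small Lipschitz field is close to the identity. The inverse maps
`y` to the fixed point of `x ↦ y - F x`. -/
lemma exists_nearId_add {F : E3 → E3} {δ : ℝ≥0} (hF : LipschitzWith δ F) (hb : ∀ x, ‖F x‖ ≤ δ)
    (hδ : 2 * δ ≤ 1 / 2) : ∃ S, NearId (2 * δ) (fun x => x + F x) S := by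
  have hδ' : 2 * (δ : ℝ) ≤ 1 / 2 := by exact_mod_cast hδ
  have hδ0 : (0 : ℝ) ≤ δ := δ.2
  have hc : ∀ y, ContractingWith δ fun x => y - F x := fun y => by
    refine ⟨?_, by simpa using (LipschitzWith.const y).sub hF⟩
    rw [← NNReal.coe_lt_coe]
    push_cast
    linarith
  set S : E3 → E3 := fun y => (hc y).fixedPoint
  have hS : ∀ y, S y + F (S y) = y := fun y => by
    have : y - F (S y) = S y := (hc y).fixedPoint_isFixedPt
    nth_rewrite 1 [← this]
    abel
  have hinj : Function.Injective fun x => x + F x := fun x y hxy => by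
    have h1 := hF.norm_sub_le x y
    have h2 : x - y = -(F x - F y) := by
      have : x + F x = y + F y := hxy
      rw [neg_sub, sub_eq_sub_iff_add_eq_add, this, add_comm]
    rw [← norm_neg (F x - F y), ← h2] at h1
    rw [← sub_eq_zero, ← norm_le_zero_iff]
    nlinarith [norm_nonneg (x - y)]
  have hSF : ∀ y, S y - y = -F (S y) := fun y => by
    nth_rewrite 2 [← hS y]
    abel
  refine ⟨S, hδ, fun x => hinj (hS _), hS, ?_, LipschitzWith.of_dist_le_mul fun x y => ?_,
    fun x => ?_, fun x => ?_⟩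
  · simpa using hF.weaken (by simp [two_mul] : δ ≤ 2 * δ)
  · have h1 := hF.norm_sub_le (S x) (S y)
    rw [hSF, hSF, dist_eq_norm, dist_eq_norm, neg_sub_neg, norm_sub_rev]
    have h2 : S x - S y = (x - y) - (F (S x) - F (S y)) := by
      nth_rewrite 2 [← hS x]
      nth_rewrite 2 [← hS y]
      abel
    have h3 : ‖S x - S y‖ ≤ ‖x - y‖ + ‖F (S x) - F (S y)‖ := by
      rw [h2]; exact norm_sub_le _ _
    push_cast
    have h4 : ‖S x - S y‖ ≤ 2 * ‖x - y‖ := by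
      nlinarith [norm_nonneg (S x - S y)]
    nlinarith
  · simpa using (hb x).trans (by linarith)
  · rw [hSF, norm_neg]
    exact (hb _).trans (by push_cast; linarith)

lemma exists_nearId_perturbMap {κt : E3 → ℝ} (hκ : ContDiff ℝ 1 κt) (hs : HasCompactSupport κt)
    {nt : E3 → E3} (hn : LocallyLipschitz nt) :
    ∃ C : ℝ≥0, ∀ ε : ℝ≥0, C * ε ≤ 1 / 2 →
      ∃ S, NearId (C * ε) (perturbMap κt nt ε) S := by
  obtain ⟨L, M, hL, hM⟩ := exists_lipschitz_smul hκ hs hn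
  refine ⟨2 * (L + M), fun ε hε => ?_⟩
  rw [mul_assoc] at hε ⊢
  have e : perturbMap κt nt ε = fun x => x + (ε : ℝ) • κt x • nt x := by
    funext x; rw [perturbMap, mul_smul]
  rw [e]
  refine exists_nearId_add (F := fun x => (ε : ℝ) • κt x • nt x) ?_ (fun x => ?_) hε
  · refine LipschitzWith.of_dist_le_mul fun x y => ?_
    have := hL.dist_le_mul x y
    rw [dist_smul₀, Real.norm_of_nonneg ε.coe_nonneg]
    push_cast
    calc _ ≤ (ε : ℝ) * (L * dist x y) := mul_le_mul_of_nonneg_left this ε.coe_nonneg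
      _ ≤ (ε : ℝ) * ((L + M) * dist x y) := by gcongr; simp
      _ = _ := by ring
  · rw [norm_smul, Real.norm_of_nonneg ε.coe_nonneg]
    push_cast
    rw [mul_comm]
    gcongr
    exact (hM x).trans (by simp)

/-! ### Weak solutions -/

lemma l2Norm_eq_sqrt {F : Type*} [NormedAddCommGroup F] (g : E3 → F) :
    l2Norm g = √(∫⁻ x, ‖g x‖ₑ ^ 2).toReal := by
  rw [lintegral_enorm_sq_eq_eLpNorm_sq, ENNReal.toReal_pow, Real.sqrt_sq ENNReal.toReal_nonneg]
  rfl

lemma tendsto_l2Norm {F : Type*} [NormedAddCommGroup F] {g : ℕ → E3 → F}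
    (h : Tendsto (fun k => ∫⁻ x, ‖g k x‖ₑ ^ 2) atTop (𝓝 0)) :
    Tendsto (fun k => l2Norm (g k)) atTop (𝓝 0) := by
  have := (Real.continuous_sqrt.tendsto _).comp
    ((ENNReal.tendsto_toReal ENNReal.zero_ne_top).comp h)
  simp only [ENNReal.toReal_zero, Real.sqrt_zero] at this
  exact this.congr fun k => (l2Norm_eq_sqrt _).symm

lemma tendsto_integral_inner {F : Type*} [NormedAddCommGroup F] [InnerProductSpace ℝ F]
    {g k₀ : E3 → F} {k : ℕ → E3 → F} (hg : MemLp g 2 volume) (hk : ∀ j, MemLp (k j) 2 volume)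
    (hk₀ : MemLp k₀ 2 volume)
    (h : Tendsto (fun j => ∫⁻ x, ‖k j x - k₀ x‖ₑ ^ 2) atTop (𝓝 0)) :
    Tendsto (fun j => ∫ x, ⟪g x, k j x⟫_ℝ) atTop (𝓝 (∫ x, ⟪g x, k₀ x⟫_ℝ)) := by
  rw [tendsto_iff_norm_sub_tendsto_zero]
  have h1 := (tendsto_l2Norm h).const_mul (l2Norm g)
  rw [mul_zero] at h1
  refine squeeze_zero (fun _ => norm_nonneg _) (fun j => ?_) h1
  have hd : MemLp (fun x => k j x - k₀ x) 2 volume := (hk j).sub hk₀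
  rw [← integral_sub (integrable_inner hg (hk j)) (integrable_inner hg hk₀)]
  refine (norm_integral_le_of_norm_le (integrable_norm_mul_norm hg hd)
    (Eventually.of_forall fun x => ?_)).trans (integral_norm_mul_norm_le hg hd)
  rw [← inner_sub_right]
  exact norm_inner_le_norm _ _

lemma IsTest.memLp {φ : E3 → ℝ} (h : IsTest φ) : MemLp φ 2 volume :=
  h.continuous.memLp_of_hasCompactSupport h.2

lemma IsTest.memLp_gradient {φ : E3 → ℝ} (h : IsTest φ) : MemLp (gradient φ) 2 volume :=
  (continuous_gradient h.contDiff_one).memLp_of_hasCompactSupport (hasCompactSupport_gradient h.2)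

/-- The weak equation extends from test functions to Lipschitz functions with compact support. -/
lemma integral_eq_of_lipschitz {A : E3 → ℝ} {M : ℝ} (hA : Measurable A) (hM : ∀ x, |A x| ≤ M)
    {P : E3 → E3} (hP : MemLp P 2 volume) {f : E3 → ℝ} (hf : MemLp f 2 volume)
    (h : ∀ φ, IsTest φ → ∫ x, A x * ⟪P x, gradient φ x⟫_ℝ = ∫ x, f x * φ x)
    {χ : E3 → ℝ} {C : ℝ≥0} (hχ : LipschitzWith C χ) (hs : HasCompactSupport χ) :
    ∫ x, A x * ⟪P x, gradient χ x⟫_ℝ = ∫ x, f x * χ x := by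
  have m1 : MemLp χ 2 volume := hχ.continuous.memLp_of_hasCompactSupport hs
  have m2 := memLp_gradient_of_lipschitz hχ hs
  obtain ⟨φ, hφ, he, -⟩ := exists_test_tendsto_of_hasCompactSupport m1 m2 hs
    (hasWeakGrad_of_lipschitz hχ univ)
  have l1 := tendsto_integral_inner (memLp_bdd_smul hA hM hP) (fun k => (hφ k).memLp_gradient) m2
    (by simpa using tendsto_sq_of_tendsto_energy he)
  have l2 := tendsto_integral_inner hf (fun k => (hφ k).memLp) m1
    (by simpa [unitWeight] using tendsto_weighted_sq_of_tendsto_energy he)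
  simp only [real_inner_smul_left] at l1
  simp only [RCLike.inner_apply, conj_trivial, mul_comm _ (f _)] at l2
  refine tendsto_nhds_unique l1 (l2.congr fun k => ?_)
  rw [h _ (hφ k)]

/-- The coefficient `α`, equal to `αm` in `D` and to `αp` in the exterior, and to `0` on the null set
that remains. -/
noncomputable def coeff (αm αp : ℝ) (D : Set E3) : E3 → ℝ := fun x =>
  D.indicator (fun _ => αm) x + (exterior D).indicator (fun _ => αp) x

lemma measurable_coeff (αm αp : ℝ) {D : Set E3} (hD : IsOpen D) : Measurable (coeff αm αp D) :=
  (measurable_const.indicator hD.measurableSet).add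
    (measurable_const.indicator (isOpen_exterior D).measurableSet)

lemma abs_coeff_le {αm αp : ℝ} (hm : 0 < αm) (hp : 0 < αp) (D : Set E3) (x : E3) :
    |coeff αm αp D x| ≤ αm + αp := by
  rw [coeff]
  refine (abs_add_le _ _).trans (add_le_add ?_ ?_)
  · rw [← Real.norm_eq_abs]
    exact (norm_indicator_le_norm_self _ _).trans (Real.norm_of_nonneg hm.le).le
  · rw [← Real.norm_eq_abs]
    exact (norm_indicator_le_norm_self _ _).trans (Real.norm_of_nonneg hp.le).le

lemma min_le_coeff (αm αp : ℝ) {D : Set E3} (hD : IsBoundedC11Domain D) :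
    ∀ᵐ x, min αm αp ≤ coeff αm αp D x := by
  rw [← restrict_union_exterior hD]
  filter_upwards [ae_restrict_mem
    (hD.isOpen.union (isOpen_exterior D)).measurableSet] with x hx
  rw [coeff]
  rcases hx with hx | hx
  · rw [indicator_of_mem hx, indicator_of_notMem (disjoint_left.1 (disjoint_exterior D) hx), add_zero]
    exact min_le_left _ _
  · rw [indicator_of_mem hx, indicator_of_notMem (disjoint_right.1 (disjoint_exterior D) hx), zero_add]
    exact min_le_right _ _

lemma NearId.coeff_image {δ : ℝ≥0} {T S : E3 → E3} (h : NearId δ T S) (αm αp : ℝ) (D : Set E3)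
    (y : E3) : coeff αm αp (T '' D) y = coeff αm αp D (S y) := by
  have hm : ∀ U : Set E3, y ∈ T '' U ↔ S y ∈ U := fun U => by
    rw [image_eq_preimage_of_inverse h.left h.right, mem_preimage]
  classical
  simp only [coeff, h.exterior_image, indicator_apply, hm]

lemma integral_coeff_mul (αm αp : ℝ) {D : Set E3} (hD : IsOpen D) {F : E3 → ℝ}
    (hF : Integrable F) :
    ∫ x, coeff αm αp D x * F x = αm * (∫ x in D, F x) + αp * ∫ x in exterior D, F x := by
  have hE := (isOpen_exterior D).measurableSet
  have e : ∀ x, coeff αm αp D x * F x =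
      D.indicator (fun x => αm * F x) x + (exterior D).indicator (fun x => αp * F x) x := fun x => by
    classical
    simp only [coeff, indicator_apply, add_mul, ite_mul, zero_mul]
  simp_rw [e]
  rw [integral_add ((hF.const_mul αm).indicator hD.measurableSet)
    ((hF.const_mul αp).indicator hE), integral_indicator hD.measurableSet,
    integral_indicator hE, integral_const_mul, integral_const_mul]

/-- The weak equation as an equation over the whole space. -/
lemma IsWeakSolution.integral_eq {αm αp : ℝ} {f : E3 → ℝ} {D Γ : Set E3} {u : E3 → ℝ}
    (hD : IsOpen D) (h : IsWeakSolution αm αp f D Γ u) {P : E3 → E3} (hP : MemLp P 2 volume)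
    (hPu : P =ᵐ[volume] glueGrad D u) {φ : E3 → ℝ} (hφ : IsTest φ) :
    ∫ x, coeff αm αp D x * ⟪P x, gradient φ x⟫_ℝ = ∫ x, f x * φ x := by
  rw [integral_coeff_mul αm αp hD (integrable_inner hP hφ.memLp_gradient), ← h.2 φ hφ]
  congr 2
  · refine integral_congr_ae ?_
    filter_upwards [glueGrad_ae_inner hD u, ae_restrict_of_ae hPu] with x h1 h2
    rw [h1, h2]
  · refine integral_congr_ae ?_
    filter_upwards [glueGrad_ae_outer D u, ae_restrict_of_ae hPu] with x h1 h2
    rw [h1, h2]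

lemma NearId.l2Norm_test_comp_sub_le {δ : ℝ≥0} {T S : E3 → E3} (h : NearId δ T S) {ψ : E3 → ℝ}
    (hψ : IsTest ψ) : l2Norm (fun x => ψ (T x) - ψ x) ≤ 3 * δ * l2Norm (gradient ψ) := by
  have h1 := h.lintegral_test_comp_sub_le hψ
  have hfin : ∫⁻ x, ‖gradient ψ x‖ₑ ^ 2 ≠ ⊤ := by
    rw [lintegral_enorm_sq_eq_eLpNorm_sq]
    exact ENNReal.pow_ne_top hψ.memLp_gradient.2.ne
  rw [l2Norm_eq_sqrt, l2Norm_eq_sqrt, Real.sqrt_le_left (by positivity), mul_pow,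
    Real.sq_sqrt ENNReal.toReal_nonneg]
  refine (ENNReal.toReal_mono (by finiteness) h1).trans ?_
  simp only [ENNReal.toReal_mul, ENNReal.toReal_pow, ENNReal.toReal_ofNat, ENNReal.coe_toReal]
  gcongr
  nlinarith [sq_nonneg (δ : ℝ)]

/-- The weak equation in the perturbed configuration, pulled back to the reference configuration,
is the reference equation up to an error of order `δ`. -/
lemma abs_integral_sub_le {δ : ℝ≥0} {T S : E3 → E3} (h : NearId δ T S) {A : E3 → ℝ} {M : ℝ}
    (hA : Measurable A) (hM : ∀ x, |A x| ≤ M) {G G₀ : E3 → E3} (hG : MemLp G 2 volume)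
    (hG₀ : MemLp G₀ 2 volume) {f : E3 → ℝ} (hf : MemLp f 2 volume)
    (h1 : ∀ φ, IsTest φ → ∫ x, A (S x) * ⟪pullGrad S G x, gradient φ x⟫_ℝ = ∫ x, f x * φ x)
    (h2 : ∀ φ, IsTest φ → ∫ x, A x * ⟪G₀ x, gradient φ x⟫_ℝ = ∫ x, f x * φ x)
    {ψ : E3 → ℝ} (hψ : IsTest ψ) :
    |∫ x, A x * ⟪G x - G₀ x, gradient ψ x⟫_ℝ| ≤
      δ * (31 * M * l2Norm G + 3 * l2Norm f) * l2Norm (gradient ψ) := by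
  have hAS : Measurable fun x => A (S x) := hA.comp h.symm.measurableEmbedding.measurable
  obtain ⟨C, hC⟩ := h.symm.exists_lipschitz_comp hψ
  have hcs := h.symm.hasCompactSupport_comp hψ.2
  have e1 := integral_eq_of_lipschitz hAS (fun x => hM _) (h.symm.memLp_pullGrad hG) hf h1 hC hcs
  have e2 : ∫ x, A (S x) * ⟪pullGrad S G x, gradient (fun y => ψ (S y)) x⟫_ℝ =
      ∫ x, A (S x) * ⟪pullGrad S G x, pullGrad S (gradient ψ) x⟫_ℝ := by
    refine integral_congr_ae ?_
    filter_upwards [h.symm.gradient_comp_ae (hψ.contDiff_one.differentiable one_ne_zero)] with x hx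
    rw [hx]
  have b1 := h.symm.abs_integral_inner_pullGrad_sub_le hA hM hG hψ.memLp_gradient
  rw [← e2, e1] at b1
  have mS : MemLp (fun x => ψ (S x)) 2 volume := h.symm.memLp_comp hψ.memLp
  have i1 : Integrable fun x => f x * ψ (S x) := hf.integrable_mul mS
  have i2 : Integrable fun x => f x * ψ x := hf.integrable_mul hψ.memLp
  have b2 : |(∫ x, f x * ψ (S x)) - ∫ x, f x * ψ x| ≤
      l2Norm f * (3 * δ * l2Norm (gradient ψ)) := by
    have md : MemLp (fun x => ψ (S x) - ψ x) 2 volume := mS.sub hψ.memLp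
    rw [← integral_sub i1 i2, ← Real.norm_eq_abs]
    refine (norm_integral_le_of_norm_le (integrable_norm_mul_norm hf md)
      (Eventually.of_forall fun x => ?_)).trans ((integral_norm_mul_norm_le hf md).trans ?_)
    · rw [← mul_sub, norm_mul]
    · exact mul_le_mul_of_nonneg_left (h.symm.l2Norm_test_comp_sub_le hψ) (l2Norm_nonneg _)
  have e3 : ∫ x, A x * ⟪G x - G₀ x, gradient ψ x⟫_ℝ =
      (∫ x, A x * ⟪G x, gradient ψ x⟫_ℝ) - ∫ x, f x * ψ x := by
    rw [← h2 ψ hψ, ← integral_sub (integrable_mul_inner hA hM hG hψ.memLp_gradient)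
      (integrable_mul_inner hA hM hG₀ hψ.memLp_gradient)]
    simp_rw [inner_sub_left, mul_sub]
  rw [e3]
  rw [abs_sub_comm] at b1
  refine (abs_sub_le _ _ _).trans ((add_le_add b1 b2).trans (le_of_eq ?_))
  ring

/-- Coercivity turns the estimate of `abs_integral_sub_le` into an estimate of the difference of
the gradients. -/
lemma l2Norm_sub_le {δ : ℝ≥0} {T S : E3 → E3} (h : NearId δ T S) {A : E3 → ℝ} {M α : ℝ}
    (hA : Measurable A) (hM : ∀ x, |A x| ≤ M) (hα : 0 < α) (hαA : ∀ᵐ x, α ≤ A x)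
    (hδ : 31 * M * δ ≤ α / 2)
    {v : E3 → ℝ} {G G₀ : E3 → E3} (hG : MemLp G 2 volume)
    (hG₀ : MemLp G₀ 2 volume) {f : E3 → ℝ} (hf : MemLp f 2 volume)
    (h1 : ∀ φ, IsTest φ → ∫ x, A (S x) * ⟪pullGrad S G x, gradient φ x⟫_ℝ = ∫ x, f x * φ x)
    (h2 : ∀ φ, IsTest φ → ∫ x, A x * ⟪G₀ x, gradient φ x⟫_ℝ = ∫ x, f x * φ x)
    (hv : HasWeakGrad univ v fun x => G x - G₀ x)
    (he : energy decayWeight univ v (fun x => G x - G₀ x) < ⊤) :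
    l2Norm (fun x => G x - G₀ x) ≤ 2 * δ * (31 * M * l2Norm G₀ + 3 * l2Norm f) / α := by
  set Z : E3 → E3 := fun x => G x - G₀ x
  have hZ : MemLp Z 2 volume := hG.sub hG₀
  obtain ⟨φ, hφ, hφe⟩ := exists_test_tendsto hv he
  have hφ2 : Tendsto (fun k => ∫⁻ x, ‖gradient (φ k) x - Z x‖ₑ ^ 2) atTop (𝓝 0) := by
    simpa using tendsto_sq_of_tendsto_energy hφe
  have l1 := tendsto_integral_inner (memLp_bdd_smul hA hM hZ) (fun k => (hφ k).memLp_gradient) hZ hφ2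
  simp only [real_inner_smul_left] at l1
  set B := δ * (31 * M * l2Norm G + 3 * l2Norm f) with hB
  have hM0 : 0 ≤ M := (abs_nonneg _).trans (hM 0)
  have hB0 : 0 ≤ B := by
    have := l2Norm_nonneg G
    have := l2Norm_nonneg f
    positivity
  have htri : ∀ {g k : E3 → E3}, MemLp g 2 volume → MemLp k 2 volume →
      l2Norm (fun x => g x + k x) ≤ l2Norm g + l2Norm k := fun hg hk => by
    rw [l2Norm, l2Norm, l2Norm, ← ENNReal.toReal_add hg.2.ne hk.2.ne]
    exact ENNReal.toReal_mono (by have := hg.2.ne; have := hk.2.ne; finiteness)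
      (eLpNorm_add_le hg.1 hk.1 one_le_two)
  have l2 : Tendsto (fun k => B * (l2Norm (fun x => gradient (φ k) x - Z x) + l2Norm Z)) atTop
      (𝓝 (B * (0 + l2Norm Z))) := ((tendsto_l2Norm hφ2).add_const _).const_mul _
  rw [zero_add] at l2
  have hle : ∫ x, A x * ⟪Z x, Z x⟫_ℝ ≤ B * l2Norm Z := by
    refine le_of_tendsto_of_tendsto' l1 l2 fun k => ?_
    refine (le_abs_self _).trans ((abs_integral_sub_le h hA hM hG hG₀ hf h1 h2 (hφ k)).trans ?_)
    refine mul_le_mul_of_nonneg_left ?_ hB0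
    have := htri (g := fun x => gradient (φ k) x - Z x) ((hφ k).memLp_gradient.sub hZ) hZ
    simpa only [sub_add_cancel] using this
  have hco : α * l2Norm Z ^ 2 ≤ ∫ x, A x * ⟪Z x, Z x⟫_ℝ := by
    have e : l2Norm Z ^ 2 = ∫ x, ⟪Z x, Z x⟫_ℝ := by
      rw [l2Norm_eq_sqrt, Real.sq_sqrt ENNReal.toReal_nonneg, integral_eq_lintegral_of_nonneg_ae
        (Eventually.of_forall fun x => real_inner_self_nonneg) (integrable_inner hZ hZ).1]
      congr 1
      refine lintegral_congr fun x => ?_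
      rw [real_inner_self_eq_norm_sq, ENNReal.ofReal_pow (norm_nonneg _), ofReal_norm]
    rw [e, ← integral_const_mul]
    refine integral_mono_ae ((integrable_inner hZ hZ).const_mul α)
      (integrable_mul_inner hA hM hZ hZ) ?_
    filter_upwards [hαA] with x hx
    exact mul_le_mul_of_nonneg_right hx real_inner_self_nonneg
  have hZ0 := l2Norm_nonneg Z
  have hGn : l2Norm G ≤ l2Norm Z + l2Norm G₀ := by
    have := htri hZ hG₀
    simpa [Z] using this
  -- Cancelling one factor `l2Norm Z`; `hδ` then absorbs the part of `B` that contains `l2Norm Z`.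
  have hlin : α * l2Norm Z ≤ B := by
    rcases hZ0.eq_or_lt with h0 | h0
    · rw [← h0, mul_zero]; exact hB0
    · refine le_of_mul_le_mul_right ?_ h0
      nlinarith
  rw [le_div_iff₀ hα]
  have h3 : 31 * M * δ * l2Norm G ≤ 31 * M * δ * (l2Norm Z + l2Norm G₀) := by gcongr
  have h4 := mul_le_mul_of_nonneg_right hδ hZ0
  nlinarith

/-- The norm of `W` is bounded by the norm of the gradient: the weight is bounded on the bounded set
`D`, and Hardy's inequality applies on the whole space. -/
lemma wNorm_le {D : Set E3} (hD : IsBoundedC11Domain D) :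
    ∃ K : ℝ≥0, ∀ (v : E3 → ℝ) (G : E3 → E3), HasWeakGrad univ v G →
      energy decayWeight univ v G < ⊤ → wNorm D v ≤ K * eLpNorm G 2 volume := by
  obtain ⟨R, hR⟩ := hD.isBounded.exists_norm_le
  have hinner : ∀ (v : E3 → ℝ) (G : E3 → E3), energy unitWeight D v G ≤
      ENNReal.ofReal (1 + R ^ 2) * energy decayWeight D v G := fun v G => by
    unfold energy
    rw [← lintegral_const_mul' _ _ ENNReal.ofReal_ne_top]
    refine setLIntegral_mono' hD.isOpen.measurableSet fun x hx => ?_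
    have h1 : decayWeight x ≤ 1 + R ^ 2 := by
      have := hR x hx
      unfold decayWeight
      gcongr
    have h2 : ENNReal.ofReal (decayWeight x) ≤ ENNReal.ofReal (1 + R ^ 2) :=
      ENNReal.ofReal_le_ofReal h1
    rw [mul_add]
    refine add_le_add (le_mul_of_one_le_left zero_le ?_) ?_
    · rw [← ENNReal.ofReal_one]
      exact ENNReal.ofReal_le_ofReal (by nlinarith [sq_nonneg R])
    · rw [unitWeight, ENNReal.ofReal_one, div_one, ← mul_div_assoc,
        ENNReal.le_div_iff_mul_le (Or.inl (isWeight_decayWeight.ofReal_ne_zero x))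
        (Or.inl ENNReal.ofReal_ne_top), mul_comm]
      gcongr
  refine ⟨((1 + R ^ 2).toNNReal * 42) ^ (1 / 2 : ℝ), fun v G hv he => ?_⟩
  have h1 : h1NormSq D v + h1wNormSq (exterior D) v ≤
      ((((1 + R ^ 2).toNNReal * 42 : ℝ≥0)) : ℝ≥0∞) * eLpNorm G 2 volume ^ 2 := by
    rw [h1NormSq_eq_energy, h1wNormSq_eq_energy,
      energy_weakGrad hD.isOpen (hv.mono (subset_univ D)),
      energy_weakGrad (isOpen_exterior D) (hv.mono (subset_univ _)),
      ← lintegral_enorm_sq_eq_eLpNorm_sq]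
    have hone : 1 ≤ ENNReal.ofReal (1 + R ^ 2) := by
      rw [← ENNReal.ofReal_one]
      exact ENNReal.ofReal_le_ofReal (by nlinarith [sq_nonneg R])
    calc _ ≤ ENNReal.ofReal (1 + R ^ 2) * energy decayWeight D v G +
          ENNReal.ofReal (1 + R ^ 2) * energy decayWeight (exterior D) v G :=
          add_le_add (hinner v G) (le_mul_of_one_le_left zero_le hone)
      _ = ENNReal.ofReal (1 + R ^ 2) * energy decayWeight univ v G := by
          rw [← mul_add]
          congr 1
          simp only [energy]
          rw [Measure.restrict_univ, ← lintegral_eq_add_exterior hD]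
      _ ≤ ENNReal.ofReal (1 + R ^ 2) * (42 * ∫⁻ x, ‖G x‖ₑ ^ 2) := by
          gcongr
          exact energy_le_of_hasWeakGrad hv he
      _ = _ := by
          push_cast
          rw [mul_assoc]
          rfl
  rw [wNorm]
  refine (ENNReal.rpow_le_rpow h1 (by norm_num)).trans (le_of_eq ?_)
  rw [ENNReal.mul_rpow_of_nonneg _ _ (by norm_num), ← ENNReal.rpow_natCast, ← ENNReal.rpow_mul,
    ENNReal.coe_rpow_of_nonneg _ (by norm_num)]
  norm_num

/-! ### Convergence of the solutions -/

lemma perturbedInterface_eq {D : Set E3} {κ κt : E3 → ℝ} {n nt : E3 → E3}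
    (hκ : EqOn κt κ (interface D)) (hn : EqOn nt n (interface D)) (ε : ℝ) :
    perturbedInterface (interface D) κ n ε = perturbMap κt nt ε '' interface D :=
  image_congr fun x hx => by rw [perturbMap, hκ hx, hn hx]

lemma perturbMap_zero (κt : E3 → ℝ) (nt : E3 → E3) : perturbMap κt nt 0 = id := by
  funext x; simp [perturbMap]

/-- The solution of the problem perturbed by a map close to the identity, pulled back to the
reference configuration, lies in `W` and differs little from the reference solution. -/
lemma exists_wNorm_comp_sub_le {D : Set E3} (hD : IsBoundedC11Domain D) {αm αp : ℝ} (hαm : 0 < αm)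
    (hαp : 0 < αp) {f : E3 → ℝ} (hf : MemLp f 2 volume) {u₀ : E3 → ℝ}
    (hu₀ : IsWeakSolution αm αp f D (interface D) u₀) :
    ∃ (c : ℝ≥0) (K : ℝ), 0 < c ∧ ∀ (δ : ℝ≥0) (T S : E3 → E3) (u : E3 → ℝ), NearId δ T S → δ ≤ c →
      IsWeakSolution αm αp f (T '' D) (T '' interface D) u →
      MemW D (interface D) (u ∘ T) ∧ wNorm D (u ∘ T - u₀) ≤ ENNReal.ofReal (K * δ) := by
  have hG₀ := hu₀.1.hasGradW hD.isOpen
  set G₀ := glueGrad D u₀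
  have hα : 0 < min αm αp := lt_min hαm hαp
  obtain ⟨K, hK⟩ := wNorm_le hD
  refine ⟨(min αm αp / (62 * (αm + αp))).toNNReal,
    K * (2 * (31 * (αm + αp) * l2Norm G₀ + 3 * l2Norm f) / min αm αp), ?_,
    fun δ T S u h hδ hu => ?_⟩
  · rw [Real.toNNReal_pos]
    positivity
  have hδ' : 31 * (αm + αp) * δ ≤ min αm αp / 2 := by
    rw [← NNReal.coe_le_coe, Real.coe_toNNReal _ (by positivity), le_div_iff₀ (by positivity)] at hδ
    linarith
  have hΓ : μH[2] (interface D) < ⊤ :=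
    (measure_mono (interface_subset_frontier hD.isOpen)).trans_lt
      (hausdorffMeasure_frontier_lt_top hD)
  have hG := h.hasGradW_comp hD.isOpen hΓ (hu.1.hasGradW (h.isOpen_image hD.isOpen))
  set G := pullGrad T (glueGrad (T '' D) u)
  have mG := hG.memLp hD
  have mG₀ := hG₀.memLp hD
  have hA := measurable_coeff αm αp hD.isOpen
  have hM := abs_coeff_le hαm hαp D
  have h1 : ∀ φ, IsTest φ → ∫ x, coeff αm αp D (S x) * ⟪pullGrad S G x, gradient φ x⟫_ℝ =
      ∫ x, f x * φ x := fun φ hφ => by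
    simp_rw [← h.coeff_image]
    exact hu.integral_eq (h.isOpen_image hD.isOpen) (h.symm.memLp_pullGrad mG)
      (h.pullGrad_pullGrad_ae _) hφ
  have h2 : ∀ φ, IsTest φ → ∫ x, coeff αm αp D x * ⟪G₀ x, gradient φ x⟫_ℝ = ∫ x, f x * φ x :=
    fun φ hφ => hu₀.integral_eq hD.isOpen mG₀ (ae_eq_refl _) hφ
  have hv := (hG.hasWeakGrad hD).sub (hG₀.hasWeakGrad hD)
  have he : energy decayWeight univ (fun x => u (T x) - u₀ x) (fun x => G x - G₀ x) < ⊤ := by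
    have := energy_add_le isWeight_decayWeight (U := univ) (v := fun x => u (T x))
      (v' := fun x => -u₀ x) (g := G) (g' := fun x => -G₀ x)
      (hG.hasWeakGrad hD).1.aestronglyMeasurable (hG.hasWeakGrad hD).2.1.aestronglyMeasurable
    simp only [← sub_eq_add_neg] at this
    refine this.trans_lt (ENNReal.add_lt_top.2 ⟨ENNReal.mul_lt_top (by norm_num)
      (hG.energy_lt_top hD), ENNReal.mul_lt_top (by norm_num) ?_⟩)
    have := hG₀.energy_lt_top hD
    simpa only [energy, enorm_neg] using this
  refine ⟨hG.memW hD.isOpen, (hK (u ∘ T - u₀) (fun x => G x - G₀ x) hv he).trans ?_⟩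
  have hle := l2Norm_sub_le h hA hM hα (min_le_coeff αm αp hD) hδ' mG mG₀ hf h1 h2 hv he
  have hfin : eLpNorm (fun x => G x - G₀ x) 2 volume ≠ ⊤ := (mG.sub mG₀).2.ne
  rw [← ENNReal.ofReal_toReal hfin, ← ENNReal.ofReal_coe_nnreal,
    ← ENNReal.ofReal_mul K.coe_nonneg]
  refine ENNReal.ofReal_le_ofReal ?_
  refine (mul_le_mul_of_nonneg_left hle K.coe_nonneg).trans (le_of_eq ?_)
  ring

end Transmission

open Transmission
theorem mainTheorem4
    (D : Set E3) (hD : IsBoundedC11Domain D)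
    (n : E3 → E3) (hn : ∀ x ∈ interface D, IsOutwardUnitNormal D x (n x))
    (κ : E3 → ℝ) (hκ : IsC1On (interface D) κ)
    (κt : E3 → ℝ) (hκt : ContDiff ℝ 1 κt) (hκt_supp : HasCompactSupport κt)
    (hκt_ext : EqOn κt κ (interface D))
    (nt : E3 → E3) (hnt : LocallyLipschitz nt) (hnt_ext : EqOn nt n (interface D))
    (αm αp : ℝ) (hαm : 0 < αm) (hαp : 0 < αp)
    (f : E3 → ℝ) (hf : MemLp f 2 volume) (hf_dual : MemWDual D (interface D) f)
    (ε₀ : ℝ) (hε₀ : 0 < ε₀) (u : ℝ → E3 → ℝ)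
    (hu : ∀ ε ∈ Ico 0 ε₀,
      IsWeakSolution αm αp f (perturbMap κt nt ε '' D)
        (perturbedInterface (interface D) κ n ε) (u ε)) :
    (∀ᶠ ε in 𝓝[>] (0 : ℝ), MemW D (interface D) (u ε ∘ perturbMap κt nt ε)) ∧
      Tendsto (fun ε => wNorm D (u ε ∘ perturbMap κt nt ε - u 0)) (𝓝[>] (0 : ℝ)) (𝓝 0) := by
  simp_rw [perturbedInterface_eq hκt_ext hnt_ext] at hu
  have hu₀ := hu 0 ⟨le_rfl, hε₀⟩
  rw [perturbMap_zero, image_id, image_id] at hu₀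
  obtain ⟨c, K, hc, hcK⟩ := exists_wNorm_comp_sub_le hD hαm hαp hf hu₀
  obtain ⟨C, hC⟩ := exists_nearId_perturbMap hκt hκt_supp hnt
  have hlim : Tendsto (fun ε : ℝ => C * ε.toNNReal) (𝓝[>] 0) (𝓝 0) := by
    have : Continuous fun ε : ℝ => C * ε.toNNReal := by fun_prop
    simpa using (this.tendsto 0).mono_left nhdsWithin_le_nhds
  have hev : ∀ᶠ ε in 𝓝[>] (0 : ℝ), MemW D (interface D) (u ε ∘ perturbMap κt nt ε) ∧
      wNorm D (u ε ∘ perturbMap κt nt ε - u 0) ≤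
        ENNReal.ofReal (K * (C * ε.toNNReal : ℝ≥0)) := by
    filter_upwards [hlim.eventually_le_const hc, hlim.eventually_le_const
      (by norm_num : (0 : ℝ≥0) < 1 / 2), Ioo_mem_nhdsGT hε₀] with ε h1 h2 h3
    obtain ⟨S, hS⟩ := hC ε.toNNReal h2
    rw [Real.coe_toNNReal ε h3.1.le] at hS
    exact hcK _ _ S (u ε) hS h1 (hu ε ⟨h3.1.le, h3.2⟩)
  refine ⟨hev.mono fun _ h => h.1, ?_⟩
  refine tendsto_of_tendsto_of_tendsto_of_le_of_le' tendsto_const_nhds ?_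
    (Eventually.of_forall fun _ => zero_le) (hev.mono fun _ h => h.2)
  have := ENNReal.tendsto_ofReal ((NNReal.tendsto_coe.2 hlim).const_mul K)
  simpa using this
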